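/- **Conventions.** A *post-selected circuit* on $n$ qubits carries a designated output qubit and a post-selection register (a set of qubits not containing the output qubit); all qubits are measured in the computational basis, and outcomes are conditioned on the post-selection register returning $0\cdots0$. Quantum circuits are circuits over the gate set $\{H, T^\dagger, CZ\}$ started in $|0^n\rangle$. A *depth-$p$ QAOA circuit* is given by a cost function $C=\sum_i C_i$ on $\{0,1\}^n$, with each $C_i$ integer-valued and depending on at most two variables, and by angles $\beta_1,\gamma_1,\dots,\beta_p,\gamma_p\in\frac{\pi}{4}\mathbf Z$; it prepares $$e^{-i\beta_p B}e^{-i\gamma_p C}\cdots e^{-i\beta_1 B}e^{-i\gamma_1 C}|+\rangle^{\otimes n},\qquad B=\sum_j X_j .$$ Its *interaction graph* has vertex set $[n]$ and an edge $\{j,k\}$, $j\ne k$, whenever some single term $C_i$ depends on both variables $j$ and $k$ (flipping bit $j$ can change $C_i$, and flipping bit $k$ can change $C_i$); its *interaction degree* is the maximum degree of this graph. A family of post-selected circuits indexed by the inputs $w\in\{0,1\}^*$ is *uniform* if a Turing machine computes the description of the circuit for $w$ from $w$ in time polynomial in $|w|$ (qubit numbers are written in unary and integers in binary). A family *decides*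 a language $L$ *with error $\epsilon$* if for every $w$ the post-selection probability is nonzero and, conditioned on post-selection, the output qubit is $1$ with probability at least $1-\epsilon$ if $w\in L$, and is $0$ with probability at least $1-\epsilon$ if $w\notin L$. $\mathsf{PostBQP}$ is the class of languages decided, with some constant error $0<\epsilon<\frac12$, by a uniform family of post-selected quantum circuits; $\mathsf{PostQAOA}_p^{\deg\le d}$ is the class of languages decided, with some constant error $0<\epsilon<\frac12$, by a uniform family of post-selected depth-$p$ QAOA circuits of interaction degree at most $d$. **Theorem.** 1. Every language in $\mathsf{PostBQP}$ is decided, with some constant error $0<\epsilon<\frac12$, by a uniform family of post-selected depth-$1$ QAOA circuits with $\beta=\gamma=\frac{\pi}{4}$ and interaction degree at most $3$. 2. $\mathsf{PostQAOA}_1^{\deg\le 3}=\mathsf{PostBQP}$. 3. There is a polynomial-time computable map $R$ from (descriptions of) post-selected quantum circuits to (descriptions of) post-selected depth-$1$ QAOA circuits with $\beta=\gamma=\frac{\pi}{4}$ and interaction degree at most $3$ that preserves the post-selected output distribution exactly: for every post-selected quantum circuit $\mathcal C$, the post-selection probability of $R(\mathcal C)$ is nonzero if and only if that of $\mathcal C$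 is, and there is an injection $\iota$ of the qubits of $\mathcal C$ into those of $R(\mathcal C)$, taking the output qubit to the output qubit, such that (if these probabilities are nonzero) the conditional joint distribution of the measured values of the qubits $\iota(1),\dots,\iota(n)$ in $R(\mathcal C)$ equals that of the qubits $1,\dots,n$ in $\mathcal C$. -/

import Mathlib

namespace PostSel

/-! ## Amplitude vectors, measurement and post-selection -/

/-- Amplitude vectors of `n` qubits in the computational basis. -/
abbrev State (n : ℕ) : Type := (Fin n → Bool) → ℂ

open Classical in
/-- Probability that a computational-basis measurement of `ψ` gives an outcome in `E`. -/
noncomputable def prob {n : ℕ} (ψ : State n) (E : Set (Fin n → Bool)) : ℝ :=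
  ∑ z : Fin n → Bool, if z ∈ E then ‖ψ z‖ ^ 2 else 0

/-- A designated output qubit together with a post-selection register. -/
structure Readout (n : ℕ) where
  out : Fin n
  post : Finset (Fin n)
  out_notMem : out ∉ post

/-- The event that the whole post-selection register returns `0⋯0`. -/
def Readout.postEvent {n : ℕ} (r : Readout n) : Set (Fin n → Bool) :=
  {z | ∀ i ∈ r.post, z i = false}

/-- Probability of `E` conditioned on successful post-selection. -/
noncomputable def condProb {n : ℕ} (ψ : State n) (r : Readout n) (E : Set (Fin n → Bool)) : ℝ :=
  prob ψ (E ∩ r.postEvent) / prob ψ r.postEvent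

/-- The post-selected measurement of `ψ` answers the question `yes` with error at most `ε`. -/
def Answers {n : ℕ} (ψ : State n) (r : Readout n) (ε : ℝ) (yes : Prop) : Prop :=
  prob ψ r.postEvent ≠ 0 ∧
    (yes → 1 - ε ≤ condProb ψ r {z | z r.out = true}) ∧
    (¬ yes → 1 - ε ≤ condProb ψ r {z | z r.out = false})

/-! ## Circuits over the gate set `{H, T†, CZ}` -/

/-- A gate from `{H, T†, CZ}` placed on a register of `n` qubits. -/
inductive Gate (n : ℕ) : Type
  | H (i : Fin n)
  | Tdg (i : Fin n)
  | CZ (i j : Fin n) (h : i ≠ j)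

/-- The action of a gate on amplitude vectors. -/
noncomputable def Gate.apply {n : ℕ} : Gate n → State n → State n
  | .H i, ψ => fun z =>
      (ψ (Function.update z i false) +
        (if z i then -1 else 1) * ψ (Function.update z i true)) / (Real.sqrt 2 : ℂ)
  | .Tdg i, ψ => fun z => (if z i then Complex.exp (-(Complex.I * (Real.pi / 4))) else 1) * ψ z
  | .CZ i j _, ψ => fun z => (if z i && z j then -1 else 1) * ψ z

/-- A post-selected quantum circuit; the head of `gates` is applied first. -/
structure Circuit where
  n : ℕ
  readout : Readout n
  gates : List (Gate n)

/-- The final state of the circuit started in `|0⋯0⟩`. -/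
noncomputable def Circuit.state (C : Circuit) : State C.n :=
  C.gates.foldl (fun ψ g => g.apply ψ) (fun z => if z = fun _ => false then 1 else 0)

/-! ## QAOA -/

/-- The operator `B = ∑ⱼ Xⱼ`. -/
noncomputable def mixer (n : ℕ) : Matrix (Fin n → Bool) (Fin n → Bool) ℂ :=
  ∑ j : Fin n, Matrix.of fun z z' => if z = Function.update z' j (!z' j) then 1 else 0

/-- The state `e^{-iβ_p B} e^{-iγ_p C} ⋯ e^{-iβ_1 B} e^{-iγ_1 C} |+⟩^{⊗n}`; the list contains the
pairs `(β_1, γ_1), …, (β_p, γ_p)` in this order. -/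
noncomputable def qaoaState {n : ℕ} (cost : (Fin n → Bool) → ℝ) (angles : List (ℝ × ℝ)) :
    State n :=
  angles.foldl
    (fun ψ a =>
      (NormedSpace.exp ((-(Complex.I * (a.1 : ℂ))) • mixer n)).mulVec
        ((NormedSpace.exp ((-(Complex.I * (a.2 : ℂ))) •
          Matrix.diagonal fun z => ((cost z : ℝ) : ℂ))).mulVec ψ))
    (fun _ => (1 / (Real.sqrt 2 : ℂ)) ^ n)

/-- An integer-valued term of a cost function, depending on at most two of the `n` variables and
given by its table of values. -/
inductive Term (n : ℕ) : Type
  | one (i : Fin n) (v : Bool → ℤ)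
  | two (i j : Fin n) (h : i ≠ j) (v : Bool → Bool → ℤ)

def Term.eval {n : ℕ} : Term n → (Fin n → Bool) → ℤ
  | .one i v, z => v (z i)
  | .two i j _ v, z => v (z i) (z j)

/-- Flipping bit `j` can change the value of the term. -/
def Term.DependsOn {n : ℕ} (t : Term n) (j : Fin n) : Prop :=
  ∃ z : Fin n → Bool, t.eval (Function.update z j (!z j)) ≠ t.eval z

/-- A post-selected QAOA circuit with a finite exact description: the cost function is a sum of
integer-valued terms, and an entry `(b, c)` of `layers` stands for the angles
`β = b π / 4`, `γ = c π / 4`. -/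
structure QAOA where
  n : ℕ
  readout : Readout n
  layers : List (ℤ × ℤ)
  terms : List (Term n)

def QAOA.depth (Q : QAOA) : ℕ := Q.layers.length

def QAOA.cost (Q : QAOA) (z : Fin Q.n → Bool) : ℤ := (Q.terms.map fun t => t.eval z).sum

/-- The pairs `(β_k, γ_k)`. -/
noncomputable def QAOA.angles (Q : QAOA) : List (ℝ × ℝ) :=
  Q.layers.map fun l => ((l.1 : ℝ) * (Real.pi / 4), (l.2 : ℝ) * (Real.pi / 4))

noncomputable def QAOA.state (Q : QAOA) : State Q.n :=
  qaoaState (fun z => (Q.cost z : ℝ)) Q.angles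

/-- Distinct variables are adjacent when some term depends on both of them. -/
def QAOA.interactionGraph (Q : QAOA) : SimpleGraph (Fin Q.n) where
  Adj j k := j ≠ k ∧ ∃ t ∈ Q.terms, t.DependsOn j ∧ t.DependsOn k
  symm := ⟨fun _ _ h => ⟨h.1.symm, h.2.imp fun _ ht => ⟨ht.1, ht.2.2, ht.2.1⟩⟩⟩
  loopless := ⟨fun _ h => h.1 rfl⟩

/-- The maximum vertex degree of the interaction graph. -/
noncomputable def QAOA.interactionDegree (Q : QAOA) : ℕ :=
  Finset.univ.sup fun v : Fin Q.n => (Q.interactionGraph.neighborSet v).ncard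

/-! ## Descriptions as strings over a finite alphabet -/

inductive Tok : Type
  | zero | one | sep | gateH | gateT | gateCZ | layer | termOne | termTwo
  deriving DecidableEq

instance : Fintype Tok where
  elems := {.zero, .one, .sep, .gateH, .gateT, .gateCZ, .layer, .termOne, .termTwo}
  complete x := by cases x <;> decide

def encodeBit (b : Bool) : Tok := if b then .one else .zero

/-- Numbers of qubits and qubit indices are written in unary. -/
def encodeNat (k : ℕ) : List Tok := List.replicate k .one ++ [.sep]

/-- Integers are written as a sign bit and the binary digits of the absolute value, the least
significant one first. -/
def encodeInt (v : ℤ) : List Tok :=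
  encodeBit (decide (v < 0)) :: v.natAbs.bits.map encodeBit ++ [.sep]

/-- The output qubit, then the characteristic vector of the post-selection register. -/
def Readout.encode {n : ℕ} (r : Readout n) : List Tok :=
  encodeNat r.out ++ List.ofFn fun i : Fin n => encodeBit (decide (i ∈ r.post))

def Gate.encode {n : ℕ} : Gate n → List Tok
  | .H i => .gateH :: encodeNat i
  | .Tdg i => .gateT :: encodeNat i
  | .CZ i j _ => .gateCZ :: encodeNat i ++ encodeNat j

def Circuit.encode (C : Circuit) : List Tok :=
  encodeNat C.n ++ C.readout.encode ++ C.gates.flatMap Gate.encode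

def Term.encode {n : ℕ} : Term n → List Tok
  | .one i v => .termOne :: encodeNat i ++ encodeInt (v false) ++ encodeInt (v true)
  | .two i j _ v => .termTwo :: encodeNat i ++ encodeNat j ++
      encodeInt (v false false) ++ encodeInt (v false true) ++
      encodeInt (v true false) ++ encodeInt (v true true)

def QAOA.encode (Q : QAOA) : List Tok :=
  encodeNat Q.n ++ Q.readout.encode ++
    (Q.layers.flatMap fun l => .layer :: encodeInt l.1 ++ encodeInt l.2) ++
    Q.terms.flatMap Term.encode

/-! ## Uniform families and complexity classes -/

/-- `f` is computed by a Turing machine in time polynomial in the length of the encoded input. -/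
def PolyTime {α β Γ₀ Γ₁ : Type} (ea : α → List Γ₀) (eb : β → List Γ₁) (f : α → β) : Prop :=
  Nonempty (Turing.TM2ComputableInPolyTime ea eb f)

/-- A uniform family of post-selected circuits: the description of the circuit for the input `w`
is computed from `w` in polynomial time. -/
def UniformCircuits (C : List Bool → Circuit) : Prop := PolyTime id Circuit.encode C

/-- A uniform family of post-selected QAOA circuits. -/
def UniformQAOA (Q : List Bool → QAOA) : Prop := PolyTime id QAOA.encode Q

def PostBQP : Set (Language Bool) :=
  {L | ∃ ε : ℝ, 0 < ε ∧ ε < 1 / 2 ∧ ∃ C : List Bool → Circuit, UniformCircuits C ∧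
    ∀ w, Answers (C w).state (C w).readout ε (w ∈ L)}

/-- The class `PostQAOA_p^{deg ≤ d}`. -/
def PostQAOA (p d : ℕ) : Set (Language Bool) :=
  {L | ∃ ε : ℝ, 0 < ε ∧ ε < 1 / 2 ∧ ∃ Q : List Bool → QAOA, UniformQAOA Q ∧
    ∀ w, (Q w).depth = p ∧ (Q w).interactionDegree ≤ d ∧
      Answers (Q w).state (Q w).readout ε (w ∈ L)}

end PostSel

/-! Up to phases, one mixing layer at β = π/4 is a Hadamard transform: on each qubit the kernel of
e^{-iπX/4} is (1/√2)(-i)^z(-i)^x(-1)^{zx} (`mixer_kernel`). With γ = π/4 and ω = e^{-iπ/4}, the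
amplitude of z is therefore a nonzero constant, times a unit phase, times the sum over x of
(-i)^{|x|} ω^{C(x)} (-1)^{x·z} (`qaoaState_pi_div_four`). Post-selecting a variable on 0 removes its
factor (-1)^{xz} and leaves a free summation variable, so the circuit can be written as a sum over
paths.

For a circuit with n qubits and m gates take 2m+3 layers of n variables and post-select all but the
last layer on 0. The term 4xy - 2x between corresponding variables of consecutive layers contributes
(-1)^{xy} i^x: a Hadamard step, with the unwanted (-i)^x cancelled. The term -2x does the cancelling
in the last layer. Summing over layer 0 forces layer 1 to be 0⋯0, the initial state. Each gate
occupies two steps, and two Hadamard transforms compose to a multiple of the identity, so a diagonal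
gate is just an extra phase on the first of its layers: x for T†, 4xy for CZ. For H, the phases 2x,
2y, 2u on the three layers concerned realise S†·(H S† H)·S†, a multiple of H. The last link and the
mixer again compose to a multiple of the identity. Thus the post-selected amplitudes are those of
the circuit up to one constant and phases depending on z (`sum_gatePhase`, `sum_pathPhase`,
`phase_mul_cost`, `Circuit.state_toQAOA`), and conditional distributions agree exactly. A variable
meets the previous layer, the next layer and at most one CZ partner, hence degree at most 3
(`Circuit.interactionDegree_toQAOA`).

Conversely, at depth one with angles bπ/4 and cπ/4 only residues modulo 8 matter. A term in two
variables is an affine part plus a multiple of xy; the phase ω^{kxy} is produced by writing the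
conjunction on an ancilla with a relative-phase Toffoli, applying a power of T†, and running the
same gates again, which restores the ancilla and cancels the relative phase (`run_andOps_zero`,
`run_andOps`, `run_termGates`). The mixer is H diag(1, ω^{-2b}) H on each qubit up to a global
phase. So the state is reproduced up to a unit scalar (`QAOA.state_toCircuit`).

Both maps must be computed by actual stack machines. They are written in a small structured language
whose programs compile to such machines with the same step count (`Prog.Runs.steps`,
`Prog.polyTime`). Closure of polynomial time under composition (`PolyTime.comp`) then carries
uniform families to uniform families. -/

namespace PostSel

/-! ### Stack machines: counted runs and closure of polynomial time under composition. -/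

open Turing

/-! ## Counted runs of a transition function -/

/-- `f` leads from the first state to the second one in exactly the given number of steps. -/
inductive Steps {σ : Type*} (f : σ → Option σ) : ℕ → σ → σ → Prop
  | refl (a : σ) : Steps f 0 a a
  | head {n : ℕ} {a b c : σ} : f a = some b → Steps f n b c → Steps f (n + 1) a c

namespace Steps

variable {σ : Type*} {f : σ → Option σ}

theorem single {a b : σ} (h : f a = some b) : Steps f 1 a b := .head h (.refl b)

theorem trans {m n : ℕ} {a b c : σ} (h₁ : Steps f m a b) (h₂ : Steps f n b c) :
    Steps f (m + n) a c := by
  induction h₁ with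
  | refl a => simpa using h₂
  | @head k a b' c' h _ ih => rw [Nat.add_right_comm]; exact .head h (ih h₂)

theorem iterate_none (n : ℕ) : (flip bind f)^[n] none = none := by
  induction n with
  | zero => rfl
  | succ n ih => rw [Function.iterate_succ_apply]; exact ih

/-- The inductive form is convenient for concatenating and transporting runs; the iterate form is
the one stored in `TM2ComputableInPolyTime`. -/
theorem iff_iterate {n : ℕ} {a b : σ} :
    Steps f n a b ↔ (flip bind f)^[n] (some a) = some b := by
  constructor
  · intro h
    induction h with
    | refl a => rfl
    | head h _ ih => rw [Function.iterate_succ_apply]; simpa [flip, h] using ih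
  · intro h
    induction n generalizing a with
    | zero => cases h; exact .refl _
    | succ n ih =>
      rw [Function.iterate_succ_apply] at h
      cases hfa : f a with
      | none =>
        have : flip bind f (some a) = none := by simp [flip, hfa]
        rw [this, iterate_none] at h
        cases h
      | some a' =>
        refine .head hfa (ih ?_)
        have : flip bind f (some a) = some a' := by simp [flip, hfa]
        rwa [this] at h

/-- A map between state spaces that commutes with single steps transports runs. -/
theorem map {τ : Type*} {g : τ → Option τ} (e : σ → τ)
    (he : ∀ a b, f a = some b → g (e a) = some (e b)) {n : ℕ} {a b : σ} (h : Steps f n a b) :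
    Steps g n (e a) (e b) := by
  induction h with
  | refl a => exact .refl _
  | head h _ ih => exact .head (he _ _ h) ih

end Steps

/-! ## Initial and final configurations -/

section Lists

variable (tm : FinTM2)

theorem initList_stk_self (s : List (tm.Γ tm.k₀)) : (initList tm s).stk tm.k₀ = s := by
  simp [initList]

theorem initList_stk_of_ne (s : List (tm.Γ tm.k₀)) {k : tm.K} (h : k ≠ tm.k₀) :
    (initList tm s).stk k = [] := by
  simp [initList, h]

theorem haltList_stk_self (s : List (tm.Γ tm.k₁)) : (haltList tm s).stk tm.k₁ = s := by
  simp [haltList]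

theorem haltList_stk_of_ne (s : List (tm.Γ tm.k₁)) {k : tm.K} (h : k ≠ tm.k₁) :
    (haltList tm s).stk k = [] := by
  simp [haltList, h]

theorem eq_initList {c : tm.Cfg} {s : List (tm.Γ tm.k₀)} (hl : c.l = some tm.main)
    (hv : c.var = tm.initialState) (hs : c.stk tm.k₀ = s) (hne : ∀ k, k ≠ tm.k₀ → c.stk k = []) :
    c = initList tm s := by
  obtain ⟨l, v, S⟩ := c
  change l = _ at hl
  change v = _ at hv
  subst hl hv
  have : S = (initList tm s).stk := by
    funext k
    by_cases h : k = tm.k₀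
    · subst h; rw [initList_stk_self]; exact hs
    · rw [initList_stk_of_ne _ _ h]; exact hne k h
  rw [this]; rfl

theorem eq_haltList {c : tm.Cfg} {s : List (tm.Γ tm.k₁)} (hl : c.l = none)
    (hv : c.var = tm.initialState) (hs : c.stk tm.k₁ = s) (hne : ∀ k, k ≠ tm.k₁ → c.stk k = []) :
    c = haltList tm s := by
  obtain ⟨l, v, S⟩ := c
  change l = _ at hl
  change v = _ at hv
  subst hl hv
  have : S = (haltList tm s).stk := by
    funext k
    by_cases h : k = tm.k₁
    · subst h; rw [haltList_stk_self]; exact hs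
    · rw [haltList_stk_of_ne _ _ h]; exact hne k h
  rw [this]; rfl

end Lists

/-! ## Growth of the stacks -/

section Growth

variable {K : Type} [DecidableEq K] {Γ : K → Type} {Λ σ : Type}

/-- The number of `push` instructions in a statement. -/
def pushCount : TM2.Stmt Γ Λ σ → ℕ
  | .push _ _ q => pushCount q + 1
  | .peek _ _ q => pushCount q
  | .pop _ _ q => pushCount q
  | .load _ q => pushCount q
  | .branch _ q₁ q₂ => pushCount q₁ + pushCount q₂
  | .goto _ => 0
  | .halt => 0

/-- A single machine step executes a whole statement and may push several symbols. Counting both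
branches of a `branch` is wasteful but sufficient. -/
theorem length_stepAux_le (q : TM2.Stmt Γ Λ σ) (v : σ) (S : ∀ k, List (Γ k)) (k : K) :
    ((TM2.stepAux q v S).stk k).length ≤ (S k).length + pushCount q := by
  induction q generalizing v S with
  | push k' f q ih =>
    refine (ih _ _).trans ?_
    by_cases h : k = k'
    · subst h; simp [pushCount]; omega
    · simp [pushCount, h]
  | peek k' f q ih => exact ih _ _
  | pop k' f q ih =>
    refine (ih _ _).trans ?_
    by_cases h : k = k'
    · subst h; simp [pushCount]
    · simp [pushCount, h]
  | load f q ih => exact ih _ _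
  | branch f q₁ q₂ ih₁ ih₂ =>
    simp only [TM2.stepAux, pushCount]
    cases f v
    · exact (ih₂ _ _).trans (by omega)
    · exact (ih₁ _ _).trans (by omega)
  | goto f => simp [pushCount]
  | halt => simp [pushCount]

/-- There are finitely many labels, so the total number of pushes in the program bounds what one
step can add. This is how an output length is controlled by a running time. -/
theorem Steps.length_stk_le [Fintype Λ] {M : Λ → TM2.Stmt Γ Λ σ} {n : ℕ} {a b : TM2.Cfg Γ Λ σ}
    (h : Steps (TM2.step M) n a b) (k : K) :
    (b.stk k).length ≤ (a.stk k).length + n * ∑ l, pushCount (M l) := by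
  induction h with
  | refl a => simp
  | @head n a b c h _ ih =>
    obtain ⟨l, v, S⟩ := a
    cases l with
    | none => simp at h
    | some l =>
      simp only [TM2.step, Option.some.injEq] at h
      subst h
      have h1 := length_stepAux_le (M l) v S k
      have h2 : pushCount (M l) ≤ ∑ l, pushCount (M l) :=
        Finset.single_le_sum (f := fun l => pushCount (M l)) (fun _ _ => Nat.zero_le _)
          (Finset.mem_univ l)
      rw [Nat.add_mul]
      simp only at ih ⊢
      omega

end Growth

/-! ## Composition of polynomial-time machines -/

section Comp

variable (M₁ M₂ : FinTM2) (conv : M₁.Γ M₁.k₁ → M₂.Γ M₂.k₀) (dflt : M₂.Γ M₂.k₀)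

/-- The stacks of both machines and an auxiliary one. -/
abbrev CompK : Type := (M₁.K ⊕ M₂.K) ⊕ Unit

abbrev CompΓ : CompK M₁ M₂ → Type
  | .inl (.inl k) => M₁.Γ k
  | .inl (.inr k) => M₂.Γ k
  | .inr _ => M₂.Γ M₂.k₀

/-- The labels of both machines and of the two loops that transfer the intermediate result. -/
abbrev CompΛ : Type := (M₁.Λ ⊕ M₂.Λ) ⊕ Bool

abbrev Compσ : Type := M₁.σ × M₂.σ × Option (M₂.Γ M₂.k₀)

variable {M₁ M₂}

/-- Only `halt` changes its meaning: it becomes a jump into the first transfer loop. -/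
def compStmt₁ : TM2.Stmt M₁.Γ M₁.Λ M₁.σ → TM2.Stmt (CompΓ M₁ M₂) (CompΛ M₁ M₂) (Compσ M₁ M₂)
  | .push k f q => .push (.inl (.inl k)) (fun v => f v.1) (compStmt₁ q)
  | .peek k f q => .peek (.inl (.inl k)) (fun v x => (f v.1 x, v.2)) (compStmt₁ q)
  | .pop k f q => .pop (.inl (.inl k)) (fun v x => (f v.1 x, v.2)) (compStmt₁ q)
  | .load f q => .load (fun v => (f v.1, v.2)) (compStmt₁ q)
  | .branch f q₁ q₂ => .branch (fun v => f v.1) (compStmt₁ q₁) (compStmt₁ q₂)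
  | .goto f => .goto fun v => .inl (.inl (f v.1))
  | .halt => .goto fun _ => .inr false

def compStmt₂ : TM2.Stmt M₂.Γ M₂.Λ M₂.σ → TM2.Stmt (CompΓ M₁ M₂) (CompΛ M₁ M₂) (Compσ M₁ M₂)
  | .push k f q => .push (.inl (.inr k)) (fun v => f v.2.1) (compStmt₂ q)
  | .peek k f q => .peek (.inl (.inr k)) (fun v x => (v.1, f v.2.1 x, v.2.2)) (compStmt₂ q)
  | .pop k f q => .pop (.inl (.inr k)) (fun v x => (v.1, f v.2.1 x, v.2.2)) (compStmt₂ q)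
  | .load f q => .load (fun v => (v.1, f v.2.1, v.2.2)) (compStmt₂ q)
  | .branch f q₁ q₂ => .branch (fun v => f v.2.1) (compStmt₂ q₁) (compStmt₂ q₂)
  | .goto f => .goto fun v => .inl (.inr (f v.2.1))
  | .halt => .halt

/-- The program of the composite machine. -/
def compProg : CompΛ M₁ M₂ → TM2.Stmt (CompΓ M₁ M₂) (CompΛ M₁ M₂) (Compσ M₁ M₂)
  | .inl (.inl l) => compStmt₁ (M₁.m l)
  | .inl (.inr l) => compStmt₂ (M₂.m l)
  -- One transfer reverses the stack, so the symbols pass through the auxiliary stack and are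
  -- reversed twice. The value `dflt` is never pushed, because the push is guarded by `isSome`.
  | .inr false =>
    .pop (.inl (.inl M₁.k₁)) (fun v x => (v.1, v.2.1, x.map conv)) <|
      .branch (fun v => v.2.2.isSome)
        (.push (.inr ()) (fun v => v.2.2.getD dflt) (.goto fun _ => .inr false))
        (.goto fun _ => .inr true)
  | .inr true =>
    .pop (.inr ()) (fun v x => (v.1, v.2.1, x)) <|
      .branch (fun v => v.2.2.isSome)
        (.push (.inl (.inr M₂.k₀)) (fun v => v.2.2.getD dflt) (.goto fun _ => .inr true))
        (.goto fun _ => .inl (.inr M₂.main))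

/-- The composite machine: it runs `M₁`, moves the result to the input stack of `M₂` and runs
`M₂`. -/
def compTM : FinTM2 :=
  haveI := M₁.kDecidableEq
  haveI := M₂.kDecidableEq
  haveI := M₁.kFin
  haveI := M₂.kFin
  haveI := M₁.ΛFin
  haveI := M₂.ΛFin
  haveI := M₁.σFin
  haveI := M₂.σFin
  haveI := M₁.Γk₀Fin
  haveI := M₂.Γk₀Fin
  { K := CompK M₁ M₂
    k₀ := .inl (.inl M₁.k₀)
    k₁ := .inl (.inr M₂.k₁)
    Γ := CompΓ M₁ M₂
    Λ := CompΛ M₁ M₂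
    main := .inl (.inl M₁.main)
    σ := Compσ M₁ M₂
    initialState := (M₁.initialState, M₂.initialState, none)
    Γk₀Fin := M₁.Γk₀Fin
    m := compProg conv dflt }

/-- The stacks of the composite machine, assembled from their parts. -/
def compStk (S₁ : ∀ k, List (M₁.Γ k)) (S₂ : ∀ k, List (M₂.Γ k)) (A : List (M₂.Γ M₂.k₀)) :
    ∀ k, List (CompΓ M₁ M₂ k)
  | .inl (.inl k) => S₁ k
  | .inl (.inr k) => S₂ k
  | .inr _ => A

theorem update_compStk_left (S₁ : ∀ k, List (M₁.Γ k)) (S₂ : ∀ k, List (M₂.Γ k))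
    (A : List (M₂.Γ M₂.k₀)) (k : M₁.K) (l : List (M₁.Γ k)) :
    Function.update (compStk S₁ S₂ A) (.inl (.inl k)) l =
      compStk (Function.update S₁ k l) S₂ A := by
  funext k'
  rcases k' with (k' | k') | k'
  · by_cases h : k' = k
    · subst h; simp [compStk]
    · simp [compStk, h]
  · simp [compStk]
  · simp [compStk]

theorem update_compStk_right (S₁ : ∀ k, List (M₁.Γ k)) (S₂ : ∀ k, List (M₂.Γ k))
    (A : List (M₂.Γ M₂.k₀)) (k : M₂.K) (l : List (M₂.Γ k)) :
    Function.update (compStk S₁ S₂ A) (.inl (.inr k)) l =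
      compStk S₁ (Function.update S₂ k l) A := by
  funext k'
  rcases k' with (k' | k') | k'
  · simp [compStk]
  · by_cases h : k' = k
    · subst h; simp [compStk]
    · simp [compStk, h]
  · simp [compStk]

theorem update_compStk_aux (S₁ : ∀ k, List (M₁.Γ k)) (S₂ : ∀ k, List (M₂.Γ k))
    (A : List (M₂.Γ M₂.k₀)) (u : Unit) (l : List (M₂.Γ M₂.k₀)) :
    Function.update (compStk S₁ S₂ A) (.inr u) l = compStk S₁ S₂ l := by
  funext k'
  rcases k' with (k' | k') | k' <;> simp [compStk]

/-- The configuration of the composite machine in its first phase. -/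
def compCfg₁ (c : M₁.Cfg) : TM2.Cfg (CompΓ M₁ M₂) (CompΛ M₁ M₂) (Compσ M₁ M₂) where
  l := some (c.l.elim (.inr false) fun l => .inl (.inl l))
  var := (c.var, M₂.initialState, none)
  stk := compStk c.stk (fun _ => []) []

/-- The configuration of the composite machine in its last phase. -/
def compCfg₂ (c : M₂.Cfg) : TM2.Cfg (CompΓ M₁ M₂) (CompΛ M₁ M₂) (Compσ M₁ M₂) where
  l := c.l.map fun l => .inl (.inr l)
  var := (M₁.initialState, c.var, none)
  stk := compStk (fun _ => []) c.stk []

/-- In its first phase the program never touches the other machine's stacks, so the embedding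
`compCfg₁` commutes with execution. Halting matches because `compCfg₁` sends the halted label to the
transfer loop. -/
theorem stepAux_compStmt₁ (q : TM2.Stmt M₁.Γ M₁.Λ M₁.σ) (v : M₁.σ) (S : ∀ k, List (M₁.Γ k)) :
    TM2.stepAux (compStmt₁ q) (v, M₂.initialState, none) (compStk S (fun _ => []) []) =
      compCfg₁ (M₁ := M₁) (M₂ := M₂) (TM2.stepAux q v S) := by
  induction q generalizing v S with
  | push k f q ih =>
    simp only [compStmt₁, TM2.stepAux, update_compStk_left]
    exact ih _ _
  | peek k f q ih => exact ih _ _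
  | pop k f q ih =>
    simp only [compStmt₁, TM2.stepAux, update_compStk_left]
    exact ih _ _
  | load f q ih => exact ih _ _
  | branch f q₁ q₂ ih₁ ih₂ =>
    simp only [compStmt₁, TM2.stepAux]
    cases f v
    · exact ih₂ _ _
    · exact ih₁ _ _
  | goto f => rfl
  | halt => rfl

theorem stepAux_compStmt₂ (q : TM2.Stmt M₂.Γ M₂.Λ M₂.σ) (v : M₂.σ) (S : ∀ k, List (M₂.Γ k)) :
    TM2.stepAux (compStmt₂ q) (M₁.initialState, v, none) (compStk (fun _ => []) S []) =
      compCfg₂ (M₁ := M₁) (M₂ := M₂) (TM2.stepAux q v S) := by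
  induction q generalizing v S with
  | push k f q ih =>
    simp only [compStmt₂, TM2.stepAux, update_compStk_right]
    exact ih _ _
  | peek k f q ih => exact ih _ _
  | pop k f q ih =>
    simp only [compStmt₂, TM2.stepAux, update_compStk_right]
    exact ih _ _
  | load f q ih => exact ih _ _
  | branch f q₁ q₂ ih₁ ih₂ =>
    simp only [compStmt₂, TM2.stepAux]
    cases f v
    · exact ih₂ _ _
    · exact ih₁ _ _
  | goto f => rfl
  | halt => rfl

theorem step_compCfg₁ (a b : M₁.Cfg) (h : M₁.step a = some b) :
    TM2.step (compProg conv dflt) (compCfg₁ (M₁ := M₁) (M₂ := M₂) a) = some (compCfg₁ b) := by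
  obtain ⟨l, v, S⟩ := a
  cases l with
  | none => simp at h
  | some l =>
    cases Option.some.inj h
    exact congrArg some (stepAux_compStmt₁ _ _ _)

theorem step_compCfg₂ (a b : M₂.Cfg) (h : M₂.step a = some b) :
    TM2.step (compProg conv dflt) (compCfg₂ (M₁ := M₁) (M₂ := M₂) a) = some (compCfg₂ b) := by
  obtain ⟨l, v, S⟩ := a
  cases l with
  | none => simp at h
  | some l =>
    cases Option.some.inj h
    exact congrArg some (stepAux_compStmt₂ _ _ _)

/-- The start configuration is fully determined because a machine halts with its variable reset and
all stacks except the output stack empty. -/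
theorem steps_unload (l : List (M₁.Γ M₁.k₁)) (A : List (M₂.Γ M₂.k₀)) (x : Option (M₂.Γ M₂.k₀)) :
    Steps (TM2.step (compProg conv dflt)) (l.length + 1)
      ⟨some (.inr false), (M₁.initialState, M₂.initialState, x),
        compStk (Function.update (fun _ => []) M₁.k₁ l) (fun _ => []) A⟩
      ⟨some (.inr true), (M₁.initialState, M₂.initialState, none),
        compStk (fun _ => []) (fun _ => []) ((l.map conv).reverse ++ A)⟩ := by
  induction l generalizing A x with
  | nil =>
    refine .single ?_
    simp [compProg, TM2.step, TM2.stepAux, compStk, update_compStk_left]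
  | cons a l ih =>
    refine .head (b := ⟨some (.inr false), (M₁.initialState, M₂.initialState, some (conv a)),
      compStk (Function.update (fun _ => []) M₁.k₁ l) (fun _ => []) (conv a :: A)⟩) ?_ ?_
    · simp [compProg, TM2.step, TM2.stepAux, compStk, update_compStk_left, update_compStk_aux]
    · simpa using ih (conv a :: A) (some (conv a))

theorem steps_reload (A l : List (M₂.Γ M₂.k₀)) (x : Option (M₂.Γ M₂.k₀)) :
    Steps (TM2.step (compProg conv dflt)) (A.length + 1)
      ⟨some (.inr true), (M₁.initialState, M₂.initialState, x),
        compStk (fun _ => []) (Function.update (fun _ => []) M₂.k₀ l) A⟩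
      ⟨some (.inl (.inr M₂.main)), (M₁.initialState, M₂.initialState, none),
        compStk (M₁ := M₁) (fun _ => []) (Function.update (fun _ => []) M₂.k₀ (A.reverse ++ l)) []⟩ := by
  induction A generalizing l x with
  | nil =>
    refine .single ?_
    simp [compProg, TM2.step, TM2.stepAux, compStk, update_compStk_aux]
  | cons a A ih =>
    refine .head (b := ⟨some (.inr true), (M₁.initialState, M₂.initialState, some a),
      compStk (fun _ => []) (Function.update (fun _ => []) M₂.k₀ (a :: l)) A⟩) ?_ ?_
    · simp [compProg, TM2.step, TM2.stepAux, compStk, update_compStk_right, update_compStk_aux]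
    · simpa using ih (a :: l) (some a)

theorem initList_eq (tm : FinTM2) (s : List (tm.Γ tm.k₀)) :
    initList tm s = ⟨some tm.main, tm.initialState, Function.update (fun _ => []) tm.k₀ s⟩ :=
  (eq_initList tm rfl rfl (by simp) fun k h => by simp [h]).symm

theorem haltList_eq (tm : FinTM2) (s : List (tm.Γ tm.k₁)) :
    haltList tm s = ⟨none, tm.initialState, Function.update (fun _ => []) tm.k₁ s⟩ :=
  (eq_haltList tm rfl rfl (by simp) fun k h => by simp [h]).symm

/-- Four runs are concatenated: the first machine, the two transfers, each costing one step per
symbol plus one to detect the empty stack, and the second machine. -/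
theorem steps_compTM {s : List (M₁.Γ M₁.k₀)} {u : List (M₁.Γ M₁.k₁)} {w : List (M₂.Γ M₂.k₁)}
    {n₁ n₂ : ℕ} (h₁ : Steps M₁.step n₁ (initList M₁ s) (haltList M₁ u))
    (h₂ : Steps M₂.step n₂ (initList M₂ (u.map conv)) (haltList M₂ w)) :
    Steps (compTM conv dflt).step (n₁ + (u.length + 1) + (u.length + 1) + n₂)
      (initList (compTM conv dflt) s) (haltList (compTM conv dflt) w) := by
  have e₁ : initList (compTM conv dflt) s = compCfg₁ (M₂ := M₂) (initList M₁ s) := by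
    refine (initList_eq _ _).trans (Eq.trans ?_ (congrArg compCfg₁ (initList_eq M₁ s)).symm)
    change TM2.Cfg.mk _ _ _ = TM2.Cfg.mk _ _ _
    congr 1
    refine Eq.trans ?_ (update_compStk_left (M₂ := M₂) (fun _ => []) (fun _ => []) [] M₁.k₀ s)
    congr 1
    · funext k
      rcases k with (k | k) | k <;> rfl
  have e₂ : haltList (compTM conv dflt) w = compCfg₂ (M₁ := M₁) (haltList M₂ w) := by
    refine (haltList_eq _ _).trans (Eq.trans ?_ (congrArg compCfg₂ (haltList_eq M₂ w)).symm)
    change TM2.Cfg.mk _ _ _ = TM2.Cfg.mk _ _ _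
    congr 1
    refine Eq.trans ?_ (update_compStk_right (M₁ := M₁) (fun _ => []) (fun _ => []) [] M₂.k₁ w)
    congr 1
    · funext k
      rcases k with (k | k) | k <;> rfl
  have r₁ := h₁.map (g := TM2.step (compProg conv dflt)) (compCfg₁ (M₁ := M₁) (M₂ := M₂))
    (step_compCfg₁ conv dflt)
  have r₂ := h₂.map (g := TM2.step (compProg conv dflt)) (compCfg₂ (M₁ := M₁) (M₂ := M₂))
    (step_compCfg₂ conv dflt)
  have r₃ := steps_unload conv dflt u [] none
  have r₄ := steps_reload conv dflt (u.map conv).reverse [] none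
  rw [← e₁] at r₁
  rw [← e₂] at r₂
  rw [haltList_eq] at r₁
  rw [initList_eq] at r₂
  simp only [List.length_reverse, List.length_map, List.reverse_reverse, List.append_nil] at r₃ r₄
  rw [Function.update_eq_self_iff.2 rfl] at r₄
  exact ((r₁.trans r₃).trans r₄).trans r₂

end Comp

theorem polynomial_eval_mono (p : Polynomial ℕ) {a b : ℕ} (h : a ≤ b) : p.eval a ≤ p.eval b := by
  simp only [Polynomial.eval_eq_sum, Polynomial.sum]
  gcongr

/-- Polynomial-time computable functions are closed under composition. -/
theorem PolyTime.comp {α β γ Γ₀ Γ₁ Γ₂ : Type} [Inhabited Γ₁] {ea : α → List Γ₀} {eb : β → List Γ₁}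
    {ec : γ → List Γ₂} {f : α → β} {g : β → γ} (hg : PolyTime eb ec g) (hf : PolyTime ea eb f) :
    PolyTime ea ec (g ∘ f) := by
  obtain ⟨⟨M₁, i₁, o₁⟩, p₁, run₁⟩ := hf
  obtain ⟨⟨M₂, i₂, o₂⟩, p₂, run₂⟩ := hg
  dsimp only at run₁ run₂ i₁ i₂ o₁ o₂
  let _ := M₁.ΛFin
  -- Both stack alphabets are identified with `Γ₁`, hence with each other.
  let conv : M₁.Γ M₁.k₁ → M₂.Γ M₂.k₀ := fun x => i₂.symm (o₁ x)
  let c : ℕ := ∑ l, pushCount (M₁.m l)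
  -- Bound on the length of the intermediate result: the input length plus at most `c` pushes in
  -- each of the at most `p₁` steps.
  let q : Polynomial ℕ := .X + p₁ * .C c
  refine ⟨⟨⟨compTM conv (i₂.symm default), i₁, o₂⟩, p₁ + 2 * (q + 1) + p₂.comp q, fun a => ?_⟩⟩
  have hr₁ := run₁ a
  obtain ⟨⟨n₂, e₂⟩, t₂⟩ := run₂ (f a)
  let u := List.map o₁.invFun (eb (f a))
  have s₁ : Steps M₁.step hr₁.steps (initList M₁ (List.map i₁.invFun (ea a))) (haltList M₁ u) :=
    Steps.iff_iterate.2 hr₁.evals_in_steps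
  have hu : u.map conv = List.map i₂.invFun (eb (f a)) := by
    simp [u, conv, Function.comp_def]
  have s₂ : Steps M₂.step n₂ (initList M₂ (u.map conv))
      (haltList M₂ (List.map o₂.invFun (ec (g (f a))))) :=
    by rw [hu]; exact Steps.iff_iterate.2 e₂
  have s := steps_compTM conv (i₂.symm default) s₁ s₂
  refine ⟨⟨_, Steps.iff_iterate.1 s⟩, ?_⟩
  have t₁ : hr₁.steps ≤ p₁.eval (ea a).length := hr₁.steps_le_m
  change n₂ ≤ _ at t₂
  have hlen : (eb (f a)).length ≤ q.eval (ea a).length := by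
    have := s₁.length_stk_le M₁.k₁
    rw [haltList_stk_self] at this
    have h0 : ((initList M₁ (List.map i₁.invFun (ea a))).stk M₁.k₁).length ≤ (ea a).length := by
      by_cases h : M₁.k₁ = M₁.k₀
      · rw [h, initList_stk_self]; simp
      · rw [initList_stk_of_ne _ _ h]; simp
    have h1 : hr₁.steps * c ≤ p₁.eval (ea a).length * c := Nat.mul_le_mul_right _ t₁
    simp only [q, Polynomial.eval_add, Polynomial.eval_X, Polynomial.eval_mul, Polynomial.eval_C]
    simp only [u, List.length_map] at this
    change _ ≤ _ + hr₁.steps * c at this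
    omega
  have t₃ := polynomial_eval_mono p₂ hlen
  have hul : u.length = (eb (f a)).length := by simp [u]
  simp only [Polynomial.eval_add, Polynomial.eval_comp, Polynomial.eval_mul, Polynomial.eval_one,
    Polynomial.eval_ofNat] at *
  omega

end PostSel

/-! ### Structured stack programs and their compilation to machines. -/

namespace PostSel

open Turing

/-! ## A structured programming language for stack machines -/

/-- Structured programs acting on stacks over `Γ`, indexed by `K`, and on a variable in `σ`. -/
inductive Prog (K Γ σ : Type) : Type
  | push (k : K) (f : σ → Γ)
  | pop (k : K) (f : σ → Option Γ → σ)
  | load (f : σ → σ)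
  | seq (p q : Prog K Γ σ)
  | ite (b : σ → Bool) (p q : Prog K Γ σ)
  | loop (b : σ → Bool) (p : Prog K Γ σ)

namespace Prog

variable {K Γ σ : Type}

infixr:60 " ;; " => Prog.seq

/-- The program does nothing. -/
def skip : Prog K Γ σ := .load id

variable [DecidableEq K]

/-- `Runs p v S v' S' t`: started in `(v, S)`, the program `p` terminates in `(v', S')` after `t`
steps. -/
inductive Runs : Prog K Γ σ → σ → (K → List Γ) → σ → (K → List Γ) → ℕ → Prop
  | push (k f v S) : Runs (.push k f) v S v (Function.update S k (f v :: S k)) 1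
  | pop (k f v S) : Runs (.pop k f) v S (f v (S k).head?) (Function.update S k (S k).tail) 1
  | load (f v S) : Runs (.load f) v S (f v) S 1
  | seq {p q v S v' S' v'' S'' t t'} : Runs p v S v' S' t → Runs q v' S' v'' S'' t' →
      Runs (.seq p q) v S v'' S'' (t + t')
  | ite_true {b p q v S v' S' t} : b v = true → Runs p v S v' S' t →
      Runs (.ite b p q) v S v' S' (t + 1)
  | ite_false {b p q v S v' S' t} : b v = false → Runs q v S v' S' t →
      Runs (.ite b p q) v S v' S' (t + 1)
  | loop_true {b p v S v' S' v'' S'' t t'} : b v = true → Runs p v S v' S' t →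
      Runs (.loop b p) v' S' v'' S'' t' → Runs (.loop b p) v S v'' S'' (t + t' + 1)
  | loop_false {b p v S} : b v = false → Runs (.loop b p) v S v S 1

/-! ### Compilation -/

/-- The labels of the compiled program. -/
def Lab : Prog K Γ σ → Type
  | .push _ _ => Unit
  | .pop _ _ => Unit
  | .load _ => Unit
  | .seq p q => Lab p ⊕ Lab q
  | .ite _ p q => Option (Lab p ⊕ Lab q)
  | .loop _ p => Option (Lab p)

@[reducible]
def labFintype : (p : Prog K Γ σ) → Fintype (Lab p)
  | .push _ _ => inferInstanceAs (Fintype Unit)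
  | .pop _ _ => inferInstanceAs (Fintype Unit)
  | .load _ => inferInstanceAs (Fintype Unit)
  | .seq p q =>
    haveI := labFintype p
    haveI := labFintype q
    inferInstanceAs (Fintype (Lab p ⊕ Lab q))
  | .ite _ p q =>
    haveI := labFintype p
    haveI := labFintype q
    inferInstanceAs (Fintype (Option (Lab p ⊕ Lab q)))
  | .loop _ p =>
    haveI := labFintype p
    inferInstanceAs (Fintype (Option (Lab p)))

/-- The label at which the compiled program starts. -/
def entry : (p : Prog K Γ σ) → Lab p
  | .push _ _ => ()
  | .pop _ _ => ()
  | .load _ => ()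
  | .seq p _ => Sum.inl (entry p)
  | .ite _ _ _ => none
  | .loop _ _ => none

/-- The compiled code; the labels are embedded into `Λ` by `e`, and `x` is the label to which the
control passes in the end. -/
def code {Λ : Type} : (p : Prog K Γ σ) → (Lab p → Λ) → Λ → Lab p → TM2.Stmt (fun _ : K => Γ) Λ σ
  | .push k f, _, x, _ => .push k f (.goto fun _ => x)
  | .pop k f, _, x, _ => .pop k f (.goto fun _ => x)
  | .load f, _, x, _ => .load f (.goto fun _ => x)
  | .seq p q, e, x, l =>
    match l with
    | .inl l => code p (fun l => e (.inl l)) (e (.inr (entry q))) l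
    | .inr l => code q (fun l => e (.inr l)) x l
  | .ite b p q, e, x, l =>
    match l with
    | none => .branch b (.goto fun _ => e (some (.inl (entry p))))
        (.goto fun _ => e (some (.inr (entry q))))
    | some (.inl l) => code p (fun l => e (some (.inl l))) x l
    | some (.inr l) => code q (fun l => e (some (.inr l))) x l
  | .loop b p, e, x, l =>
    match l with
    | none => .branch b (.goto fun _ => e (some (entry p))) (.goto fun _ => x)
    | some l => code p (fun l => e (some l)) (e none) l

/-- The hypothesis on `M` concerns only the labels in the image of `e`, so the induction applies to
subprograms sitting inside a larger machine. Each primitive and each test costs exactly one label,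
so step counts are preserved. -/
theorem Runs.steps {Λ : Type} {M : Λ → TM2.Stmt (fun _ : K => Γ) Λ σ} {p : Prog K Γ σ} {v v' : σ}
    {S S' : K → List Γ} {t : ℕ} (h : Runs p v S v' S' t) {e : Lab p → Λ} {x : Λ}
    (hM : ∀ l, M (e l) = code p e x l) :
    Steps (TM2.step M) t ⟨some (e (entry p)), v, S⟩ ⟨some x, v', S'⟩ := by
  induction h generalizing x with
  | push k f v S => refine .single ?_; simp [TM2.step, hM, code]
  | pop k f v S => refine .single ?_; simp [TM2.step, hM, code]
  | load f v S => refine .single ?_; simp [TM2.step, hM, code]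
  | seq _ _ ih₁ ih₂ =>
    exact (ih₁ (e := fun l => e (.inl l)) fun l => hM (.inl l)).trans
      (ih₂ (e := fun l => e (.inr l)) fun l => hM (.inr l))
  | ite_true hb _ ih =>
    refine .head ?_ (ih (e := fun l => e (some (.inl l))) fun l => hM (some (.inl l)))
    refine (congrArg (fun q => some (TM2.stepAux q _ _)) (hM none)).trans ?_
    simp [code, hb]
  | ite_false hb _ ih =>
    refine .head ?_ (ih (e := fun l => e (some (.inr l))) fun l => hM (some (.inr l)))
    refine (congrArg (fun q => some (TM2.stepAux q _ _)) (hM none)).trans ?_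
    simp [code, hb]
  | loop_true hb _ _ ih₁ ih₂ =>
    refine .head ?_ ((ih₁ (e := fun l => e (some l)) fun l => hM (some l)).trans (ih₂ hM))
    refine (congrArg (fun q => some (TM2.stepAux q _ _)) (hM none)).trans ?_
    simp [code, hb]
  | loop_false hb =>
    refine .single ?_
    refine (congrArg (fun q => some (TM2.stepAux q _ _)) (hM none)).trans ?_
    simp [code, hb]

/-! ### Running time as an upper bound -/

/-- The program terminates within `T` steps. -/
def RunsIn (p : Prog K Γ σ) (v : σ) (S : K → List Γ) (v' : σ) (S' : K → List Γ) (T : ℕ) : Prop :=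
  ∃ t ≤ T, Runs p v S v' S' t

namespace RunsIn

variable {p q : Prog K Γ σ} {v v' v'' : σ} {S S' S'' : K → List Γ} {T T' : ℕ}

theorem mono (h : RunsIn p v S v' S' T) (hT : T ≤ T') : RunsIn p v S v' S' T' := by
  obtain ⟨t, ht, hr⟩ := h
  exact ⟨t, ht.trans hT, hr⟩

theorem push (k : K) (f : σ → Γ) (v : σ) (S : K → List Γ) :
    RunsIn (.push k f) v S v (Function.update S k (f v :: S k)) 1 := ⟨1, le_rfl, .push k f v S⟩

theorem pop (k : K) (f : σ → Option Γ → σ) (v : σ) (S : K → List Γ) :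
    RunsIn (.pop k f) v S (f v (S k).head?) (Function.update S k (S k).tail) 1 :=
  ⟨1, le_rfl, .pop k f v S⟩

theorem load (f : σ → σ) (v : σ) (S : K → List Γ) : RunsIn (.load f) v S (f v) S 1 :=
  ⟨1, le_rfl, .load f v S⟩

theorem skip (v : σ) (S : K → List Γ) : RunsIn Prog.skip v S v S 1 := load id v S

theorem seq (h : RunsIn p v S v' S' T) (h' : RunsIn q v' S' v'' S'' T') :
    RunsIn (p ;; q) v S v'' S'' (T + T') := by
  obtain ⟨t, ht, hr⟩ := h
  obtain ⟨t', ht', hr'⟩ := h'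
  exact ⟨t + t', by omega, .seq hr hr'⟩

theorem ite_true {b : σ → Bool} (hb : b v = true) (h : RunsIn p v S v' S' T) :
    RunsIn (.ite b p q) v S v' S' (T + 1) := by
  obtain ⟨t, ht, hr⟩ := h
  exact ⟨t + 1, by omega, .ite_true hb hr⟩

theorem ite_false {b : σ → Bool} (hb : b v = false) (h : RunsIn q v S v' S' T) :
    RunsIn (.ite b p q) v S v' S' (T + 1) := by
  obtain ⟨t, ht, hr⟩ := h
  exact ⟨t + 1, by omega, .ite_false hb hr⟩

theorem loop_true {b : σ → Bool} (hb : b v = true) (h : RunsIn p v S v' S' T)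
    (h' : RunsIn (.loop b p) v' S' v'' S'' T') : RunsIn (.loop b p) v S v'' S'' (T + T' + 1) := by
  obtain ⟨t, ht, hr⟩ := h
  obtain ⟨t', ht', hr'⟩ := h'
  exact ⟨t + t' + 1, by omega, .loop_true hb hr hr'⟩

theorem loop_false {b : σ → Bool} (hb : b v = false) : RunsIn (.loop b p) v S v S 1 :=
  ⟨1, le_rfl, .loop_false hb⟩

theorem congr_right (h : RunsIn p v S v' S' T) (hS : S' = S'') : RunsIn p v S v' S'' T := hS ▸ h

end RunsIn

/-- The machine that runs a structured program. -/
def toTM [Fintype K] [Fintype Γ] [Fintype σ] (p : Prog K Γ σ) (kin kout : K) (v₀ : σ) : FinTM2 :=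
  haveI := labFintype p
  { K := K
    k₀ := kin
    k₁ := kout
    Γ := fun _ => Γ
    Λ := Option (Lab p)
    main := some (entry p)
    σ := σ
    initialState := v₀
    m := fun l => l.elim .halt (code p some none) }

/-- A structured program that terminates in polynomial time with the right result shows that a
function is computable in polynomial time. -/
theorem polyTime [Fintype K] [Fintype Γ] [Fintype σ] (p : Prog K Γ σ) (kin kout : K) (v₀ : σ)
    {α β : Type} {ea : α → List Γ} {eb : β → List Γ} {f : α → β} (P : Polynomial ℕ)
    (h : ∀ a, RunsIn p v₀ (Function.update (fun _ => []) kin (ea a)) v₀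
      (Function.update (fun _ => []) kout (eb (f a))) (P.eval (ea a).length)) :
    PolyTime ea eb f := by
  -- The extra 1 pays for the `halt` at the exit label.
  refine ⟨⟨⟨toTM p kin kout v₀, Equiv.refl Γ, Equiv.refl Γ⟩, P + 1, fun a => Classical.choice ?_⟩⟩
  obtain ⟨t, ht, hr⟩ := h a
  have s := hr.steps (M := (toTM p kin kout v₀).m) (e := some) (x := none) fun l => rfl
  have s₁ : (toTM p kin kout v₀).step
      ⟨some none, v₀, Function.update (fun _ => []) kout (eb (f a))⟩ =
      some ⟨none, v₀, Function.update (fun _ => []) kout (eb (f a))⟩ := rfl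
  have s₂ := s.trans (Steps.single s₁)
  have e₁ := initList_eq (toTM p kin kout v₀) (ea a)
  have e₂ := haltList_eq (toTM p kin kout v₀) (eb (f a))
  refine ⟨⟨t + 1, ?_⟩, ?_⟩
  · have := Steps.iff_iterate.1 s₂
    have h₁ : initList (toTM p kin kout v₀) (List.map (Equiv.refl Γ).invFun (ea a)) =
        initList (toTM p kin kout v₀) (ea a) := congrArg _ (List.map_id (ea a))
    have h₂ : haltList (toTM p kin kout v₀) (List.map (Equiv.refl Γ).invFun (eb (f a))) =
        haltList (toTM p kin kout v₀) (eb (f a)) := congrArg _ (List.map_id (eb (f a)))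
    exact (congrArg (fun c => (flip bind _)^[t + 1] (some c)) (h₁.trans e₁)).trans
      (this.trans (congrArg some (h₂.trans e₂).symm))
  · simp only [Polynomial.eval_add, Polynomial.eval_one]
    omega

end Prog

end PostSel

/-! ### A library of stack routines with explicit time bounds. -/

namespace PostSel

open Prog

/-! ## Stacks, variables and basic routines of the two translators -/

/-- The stacks of the translators: the input, the text of the part of the output that is generated
first (in reverse order), several unary counters, a scratch stack, the output qubit, the
post-selection register (in reverse order), the output and two qubit indices. -/
inductive Stack : Type
  | inp | txt | base | num | idx | cnt | tmp | outq | post | out | fst | snd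
  deriving DecidableEq

instance : Fintype Stack where
  elems := {.inp, .txt, .base, .num, .idx, .cnt, .tmp, .outq, .post, .out, .fst, .snd}
  complete x := by cases x <;> decide

/-- The variable consists of the symbol read last, a lookahead symbol and some registers. -/
abbrev Var : Type := Option Tok × Option Tok × (Fin 8 → ZMod 8)

abbrev Contents : Type := Stack → List Tok

abbrev Routine : Type := Prog Stack Tok Var

instance : Inhabited Tok := ⟨.sep⟩

def setCur (v : Var) (x : Option Tok) : Var := (x, v.2)

def cur (v : Var) : Tok := v.1.getD default

/-- Pop the stack `k` until it is empty, executing `body` for every symbol. -/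
def drain (k : Stack) (body : Routine) : Routine :=
  .pop k setCur ;; .loop (fun v => v.1.isSome) (body ;; .pop k setCur)

/-- `St l` is the loop invariant: the contents while `l` remains on `k`, whose own entry is
overwritten. The body may spoil the current symbol but not `w`. Each round costs the body, a pop and
a test; the first pop and the final failed test give the constant 2. -/
theorem drain_runs (k : Stack) (body : Routine) (w : Option Tok × (Fin 8 → ZMod 8))
    (St : List Tok → Contents) (l₀ : List Tok) (T : ℕ)
    (h : ∀ a l, a :: l <:+ l₀ → ∃ x, RunsIn body (some a, w) (Function.update (St (a :: l)) k l)
      (x, w) (Function.update (St l) k l) T) (x₀ : Option Tok) :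
    RunsIn (drain k body) (x₀, w) (Function.update (St l₀) k l₀) (none, w)
      (Function.update (St []) k []) ((T + 2) * l₀.length + 2) := by
  have key : ∀ l, l <:+ l₀ → RunsIn (.loop (fun v => v.1.isSome) (body ;; .pop k setCur))
      (l.head?, w) (Function.update (St l) k l.tail) (none, w) (Function.update (St []) k [])
      ((T + 2) * l.length + 1) := by
    intro l hl
    induction l with
    | nil => exact RunsIn.loop_false (by rfl)
    | cons a l ih =>
      obtain ⟨x, hx⟩ := h a l hl
      have h1 := hx.seq (RunsIn.pop k setCur (x, w) (Function.update (St l) k l))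
      have h2 := ih ((List.suffix_cons a l).trans hl)
      simp only [Function.update_self, Function.update_idem, setCur] at h1
      refine (RunsIn.loop_true (by rfl) h1 h2).mono ?_
      simp only [List.length_cons]
      ring_nf
      omega
  have h1 := RunsIn.pop k setCur (x₀, w) (Function.update (St l₀) k l₀)
  simp only [Function.update_self, Function.update_idem, setCur] at h1
  exact (h1.seq (key l₀ (List.suffix_refl _))).mono (by omega)

/-- Empty a stack. -/
def clear (k : Stack) : Routine := drain k skip

theorem clear_runs (k : Stack) (x : Option Tok) (w) (S : Contents) :
    RunsIn (clear k) (x, w) S (none, w) (Function.update S k []) (3 * (S k).length + 2) := by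
  have := drain_runs k skip w (fun _ => S) (S k) 1 (fun a l _ => ⟨_, RunsIn.skip _ _⟩) x
  simpa [clear] using this

/-- Move the contents of one stack to another one, in reverse order. -/
def move (k d : Stack) : Routine := drain k (.push d cur)

theorem move_runs {k d : Stack} (hkd : k ≠ d) (x : Option Tok) (w) (S : Contents) :
    RunsIn (move k d) (x, w) S (none, w)
      (Function.update (Function.update S k []) d ((S k).reverse ++ S d))
      (3 * (S k).length + 2) := by
  obtain ⟨r, hr⟩ : ∃ r, r = S k := ⟨_, rfl⟩
  have := drain_runs k (.push d cur) w
    (fun l => Function.update S d ((r.take (r.length - l.length)).reverse ++ S d)) (S k) 1 ?_ x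
  · simp only [← hr, Nat.sub_self, List.take_zero, List.reverse_nil, List.nil_append,
      Function.update_eq_self, List.length_nil, Nat.sub_zero, List.take_length] at this
    rw [Function.update_comm hkd, ← hr]
    rw [Function.update_eq_self_iff.2 hr] at this
    exact this
  · rintro a l ⟨l', hl⟩
    refine ⟨some a, ?_⟩
    have h1 := RunsIn.push d cur (some a, w) (Function.update
      (Function.update S d ((r.take (r.length - (a :: l).length)).reverse ++ S d)) k l)
    convert h1 using 1
    subst hr
    rw [← hl]
    simp only [List.length_append, List.length_cons]
    rw [show l'.length + (l.length + 1) - l.length = l'.length + 1 by omega,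
      show l'.length + (l.length + 1) - (l.length + 1) = l'.length by omega,
      Function.update_comm hkd, Function.update_of_ne hkd.symm, Function.update_self,
      Function.update_idem, List.take_left, List.take_append]
    simp [cur, List.take_of_length_le]

/-- Add the number of symbols on the stack `k` to the unary counter `d`. -/
def addTo (k d : Stack) : Routine :=
  drain k (.push .tmp cur ;; .push d fun _ => .one) ;; move .tmp k

/-- The symbols of `k` go to `tmp` and come back; the two reversals restore `k`, so the counter is
read without being consumed. -/
theorem addTo_runs {k d : Stack} (hkd : k ≠ d) (hk : k ≠ .tmp) (hd : d ≠ .tmp) (x : Option Tok) (w)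
    (S : Contents) (hS : S .tmp = []) :
    RunsIn (addTo k d) (x, w) S (none, w)
      (Function.update S d (List.replicate (S k).length .one ++ S d))
      (7 * (S k).length + 4) := by
  obtain ⟨r, hr⟩ : ∃ r, r = S k := ⟨_, rfl⟩
  have h1 := drain_runs k (.push .tmp cur ;; .push d fun _ => .one) w
    (fun l => Function.update (Function.update S .tmp (r.take (r.length - l.length)).reverse) d
      (List.replicate (r.length - l.length) .one ++ S d)) (S k) 2 ?_ x
  · simp only [← hr, Nat.sub_self, List.take_zero, List.reverse_nil, List.replicate_zero,
      List.nil_append, List.length_nil, Nat.sub_zero, List.take_length] at h1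
    have e1 : Function.update (Function.update (Function.update S .tmp []) d (S d)) k r = S := by
      funext j
      by_cases h1 : j = k
      · subst h1; simp [hr]
      by_cases h2 : j = d
      · subst h2; simp [hkd.symm]
      by_cases h3 : j = .tmp
      · subst h3; simp [h1, h2, hS]
      simp [h1, h2, h3]
    rw [e1] at h1
    have h2 := move_runs (k := .tmp) (d := k) hk.symm none w (Function.update
      (Function.update (Function.update S .tmp r.reverse) d
        (List.replicate r.length .one ++ S d)) k [])
    rw [← hr]
    refine ((h1.seq h2).congr_right ?_).mono ?_
    · funext j
      by_cases h1 : j = k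
      · subst h1; simp [hr, hkd, hk.symm, hd.symm]
      by_cases h2 : j = d
      · subst h2; simp [hkd.symm, hd]
      by_cases h3 : j = .tmp
      · subst h3; simp [h1, h2, hS]
      simp [h1, h2, h3]
    · simp [Function.update_of_ne hk.symm, Function.update_of_ne hd.symm]
      omega
  · rintro a l ⟨l', hl⟩
    refine ⟨some a, ?_⟩
    have h1 := (RunsIn.push .tmp cur (some a, w) (Function.update (Function.update
      (Function.update S .tmp (r.take (r.length - (a :: l).length)).reverse) d
      (List.replicate (r.length - (a :: l).length) .one ++ S d)) k l)).seq
      (RunsIn.push d (fun _ => .one) (some a, w) _)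
    convert h1 using 1
    subst hr
    rw [← hl]
    simp only [List.length_append, List.length_cons]
    rw [show l'.length + (l.length + 1) - l.length = l'.length + 1 by omega,
      show l'.length + (l.length + 1) - (l.length + 1) = l'.length by omega, List.take_left,
      List.take_append]
    funext j
    by_cases h1 : j = k
    · subst h1; simp [hk, hkd]
    by_cases h2 : j = d
    · subst h2; simp [hkd.symm, hd, List.replicate_succ]
    by_cases h3 : j = .tmp
    · subst h3; simp [hk.symm, hd.symm, cur, List.take_of_length_le]
    simp [h1, h2, h3]

/-- Push the symbols of a list, the first one first. -/
def pushAll (k : Stack) : List Tok → Routine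
  | [] => skip
  | a :: l => .push k (fun _ => a) ;; pushAll k l

theorem pushAll_runs (k : Stack) (l : List Tok) (v : Var) (S : Contents) :
    RunsIn (pushAll k l) v S v (Function.update S k (l.reverse ++ S k)) (l.length + 1) := by
  induction l generalizing S with
  | nil => simpa [pushAll] using RunsIn.skip v S
  | cons a l ih =>
    have := (RunsIn.push k (fun _ => a) v S).seq (ih _)
    simp only [Function.update_self, Function.update_idem] at this
    simp only [List.reverse_cons, List.append_assoc, List.singleton_append, List.length_cons]
    exact this.mono (by omega)

/-- Read a number written in unary from the input and add it to a counter. -/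
def readNat (k : Stack) : Routine :=
  .pop .inp setCur ;;
  .loop (fun v => v.1 = some .one) (.push k (fun _ => .one) ;; .pop .inp setCur) ;;
  .load fun v => setCur v none

theorem readNat_runs {k : Stack} (hk : k ≠ .inp) (x : Option Tok) (w) (S : Contents) (m : ℕ)
    (l : List Tok) (hS : S .inp = encodeNat m ++ l) :
    RunsIn (readNat k) (x, w) S (none, w)
      (Function.update (Function.update S .inp l) k (List.replicate m .one ++ S k))
      (3 * m + 3) := by
  have key : ∀ (m : ℕ) (S : Contents) (l : List Tok), ∃ y, RunsIn
      (.loop (fun v => v.1 = some .one) (.push k (fun _ => .one) ;; .pop .inp setCur))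
      ((encodeNat m ++ l).head?, w) (Function.update S .inp (encodeNat m ++ l).tail) (y, w)
      (Function.update (Function.update S .inp l) k (List.replicate m .one ++ S k))
      (3 * m + 1) := by
    intro m
    induction m with
    | zero =>
      intro S l
      refine ⟨_, RunsIn.congr_right (RunsIn.loop_false (by rfl)) ?_⟩
      simp only [encodeNat, List.replicate_zero, List.nil_append, List.singleton_append,
        List.tail_cons]
      rw [Function.update_comm hk.symm, Function.update_eq_self]
    | succ m ih =>
      intro S l
      have e : encodeNat (m + 1) ++ l = .one :: (encodeNat m ++ l) := by
        simp [encodeNat, List.replicate_succ]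
      obtain ⟨y, hy⟩ := ih (Function.update S k (.one :: S k)) l
      rw [e]
      refine ⟨y, ?_⟩
      have h1 := (RunsIn.push k (fun _ => .one) (some .one, w)
        (Function.update S .inp (encodeNat m ++ l))).seq (RunsIn.pop .inp setCur _ _)
      have e1 : Function.update (Function.update (Function.update S .inp (encodeNat m ++ l)) k
          (.one :: Function.update S .inp (encodeNat m ++ l) k)) .inp
          (Function.update (Function.update S .inp (encodeNat m ++ l)) k
          (.one :: Function.update S .inp (encodeNat m ++ l) k) .inp).tail =
          Function.update (Function.update S k (.one :: S k)) .inp (encodeNat m ++ l).tail := by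
        funext j
        by_cases h1 : j = k
        · subst h1; simp [hk]
        by_cases h2 : j = .inp
        · subst h2; simp [hk.symm]
        simp [h1, h2]
      have e2 : Function.update (Function.update S .inp (encodeNat m ++ l)) k
          (.one :: Function.update S .inp (encodeNat m ++ l) k) .inp = encodeNat m ++ l := by
        simp [hk.symm]
      rw [e1, e2] at h1
      refine (RunsIn.loop_true (by rfl) h1 hy |>.congr_right ?_).mono (by omega)
      funext j
      by_cases h1 : j = k
      · subst h1; simp [List.replicate_succ']
      by_cases h2 : j = .inp
      · subst h2; simp [hk.symm]
      simp [h1, h2]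
  obtain ⟨y, hy⟩ := key m S l
  have h1 := RunsIn.pop .inp setCur (x, w) S
  rw [hS] at h1
  exact (h1.seq (hy.seq (RunsIn.load (fun v => setCur v none) _ _))).mono (by omega)

/-! ## Routines that generate text -/

/-- Whatever text has been generated before, the routine appends `x` to it in at most `c` steps and
changes nothing else. -/
def Emits (p : Routine) (v : Var) (S : Contents) (x : List Tok) (c : ℕ) : Prop :=
  ∀ t, RunsIn p v (Function.update S .txt t) v (Function.update S .txt (x.reverse ++ t)) c

namespace Emits

variable {p q : Routine} {v : Var} {S : Contents} {x y : List Tok} {c d : ℕ}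

theorem mono (h : Emits p v S x c) (hc : c ≤ d) : Emits p v S x d := fun t => (h t).mono hc

theorem seq (h : Emits p v S x c) (h' : Emits q v S y d) :
    Emits (p ;; q) v S (x ++ y) (c + d) := fun t => by
  simpa using (h t).seq (h' _)

theorem skip (v : Var) (S : Contents) : Emits Prog.skip v S [] 1 := fun _ => RunsIn.skip _ _

theorem ite {b : Var → Bool} (h : b v = true → Emits p v S x c)
    (h' : b v = false → Emits q v S x c) : Emits (.ite b p q) v S x (c + 1) := fun t => by
  cases hb : b v with
  | true => exact RunsIn.ite_true hb (h hb t)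
  | false => exact RunsIn.ite_false hb (h' hb t)

theorem congr (h : Emits p v S x c) (e : x = y) : Emits p v S y c := e ▸ h

theorem runs (h : Emits p v S x c) :
    RunsIn p v S v (Function.update S .txt (x.reverse ++ S .txt)) c := by
  simpa using h (S .txt)

theorem pushAll (l : List Tok) (v : Var) (S : Contents) :
    Emits (pushAll .txt l) v S l (l.length + 1) := fun t => by
  simpa using pushAll_runs .txt l v (Function.update S .txt t)

theorem addTo {k : Stack} (hk : k ≠ .txt) (hk' : k ≠ .tmp) (w) (hS : S .tmp = []) :
    Emits (addTo k .txt) (none, w) S (List.replicate (S k).length .one)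
      (7 * (S k).length + 4) := fun t => by
  simpa [hk] using addTo_runs hk hk' (by decide) none w (Function.update S .txt t) (by simp [hS])

end Emits

/-- Write the sum of several unary counters. -/
def emitNat : List Stack → Routine
  | [] => pushAll .txt [.sep]
  | k :: ks => addTo k .txt ;; emitNat ks

theorem Emits.emitNat {S : Contents} (w) (hS : S .tmp = []) (ks : List Stack) (m : ℕ)
    (h : ∀ k ∈ ks, k ≠ .txt ∧ k ≠ .tmp ∧ (S k).length ≤ m) :
    Emits (emitNat ks) (none, w) S (encodeNat (ks.map fun k => (S k).length).sum)
      (ks.length * (7 * m + 4) + 2) := by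
  induction ks with
  | nil => exact (Emits.pushAll [.sep] _ _).mono (by simp)
  | cons k ks ih =>
    obtain ⟨h1, h2, h3⟩ := h k (by simp)
    refine (((Emits.addTo h1 h2 w hS).seq (ih fun k' hk' => h k' (by simp [hk']))).congr
      ?_).mono ?_
    · simp [encodeNat, ← List.append_assoc]
    · simp only [List.length_cons, Nat.add_mul]
      omega

/-- Execute `body` for `idx = 0, …, num - 1`. -/
def forIdx (body : Routine) : Routine :=
  -- The current symbol is cleared because the emitting routines are specified from a state where it
  -- is `none`. The loop runs on a copy of `num`, so `num` survives.
  addTo .num .cnt ;; drain .cnt (.load (fun v => setCur v none) ;; body ;; .push .idx fun _ => .one) ;;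
    clear .idx

theorem reverse_flatMap_range_succ {α : Type*} (f : ℕ → List α) (n : ℕ) :
    ((List.range (n + 1)).flatMap f).reverse =
      (f n).reverse ++ ((List.range n).flatMap f).reverse := by
  rw [List.range_succ, List.flatMap_append, List.reverse_append]
  simp

/-- The body must work for every content `r` of `cnt`, which shrinks during the loop. The constants
add up from copying `num` (7 per index), draining (body plus 4) and clearing `idx` (3). -/
theorem Emits.forIdx {body : Routine} {S : Contents} (w) (hS : S .tmp = []) (hS' : S .idx = [])
    (hS'' : S .cnt = []) (f : ℕ → List Tok) (c : ℕ)
    (h : ∀ i < (S .num).length, ∀ r, Emits body (none, w)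
      (Function.update (Function.update S .idx (List.replicate i .one)) .cnt r) (f i) c) :
    Emits (forIdx body) (none, w) S ((List.range (S .num).length).flatMap f)
      ((c + 14) * (S .num).length + 8) := fun t => by
  obtain ⟨n, hn⟩ : ∃ n, n = (S .num).length := ⟨_, rfl⟩
  rw [← hn] at h ⊢
  have h1 := addTo_runs (k := .num) (d := .cnt) (by decide) (by decide) (by decide) none w
    (Function.update S .txt t) (by simpa using hS)
  have h2 := drain_runs .cnt (.load (fun v => setCur v none) ;; body ;; .push .idx fun _ => .one) w
    (fun l => Function.update (Function.update S .txt
      (((List.range (n - l.length)).flatMap f).reverse ++ t)) .idx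
      (List.replicate (n - l.length) .one)) (List.replicate n .one) (c + 2) ?_ none
  · simp only [List.length_replicate, Nat.sub_self, List.range_zero, List.flatMap_nil,
      List.reverse_nil, List.nil_append, List.replicate_zero, List.length_nil,
      Nat.sub_zero] at h2
    have h3 := clear_runs .idx none w (Function.update (Function.update (Function.update S .txt
      (((List.range n).flatMap f).reverse ++ t)) .idx (List.replicate n .one)) .cnt [])
    have e1 : Function.update (Function.update S .txt t) .cnt
        (List.replicate (Function.update S .txt t .num).length .one ++
        Function.update S .txt t .cnt) =
        Function.update (Function.update (Function.update S .txt t) .idx []) .cnt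
        (List.replicate n .one) := by
      funext j
      cases j <;> simp [hS', hS'', hn]
    rw [e1] at h1
    refine ((h1.seq (h2.seq h3)).congr_right ?_).mono ?_
    · funext j
      cases j <;> simp [hS', hS'']
    · simp only [← hn, ne_eq, reduceCtorEq, not_false_eq_true, Function.update_of_ne,
        Function.update_self, List.length_replicate]
      ring_nf
      omega
  · rintro a l ⟨l', hl⟩
    have hlen := congrArg List.length hl
    simp only [List.length_append, List.length_cons, List.length_replicate] at hlen
    obtain ⟨i, hi⟩ : ∃ i, i = n - (l.length + 1) := ⟨_, rfl⟩
    have hi' : n - l.length = i + 1 := by omega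
    simp only [List.length_cons, ← hi, hi']
    refine ⟨none, ?_⟩
    have g1 := RunsIn.load (K := Stack) (Γ := Tok) (fun v : Var => setCur v none) (some a, w)
      (Function.update (Function.update (Function.update S .txt
        (((List.range i).flatMap f).reverse ++ t)) .idx (List.replicate i .one)) .cnt l)
    have g2 := h i (by omega) l (((List.range i).flatMap f).reverse ++ t)
    have e : Function.update (Function.update (Function.update S .idx (List.replicate i .one)) .cnt l)
        .txt (((List.range i).flatMap f).reverse ++ t) =
        Function.update (Function.update (Function.update S .txt
        (((List.range i).flatMap f).reverse ++ t)) .idx (List.replicate i .one)) .cnt l := by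
      funext j
      cases j <;> simp
    rw [e] at g2
    refine ((g1.seq (g2.seq (RunsIn.push .idx (fun _ => .one) _ _))).congr_right ?_).mono ?_
    · rw [reverse_flatMap_range_succ]
      funext j
      cases j <;> simp [List.replicate_succ]
    · omega

end PostSel

/-! ### The layered cost function of a circuit, its description and its translator. -/

namespace PostSel

open Prog

/-! ## Cost terms with unbounded indices -/

/-- A term of a cost function on variables that are numbered by natural numbers. -/
inductive RawTerm : Type
  | one (i : ℕ) (v : Bool → ℤ)
  | two (i j : ℕ) (v : Bool → Bool → ℤ)

namespace RawTerm

def eval : RawTerm → (ℕ → Bool) → ℤ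
  | .one i v, z => v (z i)
  | .two i j v, z => v (z i) (z j)

def encode : RawTerm → List Tok
  | .one i v => .termOne :: encodeNat i ++ encodeInt (v false) ++ encodeInt (v true)
  | .two i j v => .termTwo :: encodeNat i ++ encodeNat j ++
      encodeInt (v false false) ++ encodeInt (v false true) ++
      encodeInt (v true false) ++ encodeInt (v true true)

/-- The indices are distinct and less than `n`. -/
def Valid (n : ℕ) : RawTerm → Prop
  | .one i _ => i < n
  | .two i j _ => i < n ∧ j < n ∧ i ≠ j

/-- Natural-number indices keep the layer arithmetic free of bound proofs; the `none` branches are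
excluded afterwards by `Valid`. -/
def toTerm (n : ℕ) : RawTerm → Option (Term n)
  | .one i v => if h : i < n then some (.one ⟨i, h⟩ v) else none
  | .two i j v => if h : i < n ∧ j < n ∧ i ≠ j then
      some (.two ⟨i, h.1⟩ ⟨j, h.2.1⟩ (fun e => h.2.2 (congrArg Fin.val e)) v) else none

/-- An assignment of `n` variables, extended by `false`. -/
def extend {n : ℕ} (z : Fin n → Bool) (k : ℕ) : Bool := if h : k < n then z ⟨k, h⟩ else false

theorem extend_of_lt {n : ℕ} (z : Fin n → Bool) {k : ℕ} (h : k < n) : extend z k = z ⟨k, h⟩ :=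
  dif_pos h

theorem Valid.toTerm {n : ℕ} {t : RawTerm} (h : t.Valid n) : ∃ t', t.toTerm n = some t' ∧
    t'.encode = t.encode ∧ ∀ z, t'.eval z = t.eval (extend z) := by
  cases t with
  | one i v =>
    refine ⟨.one ⟨i, h⟩ v, dif_pos h, rfl, fun z => ?_⟩
    simp [Term.eval, RawTerm.eval, extend_of_lt z h]
  | two i j v =>
    refine ⟨.two ⟨i, h.1⟩ ⟨j, h.2.1⟩ (fun e => h.2.2 (congrArg Fin.val e)) v, dif_pos h, rfl,
      fun z => ?_⟩
    simp [Term.eval, RawTerm.eval, extend_of_lt z h.1, extend_of_lt z h.2.1]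

/-- For valid terms `filterMap` discards nothing, so the translator can print the raw terms without
any checks. -/
theorem flatMap_encode_filterMap {n : ℕ} (ts : List RawTerm) (h : ∀ t ∈ ts, t.Valid n) :
    (ts.filterMap (RawTerm.toTerm n)).flatMap Term.encode = ts.flatMap RawTerm.encode := by
  induction ts with
  | nil => rfl
  | cons t ts ih =>
    obtain ⟨t', h1, h2, _⟩ := (h t (by simp)).toTerm
    rw [List.filterMap_cons_some h1, List.flatMap_cons, List.flatMap_cons, h2,
      ih fun t ht => h t (by simp [ht])]

theorem sum_eval_filterMap {n : ℕ} (ts : List RawTerm) (h : ∀ t ∈ ts, t.Valid n)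
    (z : Fin n → Bool) :
    ((ts.filterMap (RawTerm.toTerm n)).map fun t => t.eval z).sum =
      (ts.map fun t => t.eval (extend z)).sum := by
  induction ts with
  | nil => rfl
  | cons t ts ih =>
    obtain ⟨t', h1, _, h3⟩ := (h t (by simp)).toTerm
    rw [List.filterMap_cons_some h1, List.map_cons, List.map_cons, List.sum_cons, List.sum_cons,
      h3, ih fun t ht => h t (by simp [ht])]

end RawTerm

/-! ## From circuits to QAOA circuits of depth one -/

/-- The value table of `c x`. -/
def linTable (c : ℤ) (x : Bool) : ℤ := if x then c else 0

/-- The value table of `4 x y`. -/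
def czTable (x y : Bool) : ℤ := if x && y then 4 else 0

/-- The value table of `4 x y - 2 x`. -/
def linkTable (x y : Bool) : ℤ := if x then (if y then 2 else -2) else 0

/-- The terms that connect the variables of layer `l` to those of layer `l + 1`. -/
def linkTerms (n l : ℕ) : List RawTerm :=
  (List.range n).map fun i => .two (l * n + i) (l * n + n + i) linkTable

/-- The terms of the last layer. -/
def lastTerms (n l : ℕ) : List RawTerm :=
  (List.range n).map fun i => .one (l * n + i) (linTable (-2))

/-- The terms of a gate that is applied to the variables of layer `l`. -/
def gateTerms {n : ℕ} (l : ℕ) : Gate n → List RawTerm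
  | .H i => [.one (l * n + i) (linTable 2), .one (l * n + n + i) (linTable 2),
      .one (l * n + n + n + i) (linTable 2)]
  | .Tdg i => [.one (l * n + i) (linTable 1)]
  | .CZ i j _ => [.two (l * n + i) (l * n + j) czTable]

/-- The terms of a sequence of gates, each of which takes two layers, starting with layer `l`. -/
def gatesTerms {n : ℕ} : ℕ → List (Gate n) → List RawTerm
  | _, [] => []
  | l, g :: gs => gateTerms l g ++ (linkTerms n l ++ (linkTerms n (l + 1) ++ gatesTerms (l + 2) gs))

namespace Circuit

variable (C : Circuit)

/-- The index of the last layer of variables. -/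
def lastLayer : ℕ := 2 * C.gates.length + 2

def rawTerms : List RawTerm :=
  linkTerms C.n 0 ++ (gatesTerms 1 C.gates ++
    (linkTerms C.n (2 * C.gates.length + 1) ++ lastTerms C.n C.lastLayer))

theorem lastLayer_mul_add_lt (i : Fin C.n) : C.lastLayer * C.n + i < (C.lastLayer + 1) * C.n := by
  rw [Nat.add_mul]; omega

/-- The variable of the last layer that belongs to a qubit of the circuit. -/
def lastVar : Fin C.n ↪ Fin ((C.lastLayer + 1) * C.n) where
  toFun i := ⟨C.lastLayer * C.n + i, C.lastLayer_mul_add_lt i⟩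
  inj' i j h := by simpa [Fin.ext_iff] using h

theorem lastVar_val (i : Fin C.n) : (C.lastVar i).1 = C.lastLayer * C.n + i := rfl

open Classical in
/-- The post-selection register consists of all the variables that do not belong to the last layer
and of the original register. -/
noncomputable def lastPost : Finset (Fin ((C.lastLayer + 1) * C.n)) :=
  Finset.univ.filter fun k => k.1 < C.lastLayer * C.n ∨ ∃ i ∈ C.readout.post, C.lastVar i = k

theorem mem_lastPost (k : Fin ((C.lastLayer + 1) * C.n)) :
    k ∈ C.lastPost ↔ k.1 < C.lastLayer * C.n ∨ ∃ i ∈ C.readout.post, C.lastVar i = k := by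
  classical
  simp [lastPost]

theorem lastVar_mem_lastPost (i : Fin C.n) : C.lastVar i ∈ C.lastPost ↔ i ∈ C.readout.post := by
  simp [mem_lastPost, lastVar_val]

/-- The QAOA circuit of depth one that simulates a post-selected circuit. -/
noncomputable def toQAOA : QAOA where
  n := (C.lastLayer + 1) * C.n
  readout :=
    { out := C.lastVar C.readout.out
      post := C.lastPost
      out_notMem := fun h => C.readout.out_notMem ((C.lastVar_mem_lastPost _).1 h) }
  layers := [(1, 1)]
  terms := C.rawTerms.filterMap (RawTerm.toTerm _)

end Circuit

theorem linkTerms_valid {n l L : ℕ} (h : l < L) :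
    ∀ t ∈ linkTerms n l, t.Valid ((L + 1) * n) := by
  intro t ht
  simp only [linkTerms, List.mem_map, List.mem_range] at ht
  obtain ⟨i, hi, rfl⟩ := ht
  have h1 : (l + 2) * n ≤ (L + 1) * n := Nat.mul_le_mul_right _ (by omega)
  rw [Nat.add_mul] at h1
  exact ⟨by omega, by omega, by omega⟩

theorem gatesTerms_valid {n l L : ℕ} (gs : List (Gate n)) (h : l + 2 * gs.length ≤ L) :
    ∀ t ∈ gatesTerms l gs, t.Valid ((L + 1) * n) := by
  induction gs generalizing l with
  | nil => simp [gatesTerms]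
  | cons g gs ih =>
    simp only [List.length_cons] at h
    have h1 : (l + 3) * n ≤ (L + 1) * n := Nat.mul_le_mul_right _ (by omega)
    rw [Nat.add_mul] at h1
    intro t ht
    simp only [gatesTerms, List.mem_append] at ht
    rcases ht with ht | ht | ht | ht
    · cases g with
      | H i =>
        simp only [gateTerms, List.mem_cons, List.not_mem_nil, or_false] at ht
        rcases ht with rfl | rfl | rfl <;> simp only [RawTerm.Valid] <;> omega
      | Tdg i =>
        simp only [gateTerms, List.mem_singleton] at ht
        subst ht
        simp only [RawTerm.Valid]
        omega
      | CZ i j hij =>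
        simp only [gateTerms, List.mem_singleton] at ht
        subst ht
        have : i.1 ≠ j.1 := fun e => hij (Fin.ext e)
        exact ⟨by omega, by omega, by omega⟩
    · exact linkTerms_valid (by omega) t ht
    · exact linkTerms_valid (by omega) t ht
    · exact ih (by omega) t ht

theorem lastTerms_valid (n L : ℕ) : ∀ t ∈ lastTerms n L, t.Valid ((L + 1) * n) := by
  intro t ht
  simp only [lastTerms, List.mem_map, List.mem_range] at ht
  obtain ⟨i, hi, rfl⟩ := ht
  simp only [RawTerm.Valid, Nat.add_mul]
  omega

theorem Circuit.rawTerms_valid (C : Circuit) :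
    ∀ t ∈ C.rawTerms, t.Valid ((C.lastLayer + 1) * C.n) := by
  intro t ht
  simp only [Circuit.rawTerms, List.mem_append] at ht
  rcases ht with ht | ht | ht | ht
  · exact linkTerms_valid (by simp [lastLayer]) t ht
  · exact gatesTerms_valid _ (by simp [lastLayer]; omega) t ht
  · exact linkTerms_valid (by simp [lastLayer]) t ht
  · exact lastTerms_valid _ _ t ht

/-- The bits of the post-selection register. -/
def Readout.postBits {n : ℕ} (r : Readout n) : List Tok :=
  List.ofFn fun i : Fin n => encodeBit (decide (i ∈ r.post))

/-- This is the text that the translator has to produce. Variables are numbered layer by layer, so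
the characteristic vector of the new register is a block of ones followed by the original vector. -/
theorem Circuit.encode_toQAOA (C : Circuit) : C.toQAOA.encode =
    encodeNat ((C.lastLayer + 1) * C.n) ++ (encodeNat (C.lastLayer * C.n + C.readout.out) ++
      (List.replicate (C.lastLayer * C.n) .one ++ (C.readout.postBits ++
        ((.layer :: encodeInt 1 ++ encodeInt 1) ++ C.rawTerms.flatMap RawTerm.encode)))) := by
  have h1 : C.toQAOA.terms.flatMap Term.encode = C.rawTerms.flatMap RawTerm.encode :=
    RawTerm.flatMap_encode_filterMap _ C.rawTerms_valid
  have h2 : (List.ofFn fun i => encodeBit (decide (i ∈ C.toQAOA.readout.post))) =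
      List.replicate (C.lastLayer * C.n) .one ++ C.readout.postBits := by
    have hn : C.toQAOA.n = C.lastLayer * C.n + C.n := Nat.succ_mul _ _
    refine List.ext_getElem (by simp [hn, Readout.postBits]) fun k hk hk' => ?_
    rw [List.getElem_ofFn]
    rw [List.length_ofFn] at hk
    by_cases hkl : k < C.lastLayer * C.n
    · rw [List.getElem_append_left (by simpa using hkl), List.getElem_replicate]
      have : (⟨k, hk⟩ : Fin ((C.lastLayer + 1) * C.n)) ∈ C.lastPost :=
        (C.mem_lastPost _).2 (Or.inl hkl)
      change encodeBit (decide ((⟨k, hk⟩ : Fin ((C.lastLayer + 1) * C.n)) ∈ C.lastPost)) = _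
      simp only [this, encodeBit, decide_true, if_true]
    · rw [List.getElem_append_right (by simpa using hkl)]
      simp only [Readout.postBits, List.getElem_ofFn, List.length_replicate]
      congr 2
      rw [← C.lastVar_mem_lastPost]
      have : C.lastVar ⟨k - C.lastLayer * C.n, by omega⟩ = ⟨k, hk⟩ :=
        Fin.ext (by rw [lastVar_val]; simp only; omega)
      rw [this]
      rfl
  simp only [QAOA.encode, Readout.encode, h1, h2]
  simp [toQAOA, lastVar_val]

end PostSel

namespace PostSel

open Prog

/-! ## The translator from circuits to QAOA circuits -/

/-- Stack contents given by a list for each of the permanently used stacks. -/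
def mem (inp txt base num outq post out fst snd : List Tok) : Contents
  | .inp => inp
  | .txt => txt
  | .base => base
  | .num => num
  | .outq => outq
  | .post => post
  | .out => out
  | .fst => fst
  | .snd => snd
  | _ => []

section mem

variable (a b c d e f g h i x : List Tok)

@[simp] theorem mem_inp : mem a b c d e f g h i .inp = a := rfl
@[simp] theorem mem_txt : mem a b c d e f g h i .txt = b := rfl
@[simp] theorem mem_base : mem a b c d e f g h i .base = c := rfl
@[simp] theorem mem_num : mem a b c d e f g h i .num = d := rfl
@[simp] theorem mem_outq : mem a b c d e f g h i .outq = e := rfl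
@[simp] theorem mem_post : mem a b c d e f g h i .post = f := rfl
@[simp] theorem mem_out : mem a b c d e f g h i .out = g := rfl
@[simp] theorem mem_fst : mem a b c d e f g h i .fst = h := rfl
@[simp] theorem mem_snd : mem a b c d e f g h i .snd = i := rfl
@[simp] theorem mem_tmp : mem a b c d e f g h i .tmp = [] := rfl
@[simp] theorem mem_idx : mem a b c d e f g h i .idx = [] := rfl
@[simp] theorem mem_cnt : mem a b c d e f g h i .cnt = [] := rfl

@[simp] theorem update_mem_inp :
    Function.update (mem a b c d e f g h i) .inp x = mem x b c d e f g h i := by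
  funext j; cases j <;> simp

@[simp] theorem update_mem_txt :
    Function.update (mem a b c d e f g h i) .txt x = mem a x c d e f g h i := by
  funext j; cases j <;> simp

@[simp] theorem update_mem_base :
    Function.update (mem a b c d e f g h i) .base x = mem a b x d e f g h i := by
  funext j; cases j <;> simp

@[simp] theorem update_mem_num :
    Function.update (mem a b c d e f g h i) .num x = mem a b c x e f g h i := by
  funext j; cases j <;> simp

@[simp] theorem update_mem_outq :
    Function.update (mem a b c d e f g h i) .outq x = mem a b c d x f g h i := by
  funext j; cases j <;> simp

@[simp] theorem update_mem_post :
    Function.update (mem a b c d e f g h i) .post x = mem a b c d e x g h i := by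
  funext j; cases j <;> simp

@[simp] theorem update_mem_out :
    Function.update (mem a b c d e f g h i) .out x = mem a b c d e f x h i := by
  funext j; cases j <;> simp

@[simp] theorem update_mem_fst :
    Function.update (mem a b c d e f g h i) .fst x = mem a b c d e f g x i := by
  funext j; cases j <;> simp

@[simp] theorem update_mem_snd :
    Function.update (mem a b c d e f g h i) .snd x = mem a b c d e f g h x := by
  funext j; cases j <;> simp

end mem

theorem update_nil_inp (l : List Tok) :
    (Function.update (fun _ => []) Stack.inp l : Contents) = mem l [] [] [] [] [] [] [] [] := by
  funext j; cases j <;> simp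

theorem update_nil_out (l : List Tok) :
    (Function.update (fun _ => []) Stack.out l : Contents) = mem [] [] [] [] [] [] l [] [] := by
  funext j; cases j <;> simp

/-- Unary numbers. -/
abbrev ones (k : ℕ) : List Tok := List.replicate k .one

def setLook (v : Var) (x : Option Tok) : Var := (v.1, x, v.2.2)

/-- Read the bits of the post-selection register and one more symbol. -/
def readBits : Routine :=
  .pop .inp setLook ;;
  .loop (fun v => v.2.1 = some .zero || v.2.1 = some .one)
    (.push .post (fun v => v.2.1.getD default) ;; .pop .inp setLook)

/-- The bit vector has no end marker: its end is recognised by the first symbol that is not a bit,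
which has then already been popped and is kept as lookahead. -/
theorem readBits_runs (bs rest : List Tok) (hbs : ∀ b ∈ bs, b = .zero ∨ b = .one)
    (hrest : rest.head? ≠ some .zero ∧ rest.head? ≠ some .one) (y : Option Tok) (r)
    (txt base num outq post out fst snd) :
    RunsIn readBits (none, y, r) (mem (bs ++ rest) txt base num outq post out fst snd)
      (none, rest.head?, r) (mem rest.tail txt base num outq (bs.reverse ++ post) out fst snd)
      (3 * bs.length + 2) := by
  have key : ∀ (bs post : List Tok), (∀ b ∈ bs, b = .zero ∨ b = .one) → RunsIn
      (.loop (fun v => v.2.1 = some .zero || v.2.1 = some .one)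
        (.push .post (fun v => v.2.1.getD default) ;; .pop .inp setLook))
      (none, (bs ++ rest).head?, r) (mem (bs ++ rest).tail txt base num outq post out fst snd)
      (none, rest.head?, r) (mem rest.tail txt base num outq (bs.reverse ++ post) out fst snd)
      (3 * bs.length + 1) := by
    intro bs
    induction bs with
    | nil => intro post _; exact RunsIn.loop_false (by simp [hrest])
    | cons b bs ih =>
      intro post hb
      have h1 := (RunsIn.push .post (fun v : Var => v.2.1.getD default) (none, some b, r)
        (mem (bs ++ rest) txt base num outq post out fst snd)).seq
        (RunsIn.pop .inp setLook _ _)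
      simp only [mem_post, mem_inp, update_mem_post, update_mem_inp, setLook,
        Option.getD_some] at h1
      have h2 := ih (b :: post) fun b hb' => hb b (by simp [hb'])
      refine ((RunsIn.loop_true ?_ h1 h2).congr_right ?_).mono ?_
      · rcases hb b (by simp) with rfl | rfl <;> rfl
      · simp
      · simp; omega
  have h1 := RunsIn.pop .inp setLook (none, y, r)
    (mem (bs ++ rest) txt base num outq post out fst snd)
  simp only [mem_inp, update_mem_inp, setLook] at h1
  exact (h1.seq (key bs post hbs)).mono (by omega)

/-- Write a term in one variable. -/
def emitOne (ks : List Stack) (v : Bool → ℤ) : Routine :=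
  pushAll .txt [.termOne] ;; emitNat ks ;; pushAll .txt (encodeInt (v false) ++ encodeInt (v true))

/-- Write a term in two variables. -/
def emitTwo (ks ks' : List Stack) (v : Bool → Bool → ℤ) : Routine :=
  pushAll .txt [.termTwo] ;; emitNat ks ;; emitNat ks' ;;
    pushAll .txt (encodeInt (v false false) ++ encodeInt (v false true) ++
      encodeInt (v true false) ++ encodeInt (v true true))

theorem Emits.emitOne {S : Contents} (w) (hS : S .tmp = []) (ks : List Stack) (v : Bool → ℤ)
    (m : ℕ) (h : ∀ k ∈ ks, k ≠ .txt ∧ k ≠ .tmp ∧ (S k).length ≤ m) (hks : ks.length ≤ 4)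
    (hv : (encodeInt (v false) ++ encodeInt (v true)).length ≤ 30) :
    Emits (emitOne ks v) (none, w) S
      (RawTerm.one (ks.map fun k => (S k).length).sum v).encode (100 * (m + 1)) := by
  refine (((Emits.pushAll _ _ _).seq ((Emits.emitNat w hS ks m h).seq
    (Emits.pushAll _ _ _))).congr ?_).mono ?_
  · simp [RawTerm.encode]
  · have : ks.length * (7 * m + 4) ≤ 4 * (7 * m + 4) := Nat.mul_le_mul_right _ hks
    simp only [List.length_singleton]
    omega

theorem Emits.emitTwo {S : Contents} (w) (hS : S .tmp = []) (ks ks' : List Stack)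
    (v : Bool → Bool → ℤ) (m : ℕ) (h : ∀ k ∈ ks, k ≠ .txt ∧ k ≠ .tmp ∧ (S k).length ≤ m)
    (h' : ∀ k ∈ ks', k ≠ .txt ∧ k ≠ .tmp ∧ (S k).length ≤ m)
    (hks : ks.length ≤ 4) (hks' : ks'.length ≤ 4)
    (hv : (encodeInt (v false false) ++ encodeInt (v false true) ++
      encodeInt (v true false) ++ encodeInt (v true true)).length ≤ 30) :
    Emits (emitTwo ks ks' v) (none, w) S
      (RawTerm.two (ks.map fun k => (S k).length).sum (ks'.map fun k => (S k).length).sum v).encode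
      (100 * (m + 1)) := by
  refine (((Emits.pushAll _ _ _).seq ((Emits.emitNat w hS ks m h).seq
    ((Emits.emitNat w hS ks' m h').seq (Emits.pushAll _ _ _)))).congr ?_).mono ?_
  · simp [RawTerm.encode]
  · have h1 : ks.length * (7 * m + 4) ≤ 4 * (7 * m + 4) := Nat.mul_le_mul_right _ hks
    have h2 : ks'.length * (7 * m + 4) ≤ 4 * (7 * m + 4) := Nat.mul_le_mul_right _ hks'
    simp only [List.length_singleton]
    omega

/-- Write the terms that connect two layers and pass to the next layer. -/
def emitLinks : Routine :=
  forIdx (emitTwo [.base, .idx] [.base, .num, .idx] linkTable) ;; addTo .num .base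

/-- The counter `base` holds the index `l * n` of the first variable of the current layer, so all
indices are sums of unary counters. The number `m` bounds every counter in use. -/
theorem emitLinks_runs (w) (n l m : ℕ) (hm : l * n + n ≤ m) (inp txt outq post out fst snd) :
    RunsIn emitLinks (none, w) (mem inp txt (ones (l * n)) (ones n) outq post out fst snd) (none, w)
      (mem inp (((linkTerms n l).flatMap RawTerm.encode).reverse ++ txt) (ones ((l + 1) * n))
        (ones n) outq post out fst snd) (170 * (m + 1) ^ 2) := by
  have h1 := (Emits.forIdx (S := mem inp txt (ones (l * n)) (ones n) outq post out fst snd)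
    (body := emitTwo [.base, .idx] [.base, .num, .idx] linkTable) w rfl rfl rfl
    (fun i => (RawTerm.two (l * n + i) (l * n + n + i) linkTable).encode)
    (100 * (m + 1)) ?_).runs
  · have h2 := addTo_runs (k := .num) (d := .base) (by decide) (by decide) (by decide) none w _
      (by rfl : mem inp (((linkTerms n l).flatMap RawTerm.encode).reverse ++ txt) (ones (l * n))
        (ones n) outq post out fst snd .tmp = [])
    simp only [mem_num, mem_txt, update_mem_txt, List.length_replicate] at h1
    have e : (List.range n).flatMap (fun i => (RawTerm.two (l * n + i) (l * n + n + i)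
        linkTable).encode) = (linkTerms n l).flatMap RawTerm.encode := by
      simp [linkTerms, List.flatMap_map]
    rw [e] at h1
    refine ((h1.seq h2).congr_right ?_).mono ?_
    · simp [Nat.add_mul, Nat.add_comm]
    · simp only [mem_num, List.length_replicate]
      have : n ≤ m := by omega
      nlinarith [Nat.mul_le_mul_left (100 * (m + 1) + 14) this]
  · intro i hi r
    simp only [mem_num, List.length_replicate] at hi
    refine (Emits.emitTwo w (by simp) [.base, .idx] [.base, .num, .idx] linkTable m
      ?_ ?_ (by decide) (by decide) (by decide)).congr ?_
    · simp; omega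
    · simp; omega
    · simp [Nat.add_assoc]

/-- Write the terms of the last layer. -/
def emitLast : Routine := forIdx (emitOne [.base, .idx] (linTable (-2)))

theorem emitLast_runs (w) (n l m : ℕ) (hm : l * n + n ≤ m) (inp txt outq post out fst snd) :
    RunsIn emitLast (none, w) (mem inp txt (ones (l * n)) (ones n) outq post out fst snd) (none, w)
      (mem inp (((lastTerms n l).flatMap RawTerm.encode).reverse ++ txt) (ones (l * n))
        (ones n) outq post out fst snd) (170 * (m + 1) ^ 2) := by
  have h1 := (Emits.forIdx (S := mem inp txt (ones (l * n)) (ones n) outq post out fst snd)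
    (body := emitOne [.base, .idx] (linTable (-2))) w rfl rfl rfl
    (fun i => (RawTerm.one (l * n + i) (linTable (-2))).encode)
    (100 * (m + 1)) ?_).runs
  · simp only [mem_num, mem_txt, update_mem_txt, List.length_replicate] at h1
    refine (h1.congr_right ?_).mono ?_
    · simp [lastTerms, List.flatMap_map]
    · have : n ≤ m := by omega
      nlinarith [Nat.mul_le_mul_left (100 * (m + 1) + 14) this]
  · intro i hi r
    simp only [mem_num, List.length_replicate] at hi
    refine (Emits.emitOne w (by simp) [.base, .idx] (linTable (-2)) m
      ?_ (by decide) (by decide)).congr ?_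
    · simp; omega
    · simp

/-- Read a gate and write its terms; the first symbol of the gate is the lookahead symbol. -/
def transGate : Routine :=
  .ite (fun v => v.2.1 = some .gateH)
    (readNat .fst ;; (emitOne [.base, .fst] (linTable 2) ;;
      emitOne [.base, .num, .fst] (linTable 2) ;;
      emitOne [.base, .num, .num, .fst] (linTable 2)) ;; clear .fst)
    (.ite (fun v => v.2.1 = some .gateT)
      (readNat .fst ;; emitOne [.base, .fst] (linTable 1) ;; clear .fst)
      (readNat .fst ;; readNat .snd ;; emitTwo [.base, .fst] [.base, .snd] czTable ;;
        clear .fst ;; clear .snd))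

theorem transGate_runs {n : ℕ} (g : Gate n) (r) (l m : ℕ) (hm : l * n + n ≤ m)
    (rest txt outq post out) :
    RunsIn transGate (none, (g.encode ++ rest).head?, r)
      (mem (g.encode ++ rest).tail txt (ones (l * n)) (ones n) outq post out [] [])
      (none, (g.encode ++ rest).head?, r)
      (mem rest (((gateTerms l g).flatMap RawTerm.encode).reverse ++ txt) (ones (l * n))
        (ones n) outq post out [] []) (400 * (m + 1)) := by
  have hb : ∀ a b, a ≤ n → b ≤ n → ∀ ks : List Stack,
      (∀ k ∈ ks, k = .base ∨ k = .num ∨ k = .fst ∨ k = .snd) → ∀ k ∈ ks,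
      k ≠ .txt ∧ k ≠ .tmp ∧
      (mem rest txt (ones (l * n)) (ones n) outq post out (ones a) (ones b) k).length ≤ m := by
    intro a b ha hb ks hks k hk
    rcases hks k hk with rfl | rfl | rfl | rfl <;> simp <;> omega
  cases g with
  | H i =>
    have hi := i.2
    have e1 : (Gate.H i).encode ++ rest = .gateH :: (encodeNat i ++ rest) := rfl
    rw [e1, List.head?_cons, List.tail_cons]
    have h1 := readNat_runs (k := .fst) (by decide) none (some .gateH, r)
      (mem (encodeNat i ++ rest) txt (ones (l * n)) (ones n) outq post out [] []) i rest rfl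
    have hb' := hb i 0 hi.le (Nat.zero_le _)
    have h2 := ((Emits.emitOne (S := mem rest txt (ones (l * n)) (ones n) outq post out (ones i) [])
      (some .gateH, r) rfl [.base, .fst] (linTable 2) m (hb' _ (by simp)) (by decide)
      (by decide)).seq ((Emits.emitOne (some .gateH, r) rfl [.base, .num, .fst] (linTable 2) m
      (hb' _ (by simp)) (by decide) (by decide)).seq (Emits.emitOne (some .gateH, r) rfl
      [.base, .num, .num, .fst] (linTable 2) m (hb' _ (by simp)) (by decide) (by decide)))).runs
    have h3 := clear_runs .fst none (some .gateH, r) (mem rest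
      (((gateTerms l (.H i)).flatMap RawTerm.encode).reverse ++ txt) (ones (l * n)) (ones n) outq
      post out (ones i) [])
    simp only [update_mem_inp, update_mem_fst, mem_fst, List.append_nil] at h1
    have h := h1.seq ((h2.congr_right ?_).seq h3)
    · rw [update_mem_fst] at h
      refine (RunsIn.ite_true (by rfl) h).mono ?_
      simp only [mem_fst, List.length_replicate]
      omega
    · simp [gateTerms, Nat.add_assoc]
  | Tdg i =>
    have hi := i.2
    have e1 : (Gate.Tdg i).encode ++ rest = .gateT :: (encodeNat i ++ rest) := rfl
    rw [e1, List.head?_cons, List.tail_cons]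
    have h1 := readNat_runs (k := .fst) (by decide) none (some .gateT, r)
      (mem (encodeNat i ++ rest) txt (ones (l * n)) (ones n) outq post out [] []) i rest rfl
    have hb' := hb i 0 hi.le (Nat.zero_le _)
    have h2 := (Emits.emitOne (S := mem rest txt (ones (l * n)) (ones n) outq post out (ones i) [])
      (some .gateT, r) rfl [.base, .fst] (linTable 1) m (hb' _ (by simp)) (by decide)
      (by decide)).runs
    have h3 := clear_runs .fst none (some .gateT, r) (mem rest
      (((gateTerms l (.Tdg i)).flatMap RawTerm.encode).reverse ++ txt) (ones (l * n)) (ones n) outq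
      post out (ones i) [])
    simp only [update_mem_inp, update_mem_fst, mem_fst, List.append_nil] at h1
    have h := h1.seq ((h2.congr_right ?_).seq h3)
    · rw [update_mem_fst] at h
      refine (RunsIn.ite_false (by rfl) (RunsIn.ite_true (by rfl) h)).mono ?_
      simp only [mem_fst, List.length_replicate]
      omega
    · simp [gateTerms]
  | CZ i j hij =>
    have hi := i.2
    have hj := j.2
    have e1 : (Gate.CZ i j hij).encode ++ rest =
        .gateCZ :: (encodeNat i ++ (encodeNat j ++ rest)) := by simp [Gate.encode]
    rw [e1, List.head?_cons, List.tail_cons]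
    have h1 := readNat_runs (k := .fst) (by decide) none (some .gateCZ, r)
      (mem (encodeNat i ++ (encodeNat j ++ rest)) txt (ones (l * n)) (ones n) outq post out [] [])
      i (encodeNat j ++ rest) rfl
    have h1' := readNat_runs (k := .snd) (by decide) none (some .gateCZ, r)
      (mem (encodeNat j ++ rest) txt (ones (l * n)) (ones n) outq post out (ones i) []) j rest rfl
    have hb' := hb i j hi.le hj.le
    have h2 := (Emits.emitTwo
      (S := mem rest txt (ones (l * n)) (ones n) outq post out (ones i) (ones j))
      (some .gateCZ, r) rfl [.base, .fst] [.base, .snd] czTable m (hb' _ (by simp))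
      (hb' _ (by simp)) (by decide) (by decide) (by decide)).runs
    have h3 := clear_runs .fst none (some .gateCZ, r) (mem rest
      (((gateTerms l (.CZ i j hij)).flatMap RawTerm.encode).reverse ++ txt) (ones (l * n)) (ones n)
      outq post out (ones i) (ones j))
    rw [update_mem_fst] at h3
    have h4 := h3.seq (clear_runs .snd none (some .gateCZ, r) _)
    simp only [update_mem_inp, update_mem_fst, mem_fst, update_mem_snd, mem_snd,
      List.append_nil] at h1 h1' h4
    have h := h1.seq (h1'.seq ((h2.congr_right ?_).seq h4))
    · refine (RunsIn.ite_false (by rfl) (RunsIn.ite_false (by rfl) h)).mono ?_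
      simp only [List.length_replicate]
      omega
    · simp [gateTerms]

/-- Read all the gates and write their terms. -/
def transGates : Routine :=
  .loop (fun v => v.2.1.isSome) (transGate ;; emitLinks ;; emitLinks ;; .pop .inp setLook)

/-- Each round leaves `base` two layers further on, in step with `gatesTerms`, and pops the next
lookahead symbol; `none` signals the end of the input. -/
theorem transGates_runs {n : ℕ} (gs : List (Gate n)) (r) (l m : ℕ)
    (hm : (l + 2 * gs.length) * n ≤ m) (txt outq post out) :
    RunsIn transGates (none, (gs.flatMap Gate.encode).head?, r)
      (mem (gs.flatMap Gate.encode).tail txt (ones (l * n)) (ones n) outq post out [] [])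
      (none, none, r)
      (mem [] (((gatesTerms l gs).flatMap RawTerm.encode).reverse ++ txt)
        (ones ((l + 2 * gs.length) * n)) (ones n) outq post out [] [])
      (800 * gs.length * (m + 1) ^ 2 + 1) := by
  induction gs generalizing l txt with
  | nil =>
    refine RunsIn.mono (T := 1) (RunsIn.loop_false ?_) ?_
    · rfl
    · simp
  | cons g gs ih =>
    simp only [List.length_cons] at hm
    have hm2 : (l + 2) * n ≤ m := (Nat.mul_le_mul_right _ (by omega)).trans hm
    rw [Nat.add_mul] at hm2
    rw [List.flatMap_cons]
    have h1 := transGate_runs g r l m (by omega) (gs.flatMap Gate.encode) txt outq post out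
    have h2 := emitLinks_runs ((g.encode ++ gs.flatMap Gate.encode).head?, r) n l m (by omega)
      (gs.flatMap Gate.encode) (((gateTerms l g).flatMap RawTerm.encode).reverse ++ txt)
      outq post out [] []
    have h3 := emitLinks_runs ((g.encode ++ gs.flatMap Gate.encode).head?, r) n (l + 1) m
      (by rw [Nat.add_mul]; omega) (gs.flatMap Gate.encode) (((linkTerms n l).flatMap RawTerm.encode).reverse ++
        (((gateTerms l g).flatMap RawTerm.encode).reverse ++ txt)) outq post out [] []
    have h4 := h1.seq (h2.seq (h3.seq (RunsIn.pop .inp setLook _ _)))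
    simp only [setLook, update_mem_inp, mem_inp] at h4
    have h5 := ih (l + 2) (by refine le_trans (le_of_eq ?_) hm; ring)
      (((linkTerms n (l + 1)).flatMap RawTerm.encode).reverse ++
        (((linkTerms n l).flatMap RawTerm.encode).reverse ++
        (((gateTerms l g).flatMap RawTerm.encode).reverse ++ txt)))
    refine ((RunsIn.loop_true ?_ h4 h5).congr_right ?_).mono ?_
    · cases g <;> rfl
    · rw [show l + 2 + 2 * gs.length = l + 2 * (g :: gs).length by simp; ring]
      simp [gatesTerms]
    · simp only [List.length_cons]
      nlinarith [Nat.zero_le m]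

/-- Assemble the description of the QAOA circuit. -/
def assemble : Routine :=
  move .txt .out ;; pushAll .out (.layer :: encodeInt 1 ++ encodeInt 1).reverse ;;
  move .post .out ;; addTo .base .out ;; pushAll .out [.sep] ;; addTo .outq .out ;;
  addTo .base .out ;; pushAll .out [.sep] ;; addTo .num .out ;; addTo .base .out ;;
  clear .base ;; clear .num ;; clear .outq

/-- The output stack is built from its end. The unary header depends on the number of layers, known
only after all gates have been read; this is why the terms are first buffered in `txt`. -/
theorem assemble_runs (w) (txt : List Tok) (b n q : ℕ) (post : List Tok) :
    RunsIn assemble (none, w) (mem [] txt (ones b) (ones n) (ones q) post [] [] []) (none, w)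
      (mem [] [] [] [] [] [] (encodeNat (b + n) ++ (encodeNat (b + q) ++
        (ones b ++ (post.reverse ++ ((.layer :: encodeInt 1 ++ encodeInt 1) ++ txt.reverse)))))
        [] [])
      (3 * txt.length + 3 * post.length + 24 * b + 10 * n + 10 * q + 70) := by
  have hlen : (Tok.layer :: encodeInt 1 ++ encodeInt 1).reverse.length = 7 := by decide
  obtain ⟨ly, hly⟩ : ∃ ly, ly = (Tok.layer :: encodeInt 1 ++ encodeInt 1) := ⟨_, rfl⟩
  rw [← hly] at hlen ⊢
  have a : ∀ k : Stack, k ≠ .out → k ≠ .tmp → ∀ S : Contents, S .tmp = [] → RunsIn (addTo k .out)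
      (none, w) S (none, w) (Function.update S .out (ones (S k).length ++ S .out))
      (7 * (S k).length + 4) := fun k h h' S hS => addTo_runs h h' (by decide) none w S hS
  have h := (move_runs (k := .txt) (d := .out) (by decide) none w
    (mem [] txt (ones b) (ones n) (ones q) post [] [] [])).seq
    ((pushAll_runs .out ly.reverse (none, w) _).seq
    ((move_runs (k := .post) (d := .out) (by decide) none w _).seq
    ((a .base (by decide) (by decide) _ (by simp)).seq
    ((pushAll_runs .out [.sep] (none, w) _).seq
    ((a .outq (by decide) (by decide) _ (by simp)).seq
    ((a .base (by decide) (by decide) _ (by simp)).seq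
    ((pushAll_runs .out [.sep] (none, w) _).seq
    ((a .num (by decide) (by decide) _ (by simp)).seq
    ((a .base (by decide) (by decide) _ (by simp)).seq
    ((clear_runs .base none w _).seq
    ((clear_runs .num none w _).seq (clear_runs .outq none w _))))))))))))
  simp only [update_mem_txt, update_mem_base, update_mem_num, update_mem_outq, update_mem_post,
    update_mem_out, mem_txt, mem_base, mem_num, mem_outq, mem_post, mem_out,
    List.length_replicate, hlen] at h
  unfold assemble
  rw [← hly]
  refine (h.congr_right ?_).mono ?_
  · congr 1
    simp only [encodeNat, ones, List.append_nil, List.reverse_reverse, List.reverse_singleton,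
      List.append_assoc, List.singleton_append, List.replicate_add]
  · simp only [List.length_singleton]
    omega

/-- The translator from circuits to QAOA circuits of depth one. -/
def transCircuit : Routine :=
  readNat .num ;; readNat .outq ;; readBits ;; emitLinks ;; transGates ;; emitLinks ;; emitLast ;;
    assemble

theorem length_encodeNat (k : ℕ) : (encodeNat k).length = k + 1 := by simp [encodeNat]

theorem length_le_length_flatMap {α β : Type*} (f : α → List β) (hf : ∀ a, f a ≠ []) (l : List α) :
    l.length ≤ (l.flatMap f).length := by
  induction l with
  | nil => simp
  | cons a l ih =>
    have := List.length_pos_iff.2 (hf a)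
    simp only [List.length_cons, List.flatMap_cons, List.length_append]
    omega

theorem Readout.postBits_mem {n : ℕ} (r : Readout n) : ∀ b ∈ r.postBits, b = .zero ∨ b = .one := by
  intro b hb
  simp only [Readout.postBits, List.mem_ofFn] at hb
  obtain ⟨i, rfl⟩ := hb
  unfold encodeBit
  split <;> simp

/-- A step of a structured program pushes at most one symbol. Applied to `txt`, this bounds the
buffered text by the time spent on writing it. -/
theorem Prog.RunsIn.length_le {K Γ σ : Type} [DecidableEq K] {p : Prog K Γ σ} {v v' : σ}
    {S S' : K → List Γ} {T : ℕ} (h : RunsIn p v S v' S' T) (k : K) :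
    (S' k).length ≤ (S k).length + T := by
  obtain ⟨t, ht, h⟩ := h
  suffices (S' k).length ≤ (S k).length + t by omega
  clear ht
  induction h with
  | push k' f v S =>
    by_cases h : k = k'
    · subst h; simp
    · simp [h]
  | pop k' f v S =>
    by_cases h : k = k'
    · subst h; simp; omega
    · simp [h]
  | load f v S => omega
  | seq _ _ ih₁ ih₂ => omega
  | ite_true _ _ ih => omega
  | ite_false _ _ ih => omega
  | loop_true _ _ _ ih₁ ih₂ => omega
  | loop_false _ => omega

theorem transCircuit_runs (C : Circuit) :
    RunsIn transCircuit (none, none, 0) (mem C.encode [] [] [] [] [] [] [] [])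
      (none, none, 0) (mem [] [] [] [] [] [] C.toQAOA.encode [] [])
      (40000 * (C.encode.length + 1) ^ 5) := by
  obtain ⟨n, ⟨q, post, hq⟩, gs⟩ := C
  obtain ⟨rd, hrd⟩ : ∃ rd : Readout n, rd = ⟨q, post, hq⟩ := ⟨_, rfl⟩
  rw [← hrd]
  have hqn := q.2
  obtain ⟨m, hm⟩ : ∃ m, m = (2 * gs.length + 3) * n := ⟨_, rfl⟩
  have hm' : 2 * gs.length * n + 3 * n = m := by rw [hm]; ring
  have henc : (Circuit.mk n rd gs).encode = encodeNat n ++ (encodeNat q ++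
      (rd.postBits ++ gs.flatMap Gate.encode)) := by
    simp [Circuit.encode, Readout.encode, Readout.postBits, hrd]
  have hpb : rd.postBits.length = n := by simp [Readout.postBits]
  have h1 := readNat_runs (k := .num) (by decide) none (none, 0)
    (mem (Circuit.mk n rd gs).encode [] [] [] [] [] [] [] []) n _ henc
  have h2 := readNat_runs (k := .outq) (by decide) none (none, 0)
    (mem (encodeNat q ++ (rd.postBits ++ gs.flatMap Gate.encode)) [] [] (ones n) [] [] [] [] [])
    q _ rfl
  simp only [update_mem_inp, update_mem_num, update_mem_outq, mem_num, mem_outq,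
    List.append_nil] at h1 h2
  have h3 := readBits_runs rd.postBits (gs.flatMap Gate.encode) rd.postBits_mem (by
    cases gs with
    | nil => simp
    | cons g gs => cases g <;> simp [Gate.encode]) none 0 [] [] (ones n) (ones q) [] [] [] []
  have h4 := emitLinks_runs ((gs.flatMap Gate.encode).head?, 0) n 0 m (by omega)
    (gs.flatMap Gate.encode).tail [] (ones q) rd.postBits.reverse [] [] []
  have h5 := transGates_runs gs 0 1 m (by rw [Nat.add_mul]; omega)
    ((linkTerms n 0).flatMap RawTerm.encode).reverse (ones q) rd.postBits.reverse []
  have h6 := emitLinks_runs (none, 0) n (1 + 2 * gs.length) m (by rw [Nat.add_mul]; omega)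
    [] (((gatesTerms 1 gs).flatMap RawTerm.encode).reverse ++
      ((linkTerms n 0).flatMap RawTerm.encode).reverse) (ones q) rd.postBits.reverse [] [] []
  have h7 := emitLast_runs (none, 0) n (1 + 2 * gs.length + 1) m (by
    rw [Nat.add_mul, Nat.add_mul]; omega) []
    (((linkTerms n (1 + 2 * gs.length)).flatMap RawTerm.encode).reverse ++
      (((gatesTerms 1 gs).flatMap RawTerm.encode).reverse ++
      ((linkTerms n 0).flatMap RawTerm.encode).reverse)) (ones q) rd.postBits.reverse [] [] []
  rw [List.append_nil] at h3 h4
  rw [Nat.zero_mul] at h4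
  have hlen := (h4.seq (h5.seq (h6.seq h7))).length_le .txt
  have h8 := assemble_runs (none, 0) (((lastTerms n (1 + 2 * gs.length + 1)).flatMap
    RawTerm.encode).reverse ++
    (((linkTerms n (1 + 2 * gs.length)).flatMap RawTerm.encode).reverse ++
      (((gatesTerms 1 gs).flatMap RawTerm.encode).reverse ++
      ((linkTerms n 0).flatMap RawTerm.encode).reverse))) ((1 + 2 * gs.length + 1) * n) n q
      rd.postBits.reverse
  have h := h1.seq (h2.seq (h3.seq (h4.seq (h5.seq (h6.seq (h7.seq h8))))))
  refine (h.congr_right ?_).mono ?_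
  · rw [Circuit.encode_toQAOA]
    have e1 : (Circuit.mk n rd gs).lastLayer = 1 + 2 * gs.length + 1 := by
      simp [Circuit.lastLayer]; omega
    have e2 : (1 + 2 * gs.length + 1 + 1) * n = (1 + 2 * gs.length + 1) * n + n :=
      Nat.succ_mul _ _
    rw [Circuit.rawTerms, e1, e2]
    congr 1
    subst hrd
    simp [show 2 * gs.length + 1 = 1 + 2 * gs.length by omega]
  · have hG := length_le_length_flatMap Gate.encode (by intro g; cases g <;> simp [Gate.encode]) gs
    obtain ⟨L, hL⟩ : ∃ L, L = (Circuit.mk n rd gs).encode.length := ⟨_, rfl⟩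
    have hL' := hL
    rw [henc] at hL'
    simp only [List.length_append, length_encodeNat, hpb] at hL'
    rw [← hL]
    simp only [mem_txt, List.length_nil, List.length_append, Nat.zero_add] at hlen
    simp only [List.length_append, List.length_reverse, hpb] at hlen ⊢
    have hb : (1 + 2 * gs.length + 1) * n ≤ m := by rw [Nat.add_mul, Nat.add_mul]; omega
    -- The number `m` of variables is quadratic in the input length, a gate costs order `(m + 1) ^
    -- 2` steps, and there are at most `L` gates; hence degree five.
    have hm1 : m + 1 ≤ 3 * (L + 1) ^ 2 := by
      have : (2 * gs.length + 3) * n ≤ (2 * L + 3) * L := Nat.mul_le_mul (by omega) (by omega)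
      rw [hm]
      nlinarith
    have hm2 : (m + 1) ^ 2 ≤ 9 * (L + 1) ^ 4 := by
      calc (m + 1) ^ 2 ≤ (3 * (L + 1) ^ 2) ^ 2 := Nat.pow_le_pow_left hm1 2
        _ = 9 * (L + 1) ^ 4 := by ring
    have hm3 : gs.length * (m + 1) ^ 2 ≤ L * (9 * (L + 1) ^ 4) :=
      Nat.mul_le_mul (by omega) hm2
    have hp : ∀ k, (L + 1) ≤ (L + 1) ^ (k + 1) := fun k => Nat.le_self_pow (by omega) _
    have hp4 : (L + 1) ^ 5 = L * (L + 1) ^ 4 + (L + 1) ^ 4 := by ring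
    have hp2 : (L + 1) ^ 2 ≤ (L + 1) ^ 4 := Nat.pow_le_pow_right (by omega) (by omega)
    have := hp 3
    have e2 : 800 * gs.length * (m + 1) ^ 2 = 800 * (gs.length * (m + 1) ^ 2) := by ring
    have e3 : L * (9 * (L + 1) ^ 4) = 9 * (L * (L + 1) ^ 4) := by ring
    rw [hp4]
    rw [e2] at hlen ⊢
    rw [e3] at hm3
    have hp6 : (L + 1) ^ 4 ≤ L * (L + 1) ^ 4 := Nat.le_mul_of_pos_left _ (by omega)
    omega

/-- The translation of circuits into QAOA circuits takes polynomial time. -/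
theorem polyTime_toQAOA : PolyTime Circuit.encode QAOA.encode Circuit.toQAOA := by
  refine Prog.polyTime transCircuit .inp .out (none, none, 0) (40000 * (.X + 1) ^ 5) fun C => ?_
  rw [update_nil_inp, update_nil_out]
  simpa using transCircuit_runs C

end PostSel

/-! ### Fourier analysis of the mixing operator. -/

namespace PostSel

open Matrix

/-! ## The Walsh–Hadamard characters and the mixing operator -/

variable {n : ℕ}

/-- The character `(-1)^{x · y}`. -/
noncomputable def chi (x y : Fin n → Bool) : ℂ := ∏ j, if x j && y j then -1 else 1

theorem chi_comm (x y : Fin n → Bool) : chi x y = chi y x := by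
  simp only [chi, Bool.and_comm]

theorem sum_prod_bool (f : Fin n → Bool → ℂ) :
    ∑ x : Fin n → Bool, ∏ j, f j (x j) = ∏ j, (f j false + f j true) := by
  have := Finset.prod_univ_sum (fun _ : Fin n => (Finset.univ : Finset Bool)) f
  rw [Fintype.piFinset_univ] at this
  rw [← this]
  refine Finset.prod_congr rfl fun j _ => ?_
  rw [Fintype.sum_bool, add_comm]

/-- Orthogonality of characters, used as: two unnormalised Hadamard transforms compose to 2^n. The
sum factors over coordinates, and a coordinate where `y` and `w` differ contributes 1 - 1. -/
theorem sum_chi_mul_chi (y w : Fin n → Bool) :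
    ∑ x, chi y x * chi x w = if y = w then 2 ^ n else 0 := by
  have h : ∀ x : Fin n → Bool, chi y x * chi x w =
      ∏ j, ((if y j && x j then -1 else 1) * (if x j && w j then -1 else 1)) := fun x => by
    rw [chi, chi, Finset.prod_mul_distrib]
  simp only [h]
  rw [sum_prod_bool fun j b => (if y j && b then (-1 : ℂ) else 1) * (if b && w j then -1 else 1)]
  split_ifs with hyw
  · subst hyw
    rw [Finset.prod_congr rfl (g := fun _ => (2 : ℂ)), Finset.prod_const, Finset.card_univ,
      Fintype.card_fin]
    intro j _
    cases y j <;> norm_num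
  · obtain ⟨j, hj⟩ := Function.ne_iff.1 hyw
    refine Finset.prod_eq_zero (Finset.mem_univ j) ?_
    revert hj
    cases y j <;> cases w j <;> norm_num

/-- Flip the bit `j`. -/
def flipBit (j : Fin n) (x : Fin n → Bool) : Fin n → Bool := Function.update x j (!x j)

theorem flipBit_flipBit (j : Fin n) (x : Fin n → Bool) : flipBit j (flipBit j x) = x := by
  simp [flipBit]

theorem chi_flipBit (j : Fin n) (x y : Fin n → Bool) :
    chi (flipBit j x) y = (if y j then -1 else 1) * chi x y := by
  simp only [chi]
  rw [← Finset.mul_prod_erase _ _ (Finset.mem_univ j), ← Finset.mul_prod_erase _ _ (Finset.mem_univ j),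
    ← mul_assoc]
  congr 1
  · simp only [flipBit, Function.update_self]
    cases x j <;> cases y j <;> norm_num
  · refine Finset.prod_congr rfl fun k hk => ?_
    simp [flipBit, Finset.ne_of_mem_erase hk]

/-- The matrix of the characters. -/
noncomputable def walsh (n : ℕ) : Matrix (Fin n → Bool) (Fin n → Bool) ℂ := Matrix.of chi

theorem walsh_mul_walsh : walsh n * walsh n = (2 ^ n : ℂ) • (1 : Matrix _ _ ℂ) := by
  ext y w
  simp only [Matrix.mul_apply, walsh, Matrix.of_apply, sum_chi_mul_chi, Matrix.smul_apply,
    Matrix.one_apply, smul_eq_mul]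
  split_ifs <;> simp

/-- The eigenvalues of the mixing operator. -/
noncomputable def mixerEigenvalue (s : Fin n → Bool) : ℂ := ∑ j, if s j then -1 else 1

/-- Flipping bit `j` multiplies the character of `s` by (-1)^{s_j}, so the characters are common
eigenvectors of all X_j. -/
theorem mixer_mul_walsh : mixer n * walsh n = walsh n * Matrix.diagonal mixerEigenvalue := by
  ext z s
  rw [Matrix.mul_diagonal, mixer, Finset.sum_mul, Matrix.sum_apply]
  simp only [walsh, Matrix.mul_apply, Matrix.of_apply, mixerEigenvalue, Finset.mul_sum]
  refine Finset.sum_congr rfl fun j _ => ?_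
  rw [Finset.sum_eq_single (flipBit j z)]
  · rw [if_pos (by exact (flipBit_flipBit j z).symm), chi_flipBit, one_mul, mul_comm]
  · intro b _ hb
    rw [if_neg, zero_mul]
    rintro rfl
    exact hb (flipBit_flipBit j b).symm
  · simp

/-- The Walsh matrix is its own inverse up to 2^n, so it diagonalises the mixer and the exponential
is taken on the diagonal. -/
theorem exp_smul_mixer (c : ℂ) : NormedSpace.exp (c • mixer n) =
    ((2 : ℂ) ^ n)⁻¹ • (walsh n * Matrix.diagonal (fun s => Complex.exp (c * mixerEigenvalue s)) *
      walsh n) := by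
  have h2 : (2 : ℂ) ^ n ≠ 0 := pow_ne_zero _ two_ne_zero
  have hinv : walsh n * (((2 : ℂ) ^ n)⁻¹ • walsh n) = 1 := by
    rw [Matrix.mul_smul, walsh_mul_walsh, smul_smul, inv_mul_cancel₀ h2, one_smul]
  have hinv' : (walsh n)⁻¹ = ((2 : ℂ) ^ n)⁻¹ • walsh n := Matrix.inv_eq_right_inv hinv
  have hU : IsUnit (walsh n) := IsUnit.of_mul_eq_one _ hinv
  have hc : c • mixer n = walsh n * Matrix.diagonal (fun s => c * mixerEigenvalue s) *
      (walsh n)⁻¹ := by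
    have : Matrix.diagonal (fun s : Fin n → Bool => c * mixerEigenvalue s) =
        c • Matrix.diagonal mixerEigenvalue := by
      rw [← Matrix.diagonal_smul]; rfl
    rw [this, Matrix.mul_smul, ← mixer_mul_walsh, Matrix.smul_mul, Matrix.mul_assoc, hinv', hinv,
      Matrix.mul_one]
  rw [hc, Matrix.exp_conj _ _ hU, Matrix.exp_diagonal, hinv', Matrix.mul_smul]
  congr 4
  funext s
  rw [Pi.coe_exp, Complex.exp_eq_exp_ℂ]

/-- The state that is prepared by a QAOA circuit of depth one. -/
theorem qaoaState_singleton (cost : (Fin n → Bool) → ℝ) (β γ : ℝ) (z : Fin n → Bool) :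
    qaoaState cost [(β, γ)] z = ((2 : ℂ) ^ n)⁻¹ * ∑ s, chi z s *
      Complex.exp (-(Complex.I * β) * mixerEigenvalue s) * ∑ x, chi s x *
        (Complex.exp (-(Complex.I * γ) * cost x) * (1 / (Real.sqrt 2 : ℂ)) ^ n) := by
  have hd : NormedSpace.exp ((-(Complex.I * (γ : ℂ))) • Matrix.diagonal fun z => ((cost z : ℝ) : ℂ)) =
      Matrix.diagonal fun z => Complex.exp (-(Complex.I * γ) * cost z) := by
    rw [← Matrix.diagonal_smul, Matrix.exp_diagonal]
    congr 1
    funext s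
    rw [Pi.coe_exp, Complex.exp_eq_exp_ℂ]
    rfl
  simp only [qaoaState, List.foldl_cons, List.foldl_nil, hd, exp_smul_mixer]
  rw [Matrix.smul_mulVec, Pi.smul_apply, smul_eq_mul, Matrix.mul_assoc, ← Matrix.mulVec_mulVec,
    ← Matrix.mulVec_mulVec]
  congr 1
  refine Finset.sum_congr rfl fun s _ => ?_
  rw [Matrix.mulVec_diagonal, mul_assoc]
  simp only [walsh, Matrix.of_apply]
  congr 2
  refine Finset.sum_congr rfl fun x _ => ?_
  rw [Matrix.mulVec_diagonal]
  rfl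

end PostSel

namespace PostSel

variable {n : ℕ}

/-! ## Eighth roots of unity -/

/-- The phase `e^{-iπ/4}` of the gate `T†`. -/
noncomputable def omega : ℂ := Complex.exp (-(Complex.I * (Real.pi / 4)))

theorem omega_ne_zero : omega ≠ 0 := Complex.exp_ne_zero _

theorem omega_zpow (c : ℤ) : omega ^ c = Complex.exp (-(Complex.I * (Real.pi / 4)) * c) := by
  rw [omega, ← Complex.exp_int_mul, mul_comm]

theorem omega_pow_two : omega ^ 2 = -Complex.I := by
  rw [omega, ← Complex.exp_nat_mul]
  have : ((2 : ℕ) : ℂ) * -(Complex.I * (Real.pi / 4)) = -(Real.pi / 2 * Complex.I) := by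
    push_cast; ring
  rw [this, Complex.exp_neg, Complex.exp_pi_div_two_mul_I, Complex.inv_I]

theorem omega_pow_four : omega ^ 4 = -1 := by
  rw [show 4 = 2 * 2 by rfl, pow_mul, omega_pow_two]
  simp

theorem omega_pow_eight : omega ^ 8 = 1 := by
  rw [show 8 = 4 * 2 by rfl, pow_mul, omega_pow_four]
  simp

theorem norm_omega : ‖omega‖ = 1 := by
  rw [omega, Complex.norm_exp]
  simp

theorem sqrt_two_ne_zero : (Real.sqrt 2 : ℂ) ≠ 0 := by
  rw [Complex.ofReal_ne_zero]; positivity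

theorem sqrt_two_sq : (Real.sqrt 2 : ℂ) ^ 2 = 2 := by
  rw [← Complex.ofReal_pow, Real.sq_sqrt (by norm_num)]; norm_num

theorem omega_eq : omega = (1 - Complex.I) / (Real.sqrt 2 : ℂ) := by
  have h : (-(Complex.I * (Real.pi / 4)) : ℂ) = ((-(Real.pi / 4) : ℝ) : ℂ) * Complex.I := by
    push_cast; ring
  have hs0 := sqrt_two_ne_zero
  rw [omega, h, Complex.exp_mul_I, ← Complex.ofReal_cos, ← Complex.ofReal_sin, Real.cos_neg,
    Real.sin_neg, Real.cos_pi_div_four, Real.sin_pi_div_four]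
  push_cast
  field_simp
  rw [sqrt_two_sq]
  ring

/-- The phase `(-i)^{|x|}`. -/
noncomputable def phase (x : Fin n → Bool) : ℂ := ∏ j, if x j then -Complex.I else 1

theorem norm_phase (x : Fin n → Bool) : ‖phase x‖ = 1 := by
  rw [phase, norm_prod]
  refine Finset.prod_eq_one fun j _ => ?_
  split_ifs <;> simp

/-- Everything factors over qubits. For one qubit the claim is that cos(π/4) on the diagonal and -i
sin(π/4) off it equal (1/√2)(-i)^z(-i)^x(-1)^{zx}; for z = x = 1 the factor (-i)² cancels the sign.
-/
theorem mixer_kernel (z x : Fin n → Bool) :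
    ((2 : ℂ) ^ n)⁻¹ * ∑ s, chi z s * Complex.exp (-(Complex.I * ((Real.pi / 4 : ℝ) : ℂ)) *
      mixerEigenvalue s) * chi s x =
      (1 / (Real.sqrt 2 : ℂ)) ^ n * (phase z * phase x * chi z x) := by
  have h1 : ∀ s : Fin n → Bool, Complex.exp (-(Complex.I * ((Real.pi / 4 : ℝ) : ℂ)) *
      mixerEigenvalue s) = ∏ j, if s j then omega⁻¹ else omega := fun s => by
    rw [mixerEigenvalue, Finset.mul_sum, Complex.exp_sum]
    refine Finset.prod_congr rfl fun j _ => ?_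
    push_cast
    split_ifs
    · rw [omega, ← Complex.exp_neg]; congr 1; ring
    · rw [omega, mul_one]
  simp only [h1]
  have h2 : ∀ s : Fin n → Bool, chi z s * (∏ j, if s j then omega⁻¹ else omega) * chi s x =
      ∏ j, ((if z j && s j then -1 else 1) * (if s j then omega⁻¹ else omega) *
        (if s j && x j then -1 else 1)) := fun s => by
    rw [chi, chi, Finset.prod_mul_distrib, Finset.prod_mul_distrib]
  simp only [h2]
  rw [sum_prod_bool fun j b => (if z j && b then (-1 : ℂ) else 1) *
    (if b then omega⁻¹ else omega) * (if b && x j then -1 else 1)]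
  rw [phase, phase, chi, ← Finset.prod_mul_distrib, ← Finset.prod_mul_distrib, ← inv_pow]
  have h3 : ∀ c : ℂ, c ^ n = ∏ _j : Fin n, c := fun c => by simp
  rw [h3, h3, ← Finset.prod_mul_distrib, ← Finset.prod_mul_distrib]
  refine Finset.prod_congr rfl fun j _ => ?_
  have hinv : omega⁻¹ = (1 + Complex.I) / (Real.sqrt 2 : ℂ) := by
    rw [inv_eq_iff_eq_inv, omega_eq, inv_div, div_eq_div_iff sqrt_two_ne_zero]
    · linear_combination (-1 : ℂ) * Complex.I_sq - sqrt_two_sq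
    · intro h0
      have := congrArg Complex.re h0
      simp at this
  rw [hinv, omega_eq]
  have hs := sqrt_two_ne_zero
  cases z j <;> cases x j <;> simp <;> field_simp <;> ring_nf

end PostSel

/-! ### Circuit amplitudes as sums over layered paths. -/

namespace PostSel

variable {n : ℕ}

/-! ## Gates as sums over two layers -/

/-- The phase contributed by the terms of a gate, as a function of the variables of three
consecutive layers. -/
noncomputable def gatePhase : Gate n → (Fin n → Bool) → (Fin n → Bool) → (Fin n → Bool) → ℂ
  | .H i, x, y, u => (if x i then -Complex.I else 1) * (if y i then -Complex.I else 1) *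
      (if u i then -Complex.I else 1)
  | .Tdg i, x, _, _ => if x i then omega else 1
  | .CZ i j _, x, _, _ => if x i && x j then -1 else 1

/-- The factor 2^n comes from two unnormalised Hadamard transforms; the rest, for `H`, is the scalar
by which S†·(H S† H)·S† differs from H. -/
noncomputable def gateConst : Gate n → ℂ
  | .H _ => 2 ^ n * ((1 - Complex.I) / 2 * Real.sqrt 2)
  | _ => 2 ^ n

theorem gateConst_ne_zero (g : Gate n) : gateConst g ≠ 0 := by
  have h2 : (2 : ℂ) ^ n ≠ 0 := pow_ne_zero _ two_ne_zero
  cases g with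
  | H i =>
    refine mul_ne_zero h2 (mul_ne_zero (div_ne_zero ?_ two_ne_zero) sqrt_two_ne_zero)
    intro h0
    have := congrArg Complex.re h0
    simp at this
  | Tdg i => exact h2
  | CZ i j h => exact h2

theorem sum_mul_sum_chi (ψ : State n) (u : Fin n → Bool) :
    ∑ x, ψ x * ∑ y, chi x y * chi y u = 2 ^ n * ψ u := by
  simp [sum_chi_mul_chi, mul_comm]

/-- A Z between two Hadamard transforms is an X. -/
theorem sum_mul_sum_ite_chi (ψ : State n) (i : Fin n) (u : Fin n → Bool) :
    ∑ x, ψ x * ∑ y, (if y i then -1 else 1) * (chi x y * chi y u) = 2 ^ n * ψ (flipBit i u) := by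
  have h : ∀ x y : Fin n → Bool, (if y i then -1 else 1) * (chi x y * chi y u) =
      chi x y * chi y (flipBit i u) := fun x y => by
    rw [chi_comm y (flipBit i u), chi_flipBit, chi_comm u y]; ring
  simp only [h]
  exact sum_mul_sum_chi ψ _

/-- Diagonal gates act on the first layer and the two transforms then cancel. For `H` the middle
phase does not commute with the transforms; it turns the identity into H S† H on qubit `i`, and the
outer phases complete the Euler decomposition of H. -/
theorem sum_gatePhase (g : Gate n) (ψ : State n) (u : Fin n → Bool) :
    ∑ x, ∑ y, ψ x * (gatePhase g x y u * (chi x y * chi y u)) = gateConst g * g.apply ψ u := by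
  cases g with
  | H i =>
    -- This expands S† as a combination of I and Z, so that each summand falls under one of the two
    -- preceding identities.
    have hs : ∀ b : Bool, (if b then -Complex.I else 1) =
        (1 - Complex.I) / 2 + (1 + Complex.I) / 2 * (if b then -1 else 1) := by
      intro b; cases b <;> simp <;> ring
    have h1 : ∀ x y : Fin n → Bool, ψ x * (gatePhase (.H i) x y u * (chi x y * chi y u)) =
        (1 - Complex.I) / 2 * (if u i then -Complex.I else 1) *
          (((if x i then -Complex.I else 1) * ψ x) * (chi x y * chi y u)) +
        (1 + Complex.I) / 2 * (if u i then -Complex.I else 1) *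
          (((if x i then -Complex.I else 1) * ψ x) *
            ((if y i then -1 else 1) * (chi x y * chi y u))) := by
      intro x y
      simp only [gatePhase]
      rw [hs (y i)]
      ring
    simp only [h1, Finset.sum_add_distrib, ← Finset.mul_sum]
    rw [sum_mul_sum_chi (fun x => (if x i then -Complex.I else 1) * ψ x),
      sum_mul_sum_ite_chi (fun x => (if x i then -Complex.I else 1) * ψ x)]
    have hu := sqrt_two_ne_zero
    have h2 : (flipBit i u) i = !u i := by simp [flipBit]
    simp only [gateConst, Gate.apply, h2]
    cases hui : u i with
    | false =>
      have e1 : Function.update u i false = u := by rw [← hui]; simp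
      have e2 : Function.update u i true = flipBit i u := by simp [flipBit, hui]
      rw [e1, e2]
      simp only [Bool.not_false, if_true, Bool.false_eq_true, if_false]
      field_simp
      linear_combination ((-1 : ℂ) * ψ (flipBit i u)) * Complex.I_sq
    | true =>
      have e1 : Function.update u i true = u := by rw [← hui]; simp
      have e2 : Function.update u i false = flipBit i u := by simp [flipBit, hui]
      rw [e1, e2]
      simp only [Bool.not_true, if_true, Bool.false_eq_true, if_false]
      field_simp
      linear_combination (ψ u - Complex.I * ψ u - ψ (flipBit i u)) * Complex.I_sq
  | Tdg i =>
    have := sum_mul_sum_chi (fun x => ψ x * if x i then omega else 1) u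
    simp only [Finset.mul_sum] at this
    simp only [gatePhase, gateConst, Gate.apply]
    refine Eq.trans (Finset.sum_congr rfl fun x _ => Finset.sum_congr rfl fun y _ => ?_)
      (this.trans ?_)
    · ring
    · rw [mul_comm (ψ u)]; rfl
  | CZ i j h =>
    have := sum_mul_sum_chi (fun x => ψ x * if x i && x j then -1 else 1) u
    simp only [Finset.mul_sum] at this
    simp only [gatePhase, gateConst, Gate.apply]
    refine Eq.trans (Finset.sum_congr rfl fun x _ => Finset.sum_congr rfl fun y _ => ?_)
      (this.trans ?_)
    · ring
    · rw [mul_comm (ψ u)]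

/-! ## Sums over all layers -/

/-- The product of all phases, as a function of the variables of all layers; `z` is the measured
value. -/
noncomputable def pathPhase (z : Fin n → Bool) : ℕ → List (Gate n) → (ℕ → Fin n → Bool) → ℂ
  | l, [], X => chi (X l) (X (l + 1)) * chi (X (l + 1)) z
  | l, g :: gs, X => gatePhase g (X l) (X (l + 1)) (X (l + 2)) *
      (chi (X l) (X (l + 1)) * chi (X (l + 1)) (X (l + 2))) * pathPhase z (l + 2) gs X

theorem pathPhase_succ (z : Fin n → Bool) (l : ℕ) (gs : List (Gate n)) (X : ℕ → Fin n → Bool) :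
    pathPhase z (l + 1) gs X = pathPhase z l gs fun j => X (j + 1) := by
  induction gs generalizing l with
  | nil => rfl
  | cons g gs ih =>
    simp only [pathPhase]
    rw [show l + 1 + 2 = (l + 2) + 1 by ring, ih]

/-- A finite sequence of assignments, extended to all natural numbers. -/
def extendLayers {k : ℕ} (X : Fin k → Fin n → Bool) (l : ℕ) : Fin n → Bool :=
  if h : l < k then X ⟨l, h⟩ else fun _ => false

theorem extendLayers_cons_zero {k : ℕ} (x : Fin n → Bool) (X : Fin k → Fin n → Bool) :
    extendLayers (Fin.cons x X : Fin (k + 1) → Fin n → Bool) 0 = x := by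
  simp [extendLayers]

theorem extendLayers_cons_succ {k : ℕ} (x : Fin n → Bool) (X : Fin k → Fin n → Bool) (l : ℕ) :
    extendLayers (Fin.cons x X : Fin (k + 1) → Fin n → Bool) (l + 1) = extendLayers X l := by
  by_cases h : l < k
  · rw [extendLayers, dif_pos (Nat.succ_lt_succ h), extendLayers, dif_pos h]
    exact Fin.cons_succ (α := fun _ => Fin n → Bool) x X ⟨l, h⟩
  · rw [extendLayers, dif_neg (by omega), extendLayers, dif_neg h]

theorem sum_fin_cons {A : Type*} [Fintype A] {k : ℕ} (F : (Fin (k + 1) → A) → ℂ) :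
    ∑ X, F X = ∑ a, ∑ X : Fin k → A, F (Fin.cons a X) := by
  classical
  rw [← Fintype.sum_prod_type' (f := fun a (X : Fin k → A) => F (Fin.cons a X))]
  exact (Fintype.sum_equiv (Fin.consEquiv fun _ => A) _ _ fun _ => rfl).symm

noncomputable def gatesConst : List (Gate n) → ℂ
  | [] => 2 ^ n
  | g :: gs => gateConst g * gatesConst gs

theorem gatesConst_ne_zero (gs : List (Gate n)) : gatesConst gs ≠ 0 := by
  induction gs with
  | nil => exact pow_ne_zero _ two_ne_zero
  | cons g gs ih => exact mul_ne_zero (gateConst_ne_zero g) ih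

/-- The first two layers are summed out against `ψ`, which becomes the state after the first gate;
the remaining layers form the path sum of the remaining gates. -/
theorem sum_pathPhase (z : Fin n → Bool) (gs : List (Gate n)) (ψ : State n) :
    ∑ X : Fin (2 * gs.length + 2) → Fin n → Bool,
      ψ (extendLayers X 0) * pathPhase z 0 gs (extendLayers X) =
      gatesConst gs * gs.foldl (fun ψ g => g.apply ψ) ψ z := by
  induction gs generalizing ψ with
  | nil =>
    rw [show 2 * ([] : List (Gate n)).length + 2 = 0 + 1 + 1 by rfl, sum_fin_cons]
    simp only [sum_fin_cons, Finset.univ_unique, Finset.sum_singleton, pathPhase, zero_add,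
      extendLayers_cons_zero, extendLayers_cons_succ _ _ 0]
    simp only [← Finset.mul_sum, sum_mul_sum_chi]
    rfl
  | cons g gs ih =>
    rw [show 2 * (g :: gs).length + 2 = 2 * gs.length + 2 + 1 + 1 by
      simp only [List.length_cons]; ring, sum_fin_cons]
    refine (Finset.sum_congr rfl fun x _ => sum_fin_cons _).trans ?_
    have h : ∀ (x y : Fin n → Bool) (X : Fin (2 * gs.length + 2) → Fin n → Bool),
        ψ (extendLayers (Fin.cons x (Fin.cons y X : Fin (2 * gs.length + 2 + 1) → _) :
          Fin (2 * gs.length + 2 + 1 + 1) → _) 0) *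
        pathPhase z 0 (g :: gs) (extendLayers (Fin.cons x (Fin.cons y X :
          Fin (2 * gs.length + 2 + 1) → _) : Fin (2 * gs.length + 2 + 1 + 1) → _)) =
        (ψ x * (gatePhase g x y (extendLayers X 0) *
          (chi x y * chi y (extendLayers X 0)))) * pathPhase z 0 gs (extendLayers X) := by
      intro x y X
      simp only [pathPhase]
      rw [pathPhase_succ, pathPhase_succ]
      simp only [zero_add, extendLayers_cons_zero, extendLayers_cons_succ]
      ring
    simp only [h]
    have h2 : ∑ x, ∑ y, ∑ X : Fin (2 * gs.length + 2) → Fin n → Bool,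
        (ψ x * (gatePhase g x y (extendLayers X 0) *
          (chi x y * chi y (extendLayers X 0)))) * pathPhase z 0 gs (extendLayers X) =
        ∑ X : Fin (2 * gs.length + 2) → Fin n → Bool, (gateConst g * g.apply ψ (extendLayers X 0)) *
          pathPhase z 0 gs (extendLayers X) := by
      simp only [← sum_gatePhase, Finset.sum_mul]
      rw [Finset.sum_comm]
      refine (Finset.sum_congr rfl fun y _ => Finset.sum_comm).trans ?_
      rw [Finset.sum_comm]
      refine Finset.sum_congr rfl fun X _ => Finset.sum_comm
    rw [h2]
    simp only [mul_assoc, ← Finset.mul_sum]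
    rw [ih, gatesConst, List.foldl_cons, mul_assoc]

theorem sum_chi_left (y : Fin n → Bool) :
    ∑ x, chi x y = 2 ^ n * if y = fun _ => false then 1 else 0 := by
  have h := sum_chi_mul_chi (fun _ : Fin n => false) y
  have h1 : ∀ x : Fin n → Bool, chi (fun _ => false) x = 1 := fun x => by simp [chi]
  simp only [h1, one_mul] at h
  rw [h]
  simp [eq_comm]

/-- Layer 0 appears only in its link to layer 1. Summing it out leaves 2^n times the indicator of
0⋯0, which is the initial state of the circuit. -/
theorem sum_layers (C : Circuit) (z : Fin C.n → Bool) :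
    ∑ X : Fin (C.lastLayer + 1) → Fin C.n → Bool, chi (extendLayers X 0) (extendLayers X 1) *
      pathPhase z 1 C.gates (extendLayers X) = 2 ^ C.n * gatesConst C.gates * C.state z := by
  rw [Circuit.lastLayer, sum_fin_cons, Finset.sum_comm]
  simp only [pathPhase_succ z 0]
  simp only [extendLayers_cons_succ, extendLayers_cons_zero, ← Finset.sum_mul, sum_chi_left]
  simp only [mul_assoc, ← Finset.mul_sum]
  rw [sum_pathPhase z C.gates fun y => if y = fun _ => false then 1 else 0]
  rfl

end PostSel

/-! ### Matching the cost function and the mixer phases with the path sum. -/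

namespace PostSel

variable {n : ℕ}

/-! ## The cost function of the simulating QAOA circuit -/

/-- The value of a sum of terms. -/
def rawSum (ts : List RawTerm) (zz : ℕ → Bool) : ℤ := (ts.map fun t => t.eval zz).sum

theorem rawSum_append (ts ts' : List RawTerm) (zz : ℕ → Bool) :
    rawSum (ts ++ ts') zz = rawSum ts zz + rawSum ts' zz := by simp [rawSum]

/-- The variables of layer `l`. -/
def layer (n : ℕ) (zz : ℕ → Bool) (l : ℕ) (i : Fin n) : Bool := zz (l * n + i)

theorem list_sum_map_range (f : ℕ → ℤ) (n : ℕ) :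
    ((List.range n).map f).sum = ∑ i : Fin n, f i := by
  rw [← Finset.sum_range]; rfl

theorem omega_zpow_sum {ι : Type*} (s : Finset ι) (f : ι → ℤ) :
    omega ^ (∑ i ∈ s, f i) = ∏ i ∈ s, omega ^ f i := by
  classical
  induction s using Finset.induction_on with
  | empty => simp
  | insert a s ha ih => rw [Finset.sum_insert ha, Finset.prod_insert ha, zpow_add₀ omega_ne_zero, ih]

/-- Since ω⁴ = -1 and ω^{-2} = i, the term 4xy - 2x yields the character and removes the mixer phase
(-i)^x. -/
theorem phase_mul_linkTerms (zz : ℕ → Bool) (l : ℕ) :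
    phase (layer n zz l) * omega ^ rawSum (linkTerms n l) zz =
      chi (layer n zz l) (layer n zz (l + 1)) := by
  have h : rawSum (linkTerms n l) zz =
      ∑ i : Fin n, linkTable (layer n zz l i) (layer n zz (l + 1) i) := by
    rw [rawSum, linkTerms, List.map_map, list_sum_map_range]
    simp [RawTerm.eval, layer, Nat.succ_mul]
  rw [h, omega_zpow_sum, phase, chi, ← Finset.prod_mul_distrib]
  refine Finset.prod_congr rfl fun i _ => ?_
  cases layer n zz l i <;> cases layer n zz (l + 1) i <;>
    simp [linkTable, omega_pow_two]

theorem phase_mul_lastTerms (zz : ℕ → Bool) (l : ℕ) :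
    phase (layer n zz l) * omega ^ rawSum (lastTerms n l) zz = 1 := by
  have h : rawSum (lastTerms n l) zz = ∑ i : Fin n, linTable (-2) (layer n zz l i) := by
    rw [rawSum, lastTerms, List.map_map, list_sum_map_range]
    simp [RawTerm.eval, layer]
  rw [h, omega_zpow_sum, phase, ← Finset.prod_mul_distrib]
  refine Finset.prod_eq_one fun i _ => ?_
  cases layer n zz l i <;> simp [linTable, omega_pow_two]

theorem omega_zpow_gateTerms (zz : ℕ → Bool) (l : ℕ) (g : Gate n) :
    omega ^ rawSum (gateTerms l g) zz =
      gatePhase g (layer n zz l) (layer n zz (l + 1)) (layer n zz (l + 2)) := by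
  have e1 : ∀ i : Fin n, zz (l * n + n + i) = layer n zz (l + 1) i := fun i => by
    simp [layer, Nat.succ_mul]
  have e2 : ∀ i : Fin n, zz (l * n + n + n + i) = layer n zz (l + 2) i := fun i => by
    rw [layer, show (l + 2) * n = l * n + n + n by ring]
  have e0 : ∀ i : Fin n, zz (l * n + i) = layer n zz l i := fun _ => rfl
  cases g with
  | H i =>
    simp only [rawSum, gateTerms, List.map_cons, List.map_nil, List.sum_cons, List.sum_nil,
      RawTerm.eval, e0, e1, e2, gatePhase, add_zero, zpow_add₀ omega_ne_zero, ← mul_assoc]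
    congr 1
    · congr 1
      · cases layer n zz l i <;> simp [linTable, omega_pow_two]
      · cases layer n zz (l + 1) i <;> simp [linTable, omega_pow_two]
    · cases layer n zz (l + 2) i <;> simp [linTable, omega_pow_two]
  | Tdg i =>
    simp only [rawSum, gateTerms, List.map_cons, List.map_nil, List.sum_cons, List.sum_nil,
      RawTerm.eval, e0, gatePhase, add_zero]
    cases layer n zz l i <;> simp [linTable]
  | CZ i j h =>
    simp only [rawSum, gateTerms, List.map_cons, List.map_nil, List.sum_cons, List.sum_nil,
      RawTerm.eval, e0, gatePhase, add_zero]
    cases layer n zz l i <;> cases layer n zz l j <;> simp [czTable, omega_pow_four]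

/-- Each layer from `l` on has exactly one set of terms that absorbs its mixer phase: its links to
the next layer or, for the last layer, the terms -2x. What remains is the gate phases and characters
of `pathPhase`. -/
theorem prod_phase_mul_gatesTerms (zz : ℕ → Bool) (z : Fin n → Bool) (l : ℕ) (gs : List (Gate n)) :
    (∏ j ∈ Finset.range (2 * gs.length + 2), phase (layer n zz (l + j))) *
      omega ^ rawSum (gatesTerms l gs ++ (linkTerms n (l + 2 * gs.length) ++
        lastTerms n (l + 2 * gs.length + 1))) zz * chi (layer n zz (l + 2 * gs.length + 1)) z =
      pathPhase z l gs (layer n zz) := by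
  induction gs generalizing l with
  | nil =>
    simp only [List.length_nil, mul_zero, zero_add, Finset.prod_range_succ, Finset.prod_range_zero,
      gatesTerms, List.nil_append, add_zero, rawSum_append, zpow_add₀ omega_ne_zero, pathPhase,
      one_mul]
    linear_combination (phase (layer n zz (l + 1)) * omega ^ rawSum (lastTerms n (l + 1)) zz *
      chi (layer n zz (l + 1)) z) * phase_mul_linkTerms (n := n) zz l +
      (chi (layer n zz l) (layer n zz (l + 1)) * chi (layer n zz (l + 1)) z) *
        phase_mul_lastTerms (n := n) zz (l + 1)
  | cons g gs ih =>
    have h := ih (l + 2)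
    rw [show l + 2 + 2 * gs.length = l + 2 * (gs.length + 1) by ring] at h
    simp only [List.length_cons, pathPhase, ← h, ← omega_zpow_gateTerms]
    rw [show 2 * (gs.length + 1) + 2 = 2 * gs.length + 2 + 1 + 1 by ring,
      Finset.prod_range_succ', Finset.prod_range_succ']
    simp only [gatesTerms, rawSum_append, zpow_add₀ omega_ne_zero, ← phase_mul_linkTerms,
      Nat.add_zero, add_assoc, Nat.add_comm, Nat.reduceAdd, List.append_assoc]
    ring_nf

end PostSel

namespace PostSel

variable {n : ℕ}

/-! ## The state of the simulating QAOA circuit -/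

/-- Summing over the Fourier variable `s` first turns the mixer into its closed kernel. -/
theorem qaoaState_pi_div_four (cost : (Fin n → Bool) → ℤ) (z : Fin n → Bool) :
    qaoaState (fun x => (cost x : ℝ)) [(Real.pi / 4, Real.pi / 4)] z =
      (1 / (Real.sqrt 2 : ℂ)) ^ n * (1 / (Real.sqrt 2 : ℂ)) ^ n * phase z *
        ∑ x, phase x * omega ^ cost x * chi x z := by
  rw [qaoaState_singleton]
  have h1 : ∀ x : Fin n → Bool, Complex.exp (-(Complex.I * ((Real.pi / 4 : ℝ) : ℂ)) *
      ((cost x : ℝ) : ℂ)) = omega ^ cost x := fun x => by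
    rw [omega_zpow]; push_cast; rfl
  simp only [h1]
  simp only [Finset.mul_sum]
  rw [Finset.sum_comm]
  refine Finset.sum_congr rfl fun x _ => ?_
  have h2 := mixer_kernel z x
  rw [Finset.mul_sum] at h2
  have h3 : ∀ s : Fin n → Bool, (2 ^ n : ℂ)⁻¹ * (chi z s *
      Complex.exp (-(Complex.I * ((Real.pi / 4 : ℝ) : ℂ)) * mixerEigenvalue s) *
      (chi s x * (omega ^ cost x * (1 / (Real.sqrt 2 : ℂ)) ^ n))) =
      ((2 ^ n : ℂ)⁻¹ * (chi z s * Complex.exp (-(Complex.I * ((Real.pi / 4 : ℝ) : ℂ)) *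
        mixerEigenvalue s) * chi s x)) * (omega ^ cost x * (1 / (Real.sqrt 2 : ℂ)) ^ n) :=
    fun s => by ring
  rw [Finset.sum_congr rfl fun s _ => h3 s, ← Finset.sum_mul, h2, chi_comm x z]
  ring

/-- All the variables, given by layers. -/
def flatten {k : ℕ} : (Fin k → Fin n → Bool) ≃ (Fin (k * n) → Bool) :=
  (Equiv.curry _ _ _).symm.trans (finProdFinEquiv.arrowCongr (Equiv.refl Bool))

theorem flatten_apply {k : ℕ} (X : Fin k → Fin n → Bool) (l : Fin k) (i : Fin n) :
    flatten X (finProdFinEquiv (l, i)) = X l i := by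
  simp [flatten]

/-- Holds for every index: past the last layer both extensions are `false`. -/
theorem layer_flatten {k : ℕ} (X : Fin k → Fin n → Bool) :
    layer n (RawTerm.extend (flatten X)) = extendLayers X := by
  funext l i
  by_cases h : l < k
  · have hlt : l * n + i < k * n :=
      calc l * n + i < l * n + n := by omega
        _ = (l + 1) * n := (Nat.succ_mul _ _).symm
        _ ≤ k * n := Nat.mul_le_mul_right _ h
    rw [layer, RawTerm.extend_of_lt _ hlt, extendLayers, dif_pos h, ← flatten_apply X]
    exact congrArg (flatten X) (Fin.ext (by simp [mul_comm, add_comm]))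
  · have hlt : ¬ l * n + i < k * n := by
      have : k * n ≤ l * n := Nat.mul_le_mul_right _ (by omega)
      omega
    rw [layer, RawTerm.extend, dif_neg hlt, extendLayers, dif_neg h]

theorem prod_flatten {k : ℕ} (f : Fin (k * n) → ℂ) :
    ∏ j, f j = ∏ l : Fin k, ∏ i : Fin n, f (finProdFinEquiv (l, i)) := by
  rw [← Equiv.prod_comp finProdFinEquiv, Fintype.prod_prod_type]

theorem extendLayers_val {k : ℕ} (X : Fin k → Fin n → Bool) (l : Fin k) :
    extendLayers X l = X l := by
  simp [extendLayers]

theorem phase_flatten {k : ℕ} (X : Fin k → Fin n → Bool) :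
    phase (flatten X) = ∏ l ∈ Finset.range k, phase (extendLayers X l) := by
  rw [phase, prod_flatten, Finset.prod_range]
  simp only [flatten_apply, extendLayers_val, phase]

theorem chi_flatten {k : ℕ} (X Y : Fin k → Fin n → Bool) :
    chi (flatten X) (flatten Y) = ∏ l : Fin k, chi (X l) (Y l) := by
  rw [chi, prod_flatten]
  simp only [flatten_apply, chi]

/-- Comparison of the probabilities of two measurements whose outcomes, restricted to two given
events, correspond to each other. -/
theorem prob_preimage {N : ℕ} {ψ' : State N} {ψ : State n} {P' : Set (Fin N → Bool)}
    {P : Set (Fin n → Bool)} {κ : ℝ} (res : (Fin N → Bool) → Fin n → Bool)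
    (emb : (Fin n → Bool) → Fin N → Bool) (h₁ : ∀ z ∈ P', res z ∈ P ∧ emb (res z) = z)
    (h₂ : ∀ z ∈ P, emb z ∈ P' ∧ res (emb z) = z)
    (h₃ : ∀ z ∈ P', ‖ψ' z‖ ^ 2 = κ * ‖ψ (res z)‖ ^ 2) (E : Set (Fin n → Bool)) :
    prob ψ' ({z | res z ∈ E} ∩ P') = κ * prob ψ (E ∩ P) := by
  classical
  rw [prob, prob, Finset.mul_sum]
  simp only [mul_ite, mul_zero]
  refine (@Finset.sum_filter _ _ _ _ _ (_) _).symm.trans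
    (Eq.trans ?_ (@Finset.sum_filter _ _ _ _ _ (_) _))
  refine Finset.sum_bij' (fun z _ => res z) (fun z _ => emb z) ?_ ?_ ?_ ?_ ?_
  · intro z hz
    simp only [Finset.mem_filter, Finset.mem_univ, true_and] at hz ⊢
    exact ⟨hz.1, (h₁ z hz.2).1⟩
  · intro z hz
    simp only [Finset.mem_filter, Finset.mem_univ, true_and] at hz ⊢
    refine ⟨?_, (h₂ z hz.2).1⟩
    change res (emb z) ∈ E
    rw [(h₂ z hz.2).2]
    exact hz.1
  · intro z hz
    simp only [Finset.mem_filter, Finset.mem_univ, true_and] at hz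
    exact (h₁ z hz.2).2
  · intro z hz
    simp only [Finset.mem_filter, Finset.mem_univ, true_and] at hz
    exact (h₂ z hz.2).2
  · intro z hz
    simp only [Finset.mem_filter, Finset.mem_univ, true_and] at hz
    exact h₃ z hz.2

namespace Circuit

variable (C : Circuit)

theorem cost_toQAOA (x : Fin ((C.lastLayer + 1) * C.n) → Bool) :
    C.toQAOA.cost x = rawSum C.rawTerms (RawTerm.extend x) :=
  RawTerm.sum_eval_filterMap _ C.rawTerms_valid x

theorem angles_toQAOA : C.toQAOA.angles = [(Real.pi / 4, Real.pi / 4)] := by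
  simp [QAOA.angles, toQAOA]

theorem lastVar_eq (i : Fin C.n) : C.lastVar i = finProdFinEquiv (Fin.last C.lastLayer, i) :=
  Fin.ext (by simp [lastVar_val, mul_comm, add_comm])

/-- Post-selection makes the characters of all layers but the last trivial, so only the last layer
sees the measured value. The phase of layer 0 is split off and cancelled by its own links; the
layers from 1 on are handled by `prod_phase_mul_gatesTerms`. -/
theorem phase_mul_cost (X : Fin (C.lastLayer + 1) → Fin C.n → Bool)
    (z : Fin ((C.lastLayer + 1) * C.n) → Bool)
    (hz : ∀ k : Fin ((C.lastLayer + 1) * C.n), k.1 < C.lastLayer * C.n → z k = false) :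
    phase (flatten X) * omega ^ C.toQAOA.cost (flatten X) * chi (flatten X) z =
      chi (extendLayers X 0) (extendLayers X 1) *
        pathPhase (fun i => z (C.lastVar i)) 1 C.gates (extendLayers X) := by
  have hchi : chi (flatten X) z =
      chi (extendLayers X C.lastLayer) (fun i => z (C.lastVar i)) := by
    obtain ⟨Y, rfl⟩ := flatten.surjective z
    rw [chi_flatten, Fin.prod_univ_castSucc, Finset.prod_eq_one, one_mul]
    · have := extendLayers_val X (Fin.last C.lastLayer)
      rw [Fin.val_last] at this
      simp only [lastVar_eq, flatten_apply, this]
    · intro l _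
      have : Y l.castSucc = fun _ => false := by
        funext i
        rw [← flatten_apply Y]
        refine hz _ ?_
        have hl : (l.1 + 1) * C.n ≤ C.lastLayer * C.n := Nat.mul_le_mul_right _ l.2
        rw [Nat.succ_mul] at hl
        simp only [finProdFinEquiv_apply_val, Fin.val_castSucc, mul_comm C.n]
        omega
      simp [this, chi]
  rw [hchi, cost_toQAOA, phase_flatten, ← layer_flatten]
  have h := prod_phase_mul_gatesTerms (RawTerm.extend (flatten X)) (fun i => z (C.lastVar i)) 1
    C.gates
  rw [← h, ← phase_mul_linkTerms, rawTerms, rawSum_append, zpow_add₀ omega_ne_zero,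
    Finset.prod_range_succ']
  simp only [lastLayer]
  simp only [add_comm 1, show 2 * C.gates.length + 1 + 1 = 2 * C.gates.length + 2 by rfl]
  ring

/-- The amplitudes of the simulating QAOA circuit after successful post-selection. -/
theorem state_toQAOA : ∃ κ : ℂ, κ ≠ 0 ∧ ∀ z : Fin ((C.lastLayer + 1) * C.n) → Bool,
    (∀ k : Fin ((C.lastLayer + 1) * C.n), k.1 < C.lastLayer * C.n → z k = false) →
      C.toQAOA.state z = κ * phase z * C.state fun i => z (C.lastVar i) := by
  have hs : (1 / (Real.sqrt 2 : ℂ)) ^ ((C.lastLayer + 1) * C.n) ≠ 0 :=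
    pow_ne_zero _ (one_div_ne_zero sqrt_two_ne_zero)
  refine ⟨(1 / (Real.sqrt 2 : ℂ)) ^ ((C.lastLayer + 1) * C.n) *
    (1 / (Real.sqrt 2 : ℂ)) ^ ((C.lastLayer + 1) * C.n) * (2 ^ C.n * gatesConst C.gates),
    mul_ne_zero (mul_ne_zero hs hs) (mul_ne_zero (pow_ne_zero _ two_ne_zero)
      (gatesConst_ne_zero _)), fun z hz => ?_⟩
  have h := qaoaState_pi_div_four C.toQAOA.cost z
  rw [QAOA.state, angles_toQAOA]
  refine h.trans ?_
  have e : ∑ x, phase x * omega ^ C.toQAOA.cost x * chi x z =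
      2 ^ C.n * gatesConst C.gates * C.state fun i => z (C.lastVar i) := by
    rw [← sum_layers]
    exact (Fintype.sum_equiv flatten _ _ fun X => (C.phase_mul_cost X z hz).symm).symm
  rw [e]
  change (1 / (Real.sqrt 2 : ℂ)) ^ ((C.lastLayer + 1) * C.n) *
    (1 / (Real.sqrt 2 : ℂ)) ^ ((C.lastLayer + 1) * C.n) *
    phase (n := (C.lastLayer + 1) * C.n) z * _ = _
  ring

/-- The assignment that vanishes outside the last layer. -/
def embed (z : Fin C.n → Bool) (k : Fin ((C.lastLayer + 1) * C.n)) : Bool :=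
  if h : C.lastLayer * C.n ≤ k.1 then z ⟨k.1 - C.lastLayer * C.n, by
    have h1 := k.2
    have h2 : (C.lastLayer + 1) * C.n = C.lastLayer * C.n + C.n := Nat.succ_mul _ _
    omega⟩ else false

theorem embed_lastVar (z : Fin C.n → Bool) (i : Fin C.n) : C.embed z (C.lastVar i) = z i := by
  simp [embed, lastVar_val]

theorem embed_restrict (z : Fin ((C.lastLayer + 1) * C.n) → Bool)
    (hz : ∀ k : Fin ((C.lastLayer + 1) * C.n), k.1 < C.lastLayer * C.n → z k = false) :
    C.embed (fun i => z (C.lastVar i)) = z := by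
  funext k
  by_cases h : C.lastLayer * C.n ≤ k.1
  · rw [embed, dif_pos h]
    congr 1
    apply Fin.ext
    rw [lastVar_val]
    simp only
    omega
  · rw [embed, dif_neg h, hz k (by omega)]

theorem mem_postEvent_toQAOA (z : Fin ((C.lastLayer + 1) * C.n) → Bool) :
    z ∈ C.toQAOA.readout.postEvent ↔
      (∀ k : Fin ((C.lastLayer + 1) * C.n), k.1 < C.lastLayer * C.n → z k = false) ∧
        (fun i => z (C.lastVar i)) ∈ C.readout.postEvent := by
  constructor
  · intro h
    refine ⟨fun k hk => h k ((C.mem_lastPost k).2 (Or.inl hk)), fun i hi => ?_⟩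
    exact h _ ((C.lastVar_mem_lastPost i).2 hi)
  · rintro ⟨h1, h2⟩ k hk
    rcases (C.mem_lastPost k).1 hk with h | ⟨i, hi, rfl⟩
    · exact h1 k h
    · exact h2 i hi

/-- The probabilities of all events agree up to a constant factor. -/
theorem prob_toQAOA : ∃ κ : ℝ, κ ≠ 0 ∧ ∀ E : Set (Fin C.n → Bool),
    prob C.toQAOA.state ({z | (fun i => z (C.lastVar i)) ∈ E} ∩ C.toQAOA.readout.postEvent) =
      κ * prob C.state (E ∩ C.readout.postEvent) := by
  obtain ⟨κ, hκ, h⟩ := C.state_toQAOA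
  refine ⟨‖κ‖ ^ 2, pow_ne_zero _ (norm_ne_zero_iff.2 hκ), ?_⟩
  refine prob_preimage (N := (C.lastLayer + 1) * C.n) (fun z i => z (C.lastVar i)) C.embed ?_ ?_ ?_
  · intro z hz
    obtain ⟨h1, h2⟩ := (C.mem_postEvent_toQAOA z).1 hz
    exact ⟨h2, C.embed_restrict z h1⟩
  · intro z hz
    have e : (fun i => C.embed z (C.lastVar i)) = z := funext fun i => C.embed_lastVar z i
    refine ⟨(C.mem_postEvent_toQAOA _).2 ⟨fun k hk => ?_, ?_⟩, e⟩
    · rw [embed, dif_neg (by omega)]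
    · rw [e]; exact hz
  · intro z hz
    rw [h z ((C.mem_postEvent_toQAOA z).1 hz).1, norm_mul, norm_mul, norm_phase, mul_one, mul_pow]

theorem prob_postEvent_toQAOA_ne_zero :
    prob C.toQAOA.state C.toQAOA.readout.postEvent ≠ 0 ↔
      prob C.state C.readout.postEvent ≠ 0 := by
  obtain ⟨κ, hκ, h⟩ := C.prob_toQAOA
  have := h Set.univ
  simp only [Set.mem_univ, Set.ofPred_true, Set.univ_inter] at this
  rw [this]
  simp [hκ]

/-- The post-selected distribution of the original qubits is preserved. -/
theorem condProb_toQAOA (E : Set (Fin C.n → Bool)) :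
    condProb C.toQAOA.state C.toQAOA.readout {z | (fun i => z (C.lastVar i)) ∈ E} =
      condProb C.state C.readout E := by
  obtain ⟨κ, hκ, h⟩ := C.prob_toQAOA
  have := h Set.univ
  simp only [Set.mem_univ, Set.ofPred_true, Set.univ_inter] at this
  rw [condProb, condProb, this, h E, mul_div_mul_left _ _ hκ]

end Circuit

end PostSel

/-! ### Degree bound. -/

namespace PostSel

/-! ## The interaction degree of the simulating QAOA circuit -/

theorem mem_linkTerms_two {n l a b : ℕ} {v : Bool → Bool → ℤ}
    (h : .two a b v ∈ linkTerms n l) : b = a + n := by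
  simp only [linkTerms, List.mem_map, RawTerm.two.injEq] at h
  obtain ⟨i, -, rfl, rfl, -⟩ := h
  omega

/-- Apart from the terms that connect a layer to the next one, every variable occurs in at most one
term that depends on two variables. -/
theorem mem_gatesTerms_two {n : ℕ} (l : ℕ) (gs : List (Gate n)) : ∃ f : ℕ → ℕ,
    ∀ a b v, .two a b v ∈ gatesTerms l gs →
      b = a + n ∨ (l * n ≤ a ∧ l * n ≤ b ∧ f a = b ∧ f b = a) := by
  induction gs generalizing l with
  | nil => exact ⟨id, by simp [gatesTerms]⟩
  | cons g gs ih =>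
    obtain ⟨f, hf⟩ := ih (l + 2)
    have e : (l + 2) * n = l * n + 2 * n := Nat.add_mul _ _ _
    rw [e] at hf
    have key : ∃ f' : ℕ → ℕ, (∀ a, l * n + 2 * n ≤ a → f' a = f a) ∧
        ∀ a b v, .two a b v ∈ gateTerms l g → l * n ≤ a ∧ l * n ≤ b ∧ f' a = b ∧ f' b = a := by
      cases g with
      | H i => exact ⟨f, fun _ _ => rfl, by simp [gateTerms]⟩
      | Tdg i => exact ⟨f, fun _ _ => rfl, by simp [gateTerms]⟩
      | CZ i j hij =>
        have hi := i.2
        have hj := j.2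
        have hij' : i.1 ≠ j.1 := fun e => hij (Fin.ext e)
        -- The two ends of the CZ are swapped. Both lie in layer `l`, below the variables of later
        -- gates, so the partner function for those gates is not disturbed.
        refine ⟨fun a => if a = l * n + i then l * n + j else if a = l * n + j then l * n + i
          else f a, fun a ha => ?_, fun a b v h => ?_⟩
        · beta_reduce
          rw [if_neg (by omega), if_neg (by omega)]
        · simp only [gateTerms, List.mem_singleton, RawTerm.two.injEq] at h
          obtain ⟨rfl, rfl, -⟩ := h
          refine ⟨by omega, by omega, by simp, ?_⟩
          beta_reduce
          rw [if_neg (by omega), if_pos rfl]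
    obtain ⟨f', h1, h2⟩ := key
    refine ⟨f', fun a b v h => ?_⟩
    simp only [gatesTerms, List.mem_append] at h
    rcases h with h | h | h | h
    · exact Or.inr (h2 a b v h)
    · exact Or.inl (mem_linkTerms_two h)
    · exact Or.inl (mem_linkTerms_two h)
    · refine (hf a b v h).imp id fun ⟨ha, hb, hab, hba⟩ => ⟨by omega, by omega, ?_, ?_⟩
      · rw [h1 a ha, hab]
      · rw [h1 b hb, hba]

theorem mem_rawTerms_two (C : Circuit) : ∃ f : ℕ → ℕ,
    ∀ a b v, .two a b v ∈ C.rawTerms → b = a + C.n ∨ (f a = b ∧ f b = a) := by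
  obtain ⟨f, hf⟩ := mem_gatesTerms_two 1 C.gates
  refine ⟨f, fun a b v h => ?_⟩
  simp only [Circuit.rawTerms, List.mem_append] at h
  rcases h with h | h | h | h
  · exact Or.inl (mem_linkTerms_two h)
  · exact (hf a b v h).imp id fun h => h.2.2
  · exact Or.inl (mem_linkTerms_two h)
  · simp [lastTerms] at h

theorem Term.eq_of_dependsOn_one {n : ℕ} {i j : Fin n} {v : Bool → ℤ}
    (h : (Term.one i v).DependsOn j) : j = i := by
  obtain ⟨z, hz⟩ := h
  by_contra hne
  exact hz (by simp [Term.eval, Function.update_of_ne (Ne.symm hne)])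

theorem Term.eq_of_dependsOn_two {n : ℕ} {i k j : Fin n} {hik : i ≠ k} {v : Bool → Bool → ℤ}
    (h : (Term.two i k hik v).DependsOn j) : j = i ∨ j = k := by
  obtain ⟨z, hz⟩ := h
  by_contra! hne
  exact hz (by simp [Term.eval, Function.update_of_ne hne.1.symm, Function.update_of_ne hne.2.symm])

theorem Circuit.interactionDegree_toQAOA (C : Circuit) : C.toQAOA.interactionDegree ≤ 3 := by
  obtain ⟨f, hf⟩ := mem_rawTerms_two C
  refine Finset.sup_le fun v _ => ?_
  rw [← Set.ncard_image_of_injective _ Fin.val_injective]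
  -- In the first layer the truncated `v.1 - C.n` need not be a neighbour; it only enlarges the set,
  -- which still has at most three elements.
  have hsub : Fin.val '' C.toQAOA.interactionGraph.neighborSet v ⊆
      (({v.1 + C.n, v.1 - C.n, f v.1} : Finset ℕ) : Set ℕ) := by
    rintro _ ⟨w, ⟨hne, t, ht, h1, h2⟩, rfl⟩
    obtain ⟨r, hr, hrt⟩ := List.mem_filterMap.1 ht
    simp only [Finset.coe_insert, Finset.coe_singleton, Set.mem_insert_iff,
      Set.mem_singleton_iff]
    cases r with
    | one i u =>
      simp only [RawTerm.toTerm] at hrt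
      split at hrt
      · cases hrt
        exact absurd ((Term.eq_of_dependsOn_one h1).trans (Term.eq_of_dependsOn_one h2).symm) hne
      · cases hrt
    | two i j u =>
      have hij := hf i j u hr
      simp only [RawTerm.toTerm] at hrt
      split at hrt
      · cases hrt
        rcases Term.eq_of_dependsOn_two h1 with e1 | e1 <;>
          rcases Term.eq_of_dependsOn_two h2 with e2 | e2
        · exact absurd (e1.trans e2.symm) hne
        · have e1 := congrArg Fin.val e1
          have e2 := congrArg Fin.val e2
          simp only at e1 e2
          rw [e1, e2]
          omega
        · have e1 := congrArg Fin.val e1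
          have e2 := congrArg Fin.val e2
          simp only at e1 e2
          rw [e1, e2]
          omega
        · exact absurd (e1.trans e2.symm) hne
      · cases hrt
  calc _ ≤ Set.ncard (({v.1 + C.n, v.1 - C.n, f v.1} : Finset ℕ) : Set ℕ) :=
        Set.ncard_le_ncard hsub (Finset.finite_toSet _)
    _ ≤ 3 := by rw [Set.ncard_coe_finset]; exact Finset.card_le_three

end PostSel

/-! ### The converse simulation: gates, state and translator. -/

namespace PostSel

open Prog

/-! ## From QAOA circuits of depth one to circuits -/

/-- A sequence of gates whose qubits are given by stacks: a single gate, or a power of `T†` whose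
exponent depends on the registers. -/
inductive Op : Type
  | H (k : Stack)
  | P (k : Stack) (e : (Fin 8 → ZMod 8) → ZMod 8)
  | CZ (k k' : Stack)

namespace Op

/-- The empty list for `CZ` only makes the definition total; `Valid` rules it out wherever it is
used. -/
def gates {N : ℕ} (σ : Stack → Fin N) (r : Fin 8 → ZMod 8) : Op → List (Gate N)
  | .H k => [.H (σ k)]
  | .P k e => List.replicate (e r).val (.Tdg (σ k))
  | .CZ k k' => if h : σ k ≠ σ k' then [.CZ (σ k) (σ k') h] else []

def encode (σ : Stack → ℕ) (r : Fin 8 → ZMod 8) : Op → List Tok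
  | .H k => .gateH :: encodeNat (σ k)
  | .P k e => (List.replicate (e r).val (.gateT :: encodeNat (σ k))).flatten
  | .CZ k k' => .gateCZ :: encodeNat (σ k) ++ encodeNat (σ k')

/-- The stacks that give the qubits. -/
def wires : Op → List Stack
  | .H k => [k]
  | .P k _ => [k]
  | .CZ k k' => [k, k']

/-- The two qubits of a gate are different. -/
def Valid {N : ℕ} (σ : Stack → Fin N) : Op → Prop
  | .CZ k k' => σ k ≠ σ k'
  | _ => True

theorem flatMap_encode_gates {N : ℕ} (σ : Stack → Fin N) (r) (op : Op) (h : op.Valid σ)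
    (σ' : Stack → ℕ) (hσ : ∀ k ∈ op.wires, σ' k = σ k) :
    (op.gates σ r).flatMap Gate.encode = op.encode σ' r := by
  cases op with
  | H k => simp [gates, encode, Gate.encode, hσ k (by simp [wires])]
  | P k e => simp [gates, encode, Gate.encode, hσ k (by simp [wires]), List.flatMap]
  | CZ k k' =>
    have h' : σ k ≠ σ k' := h
    rw [gates, dif_pos h']
    simp [encode, Gate.encode, hσ k (by simp [wires]), hσ k' (by simp [wires])]

theorem flatMap_encode_flatMap_gates {N : ℕ} (σ : Stack → Fin N) (r) (ops : List Op)
    (h : ∀ op ∈ ops, op.Valid σ) (σ' : Stack → ℕ)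
    (hσ : ∀ op ∈ ops, ∀ k ∈ op.wires, σ' k = σ k) :
    (ops.flatMap (Op.gates σ r)).flatMap Gate.encode = ops.flatMap (Op.encode σ' r) := by
  rw [List.flatMap_assoc]
  exact List.flatMap_congr fun op hop =>
    flatMap_encode_gates σ r op (h op hop) σ' (hσ op hop)

end Op

/-- Compute the conjunction of `fst` and `snd` on the qubit `num`, up to a phase. -/
def andOps : List Op :=
  [.H .num, .P .num fun _ => 7, .H .num, .CZ .snd .num, .H .num, .P .num fun _ => 1,
    .H .num, .CZ .fst .num, .H .num, .P .num fun _ => 7, .H .num, .CZ .snd .num, .H .num,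
    .P .num fun _ => 1, .H .num]

/-- The phase of a term in one variable; the registers contain both angles and the values. -/
def oneOps : List Op := [.P .fst fun r => r 1 * (r 3 - r 2)]

/-- The phase of a term in two variables. -/
def twoOps : List Op :=
  [.P .fst fun r => r 1 * (r 4 - r 2), .P .snd fun r => r 1 * (r 3 - r 2)] ++ (andOps ++
    ([.P .num fun r => r 1 * (r 5 - r 4 - r 3 + r 2)] ++ andOps))

/-- One qubit of the mixing operator. -/
def mixOps : List Op := [.H .idx, .P .idx fun r => -2 * r 0, .H .idx]

/-- Slots 0 and 1 hold the two angles in units of π/4, slots 2 to 5 the value table of a term. Slot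
6 is working space for the weight of a binary digit while an integer is read. -/
def regs (b c v₀ v₁ v₂ v₃ : ZMod 8) : Fin 8 → ZMod 8 := ![b, c, v₀, v₁, v₂, v₃, 0, 0]

def termRegs {n : ℕ} (b c : ZMod 8) : Term n → Fin 8 → ZMod 8
  | .one _ v => regs b c (v false) (v true) 0 0
  | .two _ _ _ v => regs b c (v false false) (v false true) (v true false) (v true true)

/-- The qubits of a term, and an additional qubit. -/
def place {n : ℕ} (i j : Fin n) : Stack → Fin (n + 1)
  | .fst => i.castSucc
  | .snd => j.castSucc
  | .idx => i.castSucc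
  -- In particular `num`: that counter holds `n`, which is the index of the ancilla.
  | _ => Fin.last n

def termGates {n : ℕ} (b c : ZMod 8) : Term n → List (Gate (n + 1))
  | .one i v => oneOps.flatMap (Op.gates (place i i) (termRegs b c (.one i v)))
  | .two i j h v => twoOps.flatMap (Op.gates (place i j) (termRegs b c (.two i j h v)))

/-- Apply some operations to all the qubits but the last one. -/
def allGates (n : ℕ) (r : Fin 8 → ZMod 8) (ops : List Op) : List (Gate (n + 1)) :=
  (List.finRange n).flatMap fun i => ops.flatMap (Op.gates (place i i) r)

/-- A readout with an additional qubit in the post-selection register. -/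
def Readout.castSucc {n : ℕ} (r : Readout n) : Readout (n + 1) where
  out := r.out.castSucc
  post := insert (Fin.last n) (r.post.map Fin.castSuccEmb)
  out_notMem := by simpa [Fin.castSucc_ne_last] using r.out_notMem

/-- The circuit that simulates a QAOA circuit of depth one. -/
def QAOA.toCircuit (Q : QAOA) : Circuit where
  n := Q.n + 1
  readout := Q.readout.castSucc
  gates :=
    -- At depth one this is the only layer. In general it is the pair that remains in the registers
    -- after `readLayers`, so translator and definition agree on all inputs.
    let l := Q.layers.getLastD (0, 0)
    allGates Q.n 0 [.H .idx] ++ (Q.terms.flatMap (termGates l.1 l.2) ++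
      allGates Q.n (regs l.1 l.2 0 0 0 0) mixOps)

theorem twoOps_valid {n : ℕ} (i j : Fin n) : ∀ op ∈ twoOps, op.Valid (place i j) := by
  simp [twoOps, andOps, Op.Valid, place, Fin.castSucc_ne_last]

end PostSel

namespace PostSel

variable {n : ℕ}

/-! ## Circuits with an additional qubit -/

/-- The action of a sequence of gates. -/
noncomputable def run (gs : List (Gate n)) (ψ : State n) : State n :=
  gs.foldl (fun ψ g => g.apply ψ) ψ

@[simp] theorem run_nil (ψ : State n) : run [] ψ = ψ := rfl

@[simp] theorem run_cons (g : Gate n) (gs : List (Gate n)) (ψ : State n) :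
    run (g :: gs) ψ = run gs (g.apply ψ) := rfl

theorem run_append (gs gs' : List (Gate n)) (ψ : State n) :
    run (gs ++ gs') ψ = run gs' (run gs ψ) := List.foldl_append

theorem run_replicate_Tdg (k : ℕ) (i : Fin n) (ψ : State n) :
    run (List.replicate k (.Tdg i)) ψ = fun z => (if z i then omega ^ k else 1) * ψ z := by
  induction k generalizing ψ with
  | zero => simp
  | succ k ih =>
    rw [List.replicate_succ, run_cons, ih]
    funext z
    simp only [Gate.apply, ← omega.eq_def]
    split_ifs <;> ring

/-- The state of `n + 1` qubits that is `ψ₀` or `ψ₁`, depending on the last qubit. -/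
def pair (ψ₀ ψ₁ : State n) : State (n + 1) := fun z =>
  if z (Fin.last n) then ψ₁ fun i => z i.castSucc else ψ₀ fun i => z i.castSucc

theorem update_castSucc (z : Fin (n + 1) → Bool) (i : Fin n) (b : Bool) :
    (fun k : Fin n => Function.update z i.castSucc b k.castSucc) =
      Function.update (fun k : Fin n => z k.castSucc) i b := by
  funext k
  by_cases h : k = i
  · subst h; simp
  · simp [h]

theorem update_last (z : Fin (n + 1) → Bool) (b : Bool) :
    (fun k : Fin n => Function.update z (Fin.last n) b k.castSucc) = fun k => z k.castSucc := by
  funext k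
  simp [Fin.castSucc_ne_last]

theorem H_last_pair (a b : State n) : (Gate.H (Fin.last n)).apply (pair a b) =
    pair (fun z => (a z + b z) / (Real.sqrt 2 : ℂ)) (fun z => (a z - b z) / (Real.sqrt 2 : ℂ)) := by
  funext z
  simp only [Gate.apply, pair, Function.update_self, update_last]
  split_ifs <;> simp_all
  ring

theorem Tdg_last_pair (k : ℕ) (a b : State n) :
    run (List.replicate k (.Tdg (Fin.last n))) (pair a b) = pair a (fun z => omega ^ k * b z) := by
  rw [run_replicate_Tdg]
  funext z
  simp only [pair]
  split_ifs <;> simp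

theorem CZ_last_pair (i : Fin n) (h) (a b : State n) :
    (Gate.CZ i.castSucc (Fin.last n) h).apply (pair a b) =
      pair a (fun z => (if z i then -1 else 1) * b z) := by
  funext z
  simp only [Gate.apply, pair]
  cases z (Fin.last n) <;> simp

/-- A gate on the first `n` of `n + 1` qubits. -/
def Gate.castSucc : Gate n → Gate (n + 1)
  | .H i => .H i.castSucc
  | .Tdg i => .Tdg i.castSucc
  | .CZ i j h => .CZ i.castSucc j.castSucc fun e => h (Fin.castSucc_injective n e)

theorem Gate.castSucc_apply_pair (g : Gate n) (a b : State n) :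
    g.castSucc.apply (pair a b) = pair (g.apply a) (g.apply b) := by
  funext z
  cases g with
  | H i =>
    simp only [Gate.castSucc, Gate.apply, pair, update_castSucc,
      Function.update_of_ne (Fin.castSucc_ne_last i).symm]
    split_ifs <;> rfl
  | Tdg i =>
    simp only [Gate.castSucc, Gate.apply, pair]
    split_ifs <;> rfl
  | CZ i j h =>
    simp only [Gate.castSucc, Gate.apply, pair]
    split_ifs <;> rfl

theorem run_map_castSucc (gs : List (Gate n)) (a b : State n) :
    run (gs.map Gate.castSucc) (pair a b) = pair (run gs a) (run gs b) := by
  induction gs generalizing a b with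
  | nil => rfl
  | cons g gs ih => rw [List.map_cons, run_cons, Gate.castSucc_apply_pair, ih]; rfl

/-! ## Phases of the terms -/

/-- H CZ H on the target is a controlled X: it exchanges the two components where the control is
set. -/
theorem run_controlledX (i : Fin n) (h) (a b : State n) :
    (Gate.H (Fin.last n)).apply ((Gate.CZ i.castSucc (Fin.last n) h).apply
      ((Gate.H (Fin.last n)).apply (pair a b))) =
      pair (fun z => if z i then b z else a z) (fun z => if z i then a z else b z) := by
  have hs := sqrt_two_ne_zero
  have hs2 := sqrt_two_sq
  rw [H_last_pair, CZ_last_pair, H_last_pair]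
  congr 1 <;> funext z <;> cases z i <;> simp <;> field_simp <;> rw [hs2] <;> ring

theorem gates_CZ_fst (i j : Fin n) (r) : Op.gates (place i j) r (.CZ .fst .num) =
    [Gate.CZ _ _ (Fin.castSucc_ne_last i)] := dif_pos _

theorem gates_CZ_snd (i j : Fin n) (r) : Op.gates (place i j) r (.CZ .snd .num) =
    [Gate.CZ _ _ (Fin.castSucc_ne_last j)] := dif_pos _

theorem gates_H_num (i j : Fin n) (r) : Op.gates (place i j) r (.H .num) =
    [Gate.H (Fin.last n)] := rfl

theorem gates_P_num (i j : Fin n) (r) (e) : Op.gates (place i j) r (.P .num e) =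
    List.replicate (e r).val (Gate.Tdg (Fin.last n)) := rfl

/-- The uncomputing half: the ancilla, equal to the conjunction, returns to 0 with factor -i where
the conjunction holds. The exponent 7 in `andOps` is T, so the gates are T and T† interleaved with
controlled X, a Toffoli up to relative phases. -/
theorem run_andOps (i j : Fin n) (r) (a b : State n) :
    run (andOps.flatMap (Op.gates (place i j) r))
      (pair (fun z => if z i && z j then 0 else a z) (fun z => if z i && z j then b z else 0)) =
      pair (fun z => if z i && z j then -Complex.I * b z else a z) (fun _ => 0) := by
  have hs := sqrt_two_ne_zero
  have hs2 := sqrt_two_sq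
  have h7 : (7 : ZMod 8).val = 7 := rfl
  have h1 : (1 : ZMod 8).val = 1 := rfl
  have hI := omega_pow_two
  have h8 := omega_pow_eight
  have h12 : omega ^ 12 = -1 := by linear_combination omega ^ 4 * h8 + omega_pow_four
  have h16 : omega ^ 16 = 1 := by linear_combination (omega ^ 8 + 1) * h8
  simp only [andOps, List.flatMap_cons, List.flatMap_nil, gates_CZ_fst, gates_CZ_snd,
    gates_H_num, gates_P_num, run_append, run_cons, run_nil, h7, h1]
  rw [H_last_pair, Tdg_last_pair, run_controlledX, Tdg_last_pair, run_controlledX, Tdg_last_pair,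
    run_controlledX, Tdg_last_pair, H_last_pair]
  congr 1 <;> funext z <;> cases z i <;> cases z j <;> simp <;> field_simp <;> (try rw [hs2])
  all_goals simp only [h8, h12, h16, hI]
  all_goals ring

/-- The computing half: starting from ancilla 0 the conjunction is written with factor i, the
inverse of the factor picked up on the way back. -/
theorem run_andOps_zero (i j : Fin n) (r) (a : State n) :
    run (andOps.flatMap (Op.gates (place i j) r)) (pair a (fun _ => 0)) =
      pair (fun z => if z i && z j then 0 else a z)
        (fun z => if z i && z j then Complex.I * a z else 0) := by
  have hs := sqrt_two_ne_zero
  have hs2 := sqrt_two_sq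
  have h7 : (7 : ZMod 8).val = 7 := rfl
  have h1 : (1 : ZMod 8).val = 1 := rfl
  have hI := omega_pow_two
  have h8 := omega_pow_eight
  have h12 : omega ^ 12 = -1 := by linear_combination omega ^ 4 * h8 + omega_pow_four
  have h16 : omega ^ 16 = 1 := by linear_combination (omega ^ 8 + 1) * h8
  simp only [andOps, List.flatMap_cons, List.flatMap_nil, gates_CZ_fst, gates_CZ_snd,
    gates_H_num, gates_P_num, run_append, run_cons, run_nil, h7, h1]
  rw [H_last_pair, Tdg_last_pair, run_controlledX, Tdg_last_pair, run_controlledX, Tdg_last_pair,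
    run_controlledX, Tdg_last_pair, H_last_pair]
  congr 1 <;> funext z <;> cases z i <;> cases z j <;> simp <;> field_simp <;> (try rw [hs2])
  all_goals simp only [h8, h12, h16, hI]
  all_goals ring

theorem omega_pow_val (m : ℤ) : omega ^ (m : ZMod 8).val = omega ^ m := by
  have h8 : omega ^ (8 : ℤ) = 1 := by exact_mod_cast omega_pow_eight
  rw [← zpow_natCast, ZMod.val_intCast]
  conv_rhs => rw [← Int.emod_add_mul_ediv m 8]
  rw [zpow_add₀ omega_ne_zero, zpow_mul, h8]
  simp

/-- A table satisfies v(x,y) - v(0,0) = (v10 - v00)x + (v01 - v00)y + (v11 - v10 - v01 + v00)xy. The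
linear parts are powers of T† on the qubits, the last part is one on the ancilla between the two
halves of the conjunction. The constant v(0,0) is only a global phase and is dropped. -/
theorem run_termGates (b c : ℤ) (t : Term n) (ψ : State n) :
    run (termGates b c t) (pair ψ fun _ => 0) =
      pair (fun z => omega ^ (c * (t.eval z - t.eval fun _ => false)) * ψ z) fun _ => 0 := by
  have castT : ∀ (k : ℕ) (i : Fin n), List.replicate k (Gate.Tdg i.castSucc) =
      (List.replicate k (Gate.Tdg i)).map Gate.castSucc := fun k i => by simp [Gate.castSucc]
  have hzero : ∀ (k : ℕ) (i : Fin n), run (List.replicate k (Gate.Tdg i)) (fun _ => 0) =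
      fun _ => 0 := fun k i => by rw [run_replicate_Tdg]; simp
  cases t with
  | one i v =>
    have e : ((c * (v true - v false) : ℤ) : ZMod 8) = c * (v true - v false) := by push_cast; rfl
    simp only [termGates, oneOps, List.flatMap_cons, List.flatMap_nil, List.append_nil, Op.gates,
      place, termRegs]
    change run (List.replicate ((c : ZMod 8) * (v true - v false)).val _) _ = _
    rw [← e, castT, run_map_castSucc, hzero, run_replicate_Tdg, omega_pow_val]
    congr 1
    funext z
    cases h : z i <;> simp [Term.eval, h]
  | two i j hij v =>
    obtain ⟨r, hr⟩ : ∃ r, r = termRegs (n := n) b c (.two i j hij v) := ⟨_, rfl⟩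
    have e1 : r 1 * (r 4 - r 2) = ((c * (v true false - v false false) : ℤ) : ZMod 8) := by
      subst hr; push_cast; rfl
    have e2 : r 1 * (r 3 - r 2) = ((c * (v false true - v false false) : ℤ) : ZMod 8) := by
      subst hr; push_cast; rfl
    have e3 : r 1 * (r 5 - r 4 - r 3 + r 2) = ((c * (v true true - v true false - v false true +
        v false false) : ℤ) : ZMod 8) := by
      subst hr; push_cast; rfl
    rw [termGates, ← hr]
    simp only [twoOps, List.flatMap_append, run_append, List.flatMap_cons, List.flatMap_nil,
      List.append_nil, gates_P_num]
    have p1 : ∀ e, Op.gates (place i j) r (.P .fst e) =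
      (List.replicate (e r).val (Gate.Tdg i)).map Gate.castSucc := fun e => by
        rw [← castT]; rfl
    have p2 : ∀ e, Op.gates (place i j) r (.P .snd e) =
      (List.replicate (e r).val (Gate.Tdg j)).map Gate.castSucc := fun e => by
        rw [← castT]; rfl
    rw [p1, p2, e1, e2, e3, run_map_castSucc, run_map_castSucc, hzero, hzero,
      run_andOps_zero, Tdg_last_pair, run_replicate_Tdg, run_replicate_Tdg]
    simp only [omega_pow_val]
    have e4 : (fun z : Fin n → Bool => omega ^ (c * (v true true - v true false - v false true +
        v false false)) * if z i && z j then Complex.I * ((if z j then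
          omega ^ (c * (v false true - v false false)) else 1) * ((if z i then
          omega ^ (c * (v true false - v false false)) else 1) * ψ z)) else 0) =
        fun z => if z i && z j then Complex.I * omega ^ (c * (v true true - v false false)) * ψ z
          else 0 := by
      funext z
      cases z i <;> cases z j <;> simp
      rw [show c * (v true true - v false false) = c * (v true true - v true false - v false true +
        v false false) + c * (v false true - v false false) + c * (v true false - v false false) by
        ring, zpow_add₀ omega_ne_zero, zpow_add₀ omega_ne_zero]
      ring
    rw [e4, run_andOps]
    congr 1
    funext z
    cases hi : z i <;> cases hj : z j <;> simp [Term.eval, hi, hj]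
    rw [← mul_assoc, ← mul_assoc, Complex.I_mul_I]
    ring

theorem run_flatMap_termGates (b c : ℤ) (ts : List (Term n)) (ψ : State n) :
    run (ts.flatMap (termGates b c)) (pair ψ fun _ => 0) =
      pair (fun z => omega ^ (c * ((ts.map fun t => t.eval z).sum -
        (ts.map fun t => t.eval fun _ => false).sum)) * ψ z) fun _ => 0 := by
  induction ts generalizing ψ with
  | nil => simp
  | cons t ts ih =>
    rw [List.flatMap_cons, run_append, run_termGates, ih]
    congr 1
    funext z
    rw [← mul_assoc, ← zpow_add₀ omega_ne_zero]
    congr 2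
    simp only [List.map_cons, List.sum_cons]
    ring

/-! ## Products of operations on single qubits -/

/-- Operations on distinct qubits multiply to a tensor product: the matrix `m` at the listed qubits,
the identity elsewhere. -/
theorem run_flatMap_apply (G : Fin n → List (Gate n)) (m : Bool → Bool → ℂ)
    (hG : ∀ i ψ z, run (G i) ψ z = m (z i) false * ψ (Function.update z i false) +
      m (z i) true * ψ (Function.update z i true)) (l : List (Fin n)) (hl : l.Nodup) (ψ : State n)
    (z : Fin n → Bool) : run (l.flatMap G) ψ z =
      ∑ x, (∏ j, if j ∈ l then m (z j) (x j) else if z j = x j then 1 else 0) * ψ x := by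
  -- The last list entry acts last, so `hG` can be applied on the outside.
  induction l using List.reverseRecOn generalizing z with
  | nil =>
    simp only [List.not_mem_nil, if_false, List.flatMap_nil, run_nil]
    rw [Finset.sum_eq_single z]
    · simp
    · intro x _ hx
      obtain ⟨j, hj⟩ := Function.ne_iff.1 hx
      rw [Finset.prod_eq_zero (Finset.mem_univ j) (if_neg (Ne.symm hj)), zero_mul]
    · simp
  | append_singleton l i ih =>
    rw [List.nodup_append] at hl
    obtain ⟨hl, -, hd⟩ := hl
    have hi : i ∉ l := fun h => hd i h i (by simp) rfl
    rw [List.flatMap_append, run_append, List.flatMap_singleton, hG, ih hl, ih hl, Finset.mul_sum,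
      Finset.mul_sum, ← Finset.sum_add_distrib]
    refine Finset.sum_congr rfl fun x _ => ?_
    rw [← mul_assoc, ← mul_assoc, ← add_mul]
    congr 1
    simp only [← Finset.mul_prod_erase Finset.univ _ (Finset.mem_univ i)]
    have h : ∀ b, ∏ j ∈ Finset.univ.erase i, (if j ∈ l then m (Function.update z i b j) (x j)
        else if Function.update z i b j = x j then 1 else 0) =
        ∏ j ∈ Finset.univ.erase i, (if j ∈ l ++ [i] then m (z j) (x j)
        else if z j = x j then 1 else 0) := fun b => by
      refine Finset.prod_congr rfl fun j hj => ?_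
      have := Finset.ne_of_mem_erase hj
      simp [this]
    rw [h, h]
    simp only [hi, if_false, Function.update_self, List.mem_append, List.mem_singleton, or_true,
      if_true]
    cases x i <;> simp

theorem run_finRange_flatMap_apply (G : Fin n → List (Gate n)) (m : Bool → Bool → ℂ)
    (hG : ∀ i ψ z, run (G i) ψ z = m (z i) false * ψ (Function.update z i false) +
      m (z i) true * ψ (Function.update z i true)) (ψ : State n) (z : Fin n → Bool) :
    run ((List.finRange n).flatMap G) ψ z = ∑ x, (∏ j, m (z j) (x j)) * ψ x := by
  rw [run_flatMap_apply G m hG _ (List.nodup_finRange n)]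
  simp

end PostSel

namespace PostSel

variable {n : ℕ}

/-! ## The state of the circuit that simulates a QAOA circuit -/

/-- The matrix of `H diag(1, u) H`. -/
noncomputable def mixKernel (u : ℂ) (a x : Bool) : ℂ :=
  (1 + (if a then -1 else 1) * (if x then -1 else 1) * u) / 2

theorem run_H_Tdg_H (k : ℕ) (i : Fin n) (ψ : State n) (z : Fin n → Bool) :
    run (.H i :: (List.replicate k (.Tdg i) ++ [.H i])) ψ z =
      mixKernel (omega ^ k) (z i) false * ψ (Function.update z i false) +
        mixKernel (omega ^ k) (z i) true * ψ (Function.update z i true) := by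
  have hs := sqrt_two_ne_zero
  have hs2 := sqrt_two_sq
  rw [run_cons, run_append, run_replicate_Tdg]
  simp only [run_cons, run_nil, Gate.apply, Function.update_self, Function.update_idem, mixKernel]
  cases z i <;> simp <;> field_simp <;> rw [hs2] <;> ring

theorem run_H (i : Fin n) (ψ : State n) (z : Fin n → Bool) :
    run [.H i] ψ z = (if z i && false then -1 else 1) / (Real.sqrt 2 : ℂ) *
        ψ (Function.update z i false) +
      (if z i && true then -1 else 1) / (Real.sqrt 2 : ℂ) * ψ (Function.update z i true) := by
  simp only [run_cons, run_nil, Gate.apply]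
  cases z i <;> simp <;> ring

/-- Per qubit, diag(ω^b, ω^{-b}) = ω^b diag(1, ω^{-2b}), so conjugation by H gives `mixKernel` and a
global factor ω^b. -/
theorem mixer_zpow_kernel (b : ℤ) (z x : Fin n → Bool) :
    ((2 : ℂ) ^ n)⁻¹ * ∑ s, chi z s * Complex.exp (-(Complex.I * ((b * (Real.pi / 4) : ℝ) : ℂ)) *
      mixerEigenvalue s) * chi s x =
      (omega ^ b) ^ n * ∏ j, mixKernel (omega ^ (-2 * b)) (z j) (x j) := by
  have h1 : ∀ s : Fin n → Bool, Complex.exp (-(Complex.I * ((b * (Real.pi / 4) : ℝ) : ℂ)) *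
      mixerEigenvalue s) = ∏ j, if s j then omega ^ (-b) else omega ^ b := fun s => by
    rw [mixerEigenvalue, Finset.mul_sum, Complex.exp_sum]
    refine Finset.prod_congr rfl fun j _ => ?_
    rw [omega_zpow, omega_zpow]
    push_cast
    split_ifs <;> congr 1 <;> ring
  simp only [h1]
  have h2 : ∀ s : Fin n → Bool, chi z s * (∏ j, if s j then omega ^ (-b) else omega ^ b) * chi s x =
      ∏ j, ((if z j && s j then -1 else 1) * (if s j then omega ^ (-b) else omega ^ b) *
        (if s j && x j then -1 else 1)) := fun s => by
    rw [chi, chi, Finset.prod_mul_distrib, Finset.prod_mul_distrib]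
  simp only [h2]
  rw [sum_prod_bool fun j y => (if z j && y then (-1 : ℂ) else 1) *
    (if y then omega ^ (-b) else omega ^ b) * (if y && x j then -1 else 1), ← inv_pow]
  have h3 : ∀ c : ℂ, c ^ n = ∏ _j : Fin n, c := fun c => by simp
  rw [h3, h3 (omega ^ b), ← Finset.prod_mul_distrib, ← Finset.prod_mul_distrib]
  refine Finset.prod_congr rfl fun j _ => ?_
  have h4 : omega ^ (-b) = omega ^ b * omega ^ (-2 * b) := by
    rw [← zpow_add₀ omega_ne_zero]; congr 1; ring
  rw [h4, mixKernel]
  cases z j <;> cases x j <;> simp <;> ring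

theorem qaoaState_zpow (cost : (Fin n → Bool) → ℤ) (b c : ℤ) (z : Fin n → Bool) :
    qaoaState (fun x => (cost x : ℝ)) [(b * (Real.pi / 4), c * (Real.pi / 4))] z =
      (omega ^ b) ^ n * ∑ x, (∏ j, mixKernel (omega ^ (-2 * b)) (z j) (x j)) *
        (omega ^ (c * cost x) * (1 / (Real.sqrt 2 : ℂ)) ^ n) := by
  rw [qaoaState_singleton]
  have h1 : ∀ x : Fin n → Bool, Complex.exp (-(Complex.I * ((c * (Real.pi / 4) : ℝ) : ℂ)) *
      ((cost x : ℝ) : ℂ)) = omega ^ (c * cost x) := fun x => by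
    rw [omega_zpow]; push_cast; congr 1; ring
  simp only [h1]
  simp only [Finset.mul_sum]
  rw [Finset.sum_comm]
  refine Finset.sum_congr rfl fun x _ => ?_
  rw [← mul_assoc, ← mixer_zpow_kernel b z x, Finset.mul_sum, Finset.sum_mul]
  refine Finset.sum_congr rfl fun s _ => ?_
  ring

theorem allGates_H (r) : allGates n r [.H .idx] =
    ((List.finRange n).flatMap fun i => [Gate.H i]).map Gate.castSucc := by
  rw [List.map_flatMap]; rfl

theorem allGates_mixOps (r : Fin 8 → ZMod 8) : allGates n r mixOps =
    ((List.finRange n).flatMap fun i => .H i :: (List.replicate (-2 * r 0).val (.Tdg i) ++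
      [.H i])).map Gate.castSucc := by
  rw [List.map_flatMap]
  refine List.flatMap_congr fun i _ => ?_
  simp [mixOps, Op.gates, place, Gate.castSucc]

theorem run_zero (gs : List (Gate n)) : run gs (fun _ => 0) = fun _ => 0 := by
  induction gs with
  | nil => rfl
  | cons g gs ih =>
    rw [run_cons]
    convert ih using 2
    funext z
    cases g <;> simp [Gate.apply]

theorem run_all_H : run ((List.finRange n).flatMap fun i => [Gate.H i])
    (fun z => if z = fun _ => false then 1 else 0) = fun _ => (1 / (Real.sqrt 2 : ℂ)) ^ n := by
  funext z
  rw [run_finRange_flatMap_apply _ (fun a x => (if a && x then -1 else 1) / (Real.sqrt 2 : ℂ))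
    run_H]
  simp

theorem QAOA.state_toCircuit (Q : QAOA) (b c : ℤ) (h : Q.layers = [(b, c)]) :
    ∃ κ : ℂ, ‖κ‖ = 1 ∧ Q.toCircuit.state = pair (fun z => κ * Q.state z) fun _ => 0 := by
  -- The first factor collects the dropped constants of the terms, the second the scalar ω^b omitted
  -- from the mixer on each qubit.
  refine ⟨omega ^ (-(c * Q.cost fun _ => false)) * ((omega ^ b) ^ Q.n)⁻¹, ?_, ?_⟩
  · simp [norm_omega]
  have h0 : (fun z : Fin (Q.n + 1) → Bool => if z = fun _ => false then (1 : ℂ) else 0) =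
      pair (fun z => if z = fun _ => false then 1 else 0) fun _ => 0 := by
    funext z
    simp only [pair, funext_iff, Fin.forall_fin_succ']
    cases z (Fin.last Q.n) <;> simp
  have h1 : Q.toCircuit.state = run (allGates Q.n 0 [.H .idx] ++ (Q.terms.flatMap (termGates b c) ++
      allGates Q.n (regs b c 0 0 0 0) mixOps))
      (fun z : Fin (Q.n + 1) → Bool => if z = fun _ => false then (1 : ℂ) else 0) := by
    simp only [Circuit.state, QAOA.toCircuit, h, run]
    rfl
  rw [h1, run_append, run_append, h0, allGates_H, run_map_castSucc, run_zero, run_all_H,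
    run_flatMap_termGates, allGates_mixOps, run_map_castSucc, run_zero]
  congr 1
  funext z
  have e : -2 * regs (b : ZMod 8) c 0 0 0 0 0 = ((-2 * b : ℤ) : ZMod 8) := by push_cast; rfl
  rw [run_finRange_flatMap_apply _ _ (run_H_Tdg_H _), e, omega_pow_val, QAOA.state, QAOA.angles, h]
  have h2 := qaoaState_zpow Q.cost b c z
  simp only [List.map_cons, List.map_nil]
  rw [h2, mul_assoc, inv_mul_cancel_left₀ (pow_ne_zero _ (zpow_ne_zero _ omega_ne_zero)),
    Finset.mul_sum]
  refine Finset.sum_congr rfl fun x _ => ?_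
  rw [mul_sub, sub_eq_add_neg, zpow_add₀ omega_ne_zero]
  simp only [QAOA.cost]
  ring

/-- The scalar has norm one and the ancilla always returns to 0, so probabilities agree exactly and
not only up to a factor. -/
theorem QAOA.prob_toCircuit (Q : QAOA) (h : Q.depth = 1) (E : Set (Fin Q.n → Bool)) :
    prob Q.toCircuit.state ({z : Fin (Q.n + 1) → Bool | (fun i : Fin Q.n => z i.castSucc) ∈ E} ∩
      Q.toCircuit.readout.postEvent) = prob Q.state (E ∩ Q.readout.postEvent) := by
  obtain ⟨⟨b, c⟩, hl⟩ := List.length_eq_one_iff.1 h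
  obtain ⟨κ, hκ, hs⟩ := Q.state_toCircuit b c hl
  have hP : ∀ z : Fin (Q.n + 1) → Bool, z ∈ Q.toCircuit.readout.postEvent ↔
      z (Fin.last Q.n) = false ∧ (fun i : Fin Q.n => z i.castSucc) ∈ Q.readout.postEvent := by
    intro z
    change (∀ i ∈ insert (Fin.last Q.n) (Q.readout.post.map Fin.castSuccEmb), z i = false) ↔ _
    simp [Readout.postEvent]
  rw [← one_mul (prob Q.state _)]
  refine prob_preimage (N := Q.n + 1) (fun z i => z i.castSucc)
    (fun z => Fin.snoc (α := fun _ => Bool) z false) ?_ ?_ ?_ E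
  · intro z hz
    obtain ⟨h1, h2⟩ := (hP z).1 hz
    refine ⟨h2, ?_⟩
    funext i
    refine Fin.lastCases ?_ (fun i => ?_) i <;> simp [h1]
  · intro z hz
    have e : (fun i : Fin Q.n => (Fin.snoc (α := fun _ => Bool) z false : Fin (Q.n + 1) → Bool)
        i.castSucc) = z := by
      funext i; simp
    refine ⟨(hP _).2 ⟨by simp, ?_⟩, e⟩
    rw [e]; exact hz
  · intro z hz
    rw [hs]
    simp [pair, ((hP z).1 hz).1, hκ]

theorem QAOA.answers_toCircuit (Q : QAOA) (h : Q.depth = 1) {ε : ℝ} {yes : Prop}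
    (hQ : Answers Q.state Q.readout ε yes) :
    Answers Q.toCircuit.state Q.toCircuit.readout ε yes := by
  have h1 : prob Q.toCircuit.state Q.toCircuit.readout.postEvent =
      prob Q.state Q.readout.postEvent := by
    have h := Q.prob_toCircuit h Set.univ
    rw [Set.univ_inter] at h
    exact (congrArg _ (Set.univ_inter _).symm).trans h
  have h2 : ∀ b : Bool, condProb Q.toCircuit.state Q.toCircuit.readout
      {z | z Q.toCircuit.readout.out = b} = condProb Q.state Q.readout {z | z Q.readout.out = b} := by
    intro b
    rw [condProb, condProb, h1, ← Q.prob_toCircuit h]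
    rfl
  unfold Answers
  rw [h1, h2, h2]
  exact hQ

end PostSel

namespace PostSel

open Prog

/-! ## The translator from QAOA circuits to circuits -/

/-- Write the gate `T†` as often as the exponent says, trying all the numbers less than `m`. -/
def emitPow (k : Stack) (e : (Fin 8 → ZMod 8) → ZMod 8) : ℕ → Routine
  | 0 => skip
  | m + 1 => emitPow k e m ;; .ite (fun v => m < (e v.2.2).val)
      (pushAll .txt [.gateT] ;; emitNat [k]) skip

theorem Emits.emitPow {S : Contents} (y r) (hS : S .tmp = []) (k : Stack) (e) (M : ℕ)
    (hk : k ≠ .txt ∧ k ≠ .tmp ∧ (S k).length ≤ M) (m : ℕ) :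
    Emits (emitPow k e m) (none, y, r) S
      (List.replicate (min m (e r).val) (.gateT :: encodeNat (S k).length)).flatten
      (m * (7 * M + 9) + 1) := by
  induction m with
  | zero => simpa [PostSel.emitPow] using Emits.skip (none, y, r) S
  | succ m ih =>
    have h1 := (Emits.pushAll [.gateT] (none, y, r) S).seq (Emits.emitNat (y, r) hS [k] M
      (by simpa using hk))
    have h2 : Emits (.ite (fun v : Var => m < (e v.2.2).val)
        (PostSel.pushAll .txt [.gateT] ;; PostSel.emitNat [k]) Prog.skip) (none, y, r) S
        (if m < (e r).val then .gateT :: encodeNat (S k).length else []) (7 * M + 9) := by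
      refine (Emits.ite (c := 7 * M + 8) (fun h => ?_) (fun h => ?_)).mono le_rfl
      · simp only [decide_eq_true_eq] at h
        rw [if_pos h]
        exact (h1.congr (by simp)).mono (by simp; omega)
      · simp only [decide_eq_false_iff_not] at h
        rw [if_neg h]
        exact (Emits.skip _ _).mono (by omega)
    refine ((ih.seq h2).congr ?_).mono (by ring_nf; omega)
    split_ifs with h
    · rw [min_eq_left (by omega), min_eq_left (by omega), List.replicate_succ', List.flatten_append]
      simp
    · rw [min_eq_right (by omega), min_eq_right (by omega), List.append_nil]

/-- Write a sequence of gates. -/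
def emitOp : Op → Routine
  | .H k => pushAll .txt [.gateH] ;; emitNat [k]
  -- An exponent in `ZMod 8` is at most 7, so seven tests write all the copies.
  | .P k e => emitPow k e 7
  | .CZ k k' => pushAll .txt [.gateCZ] ;; emitNat [k] ;; emitNat [k']

theorem Emits.emitOp {S : Contents} (y r) (hS : S .tmp = []) (op : Op) (M : ℕ)
    (hk : ∀ k ∈ op.wires, k ≠ .txt ∧ k ≠ .tmp ∧ (S k).length ≤ M) :
    Emits (emitOp op) (none, y, r) S (op.encode (fun k => (S k).length) r) (64 * (M + 1)) := by
  cases op with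
  | H k =>
    refine (((Emits.pushAll [.gateH] _ _).seq (Emits.emitNat (y, r) hS [k] M hk)).congr ?_).mono ?_
    · simp [Op.encode]
    · simp; omega
  | P k e =>
    refine ((Emits.emitPow y r hS k e M (hk k (by simp [Op.wires])) 7).congr ?_).mono (by omega)
    have := ZMod.val_lt (e r)
    rw [min_eq_right (by omega), Op.encode]
  | CZ k k' =>
    refine (((Emits.pushAll [.gateCZ] _ _).seq ((Emits.emitNat (y, r) hS [k] M ?_).seq
      (Emits.emitNat (y, r) hS [k'] M ?_))).congr ?_).mono ?_
    · simpa using hk k (by simp [Op.wires])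
    · simpa using hk k' (by simp [Op.wires])
    · simp [Op.encode]
    · simp; omega

def emitOps : List Op → Routine
  | [] => skip
  | op :: ops => emitOp op ;; emitOps ops

theorem Emits.emitOps {S : Contents} (y r) (hS : S .tmp = []) (ops : List Op) (M : ℕ)
    (hk : ∀ op ∈ ops, ∀ k ∈ op.wires, k ≠ .txt ∧ k ≠ .tmp ∧ (S k).length ≤ M) :
    Emits (emitOps ops) (none, y, r) S (ops.flatMap (Op.encode (fun k => (S k).length) r))
      (64 * ops.length * (M + 1) + 1) := by
  induction ops with
  | nil => exact (Emits.skip _ _).mono (by simp)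
  | cons op ops ih =>
    refine (((Emits.emitOp y r hS op M (hk op (by simp))).seq
      (ih fun op' h => hk op' (by simp [h]))).congr (by simp)).mono ?_
    simp only [List.length_cons]
    ring_nf
    omega

theorem Emits.forIdx_emitOps (y r) (ops : List Op) (hops : ∀ op ∈ ops, op.wires = [.idx])
    (n M : ℕ) (hM : n ≤ M) (inp txt base outq post out fst snd) :
    Emits (PostSel.forIdx (PostSel.emitOps ops)) (none, y, r)
      (mem inp txt base (ones n) outq post out fst snd)
      ((allGates n r ops).flatMap Gate.encode) ((64 * ops.length * (M + 1) + 15) * n + 8) := by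
  have h := Emits.forIdx (S := mem inp txt base (ones n) outq post out fst snd)
    (body := PostSel.emitOps ops) (y, r) rfl rfl rfl
    (fun i => ops.flatMap (Op.encode (fun _ => i) r)) (64 * ops.length * (M + 1) + 1) ?_
  · simp only [mem_num, List.length_replicate] at h
    refine (h.congr ?_).mono (le_of_eq (by ring))
    rw [allGates, List.flatMap_assoc, ← List.map_coe_finRange_eq_range, List.flatMap_map]
    refine List.flatMap_congr fun i _ => ?_
    refine (Op.flatMap_encode_flatMap_gates _ _ _ ?_ _ ?_).symm
    · intro op hop
      have := hops op hop
      cases op <;> simp_all [Op.wires, Op.Valid]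
    · intro op hop k hk
      rw [hops op hop, List.mem_singleton] at hk
      subst hk
      rfl
  · intro i hi t
    simp only [mem_num, List.length_replicate] at hi
    refine (Emits.emitOps y r (by simp) ops M ?_).congr ?_
    · intro op hop k hk
      rw [hops op hop, List.mem_singleton] at hk
      subst hk
      simp
      omega
    · refine List.flatMap_congr fun op hop => ?_
      have := hops op hop
      cases op <;> simp_all [Op.wires, Op.encode]

/-! ### Reading integers -/

/-- Add a binary digit to a register; register 6 contains its weight. -/
def addBit (k : Fin 8) (v : Var) : Var :=
  (none, v.2.1, Function.update (Function.update v.2.2 k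
    (v.2.2 k + if v.1 = some .one then v.2.2 6 else 0)) 6 (2 * v.2.2 6))

/-- Read an integer modulo eight into a register. -/
def readInt (k : Fin 8) : Routine :=
  .pop .inp (fun v x => (none, v.2.1,
    Function.update (Function.update v.2.2 6 (if x = some .one then -1 else 1)) k 0)) ;;
  .pop .inp setCur ;;
  .loop (fun v => v.1 ≠ some .sep) (.load (addBit k) ;; .pop .inp setCur) ;;
  .load fun v => (none, v.2.1, Function.update v.2.2 6 0)

/-- The number with the given binary digits, the least significant one first. -/
def ofBits : List Bool → ℕ
  | [] => 0
  | b :: bs => b.toNat + 2 * ofBits bs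

theorem ofBits_bits (m : ℕ) : ofBits m.bits = m := by
  induction m using Nat.binaryRec' with
  | zero => rfl
  | bit b m h ih =>
    rw [Nat.bits_append_bit _ _ h, ofBits, ih, Nat.bit_val]
    omega

theorem Prog.RunsIn.congr_var {K Γ σ : Type} [DecidableEq K] {p : Prog K Γ σ} {v v' v'' : σ}
    {S S' : K → List Γ} {T : ℕ} (h : RunsIn p v S v' S' T) (hv : v' = v'') :
    RunsIn p v S v'' S' T := hv ▸ h

/-- The digits are accumulated modulo 8 with a doubling weight, so finitely many registers handle
integers of any size. The sign is the initial weight ±1; the final weight `w` is irrelevant, since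
it is reset afterwards. -/
theorem readInt_loop_runs {k : Fin 8} (hk : k ≠ 6) (y) (S : Contents) (rest : List Tok)
    (bs : List Bool) (r : Fin 8 → ZMod 8) : ∃ w : ZMod 8, RunsIn
      (.loop (fun v => v.1 ≠ some .sep) (.load (addBit k) ;; .pop .inp setCur))
      ((bs.map encodeBit ++ .sep :: rest).head?, y, r)
      (Function.update S .inp (bs.map encodeBit ++ .sep :: rest).tail)
      (some .sep, y, Function.update (Function.update r k (r k + r 6 * ofBits bs)) 6 w)
      (Function.update S .inp rest) (3 * bs.length + 1) := by
  induction bs generalizing r with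
  | nil =>
    refine ⟨r 6, ?_⟩
    have h := RunsIn.loop_false (K := Stack) (Γ := Tok) (v := (some .sep, y, r))
      (S := Function.update S .inp rest) (b := fun v : Var => v.1 ≠ some .sep)
      (p := .load (addBit k) ;; .pop .inp setCur) (by rfl)
    simpa [ofBits, Function.update_eq_self_iff, hk.symm] using h
  | cons b bs ih =>
    obtain ⟨w, hw⟩ := ih (Function.update (Function.update r k
      (r k + if encodeBit b = .one then r 6 else 0)) 6 (2 * r 6))
    refine ⟨w, ?_⟩
    have h1 := (RunsIn.load (K := Stack) (Γ := Tok) (addBit k) (some (encodeBit b), y, r)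
      (Function.update S .inp (bs.map encodeBit ++ .sep :: rest))).seq (RunsIn.pop .inp setCur _ _)
    simp only [Function.update_self, Function.update_idem, setCur, addBit, Option.some.injEq] at h1
    refine Prog.RunsIn.congr_var (RunsIn.mono (RunsIn.loop_true ?_ h1 hw) ?_) ?_
    · cases b <;> rfl
    · simp; omega
    · congr 2
      funext j
      by_cases h6 : j = 6
      · subst h6; simp
      by_cases hj : j = k
      · subst hj
        cases b <;> simp [h6, encodeBit, ofBits] <;> ring
      · simp [h6, hj]

theorem readInt_runs {k : Fin 8} (hk : k ≠ 6) (y r) (a : ℤ) (hr : r 6 = 0) (S : Contents)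
    (rest : List Tok) :
    RunsIn (readInt k) (none, y, r) (Function.update S .inp (encodeInt a ++ rest))
      (none, y, Function.update r k a) (Function.update S .inp rest)
      (3 * (encodeInt a).length) := by
  have e : encodeInt a ++ rest =
      encodeBit (decide (a < 0)) :: (a.natAbs.bits.map encodeBit ++ .sep :: rest) := by
    simp [encodeInt]
  obtain ⟨w, hw⟩ := readInt_loop_runs hk y S rest a.natAbs.bits (Function.update
    (Function.update r 6 (if encodeBit (decide (a < 0)) = .one then -1 else 1)) k 0)
  have h1 := RunsIn.pop (K := Stack) (Γ := Tok) .inp (fun (v : Var) x => (none, v.2.1,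
    Function.update (Function.update v.2.2 6 (if x = some .one then -1 else 1)) k 0))
    (none, y, r) (Function.update S .inp (encodeInt a ++ rest))
  rw [e] at h1 ⊢
  have h2 := RunsIn.pop .inp setCur (none, y, Function.update
    (Function.update r 6 (if encodeBit (decide (a < 0)) = .one then -1 else 1)) k 0)
    (Function.update S .inp (a.natAbs.bits.map encodeBit ++ .sep :: rest))
  simp only [Function.update_self, Function.update_idem, setCur, List.head?_cons, List.tail_cons,
    Option.some.injEq] at h1 h2
  refine Prog.RunsIn.congr_var (RunsIn.mono (h1.seq (h2.seq (hw.seq (RunsIn.load (K := Stack)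
    (Γ := Tok) (fun v : Var => (none, v.2.1, Function.update v.2.2 6 0)) _ _)))) ?_) ?_
  · simp [encodeInt]; omega
  · congr 2
    funext j
    by_cases h6 : j = 6
    · subst h6; simp [hk.symm, hr]
    by_cases hj : j = k
    · subst hj
      simp only [ofBits_bits, ne_eq, h6, not_false_eq_true, Function.update_of_ne,
        Function.update_self, Ne.symm h6, zero_add]
      have : ((a.natAbs : ℤ) : ZMod 8) = (a.natAbs : ZMod 8) := by simp
      rw [← this]
      rcases lt_or_ge a 0 with h | h
      · rw [Int.natCast_natAbs, abs_of_neg h]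
        simp [h, encodeBit]
      · rw [Int.natCast_natAbs, abs_of_nonneg h]
        simp [not_lt.2 h, encodeBit]
    · simp [h6, hj]

/-! ### The translator -/


/-- Forget everything but the angles. -/
def keepAngles (v : Var) : Var := (v.1, v.2.1, regs (v.2.2 0) (v.2.2 1) 0 0 0 0)

/-- Read a term and write its gates; the first symbol of the term is the lookahead symbol. -/
def transTerm : Routine :=
  .ite (fun v => v.2.1 = some .termOne)
    (readNat .fst ;; readInt 2 ;; readInt 3 ;; emitOps oneOps ;; clear .fst ;; .load keepAngles)
    (readNat .fst ;; readNat .snd ;; readInt 2 ;; readInt 3 ;; readInt 4 ;; readInt 5 ;;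
      emitOps twoOps ;; clear .fst ;; clear .snd ;; .load keepAngles)

theorem readInt_mem_runs {k : Fin 8} (hk : k ≠ 6) (y r r') (a : ℤ) (hr : r 6 = 0)
    (hr' : Function.update r k (a : ZMod 8) = r') (rest txt base num outq post out fst snd) :
    RunsIn (readInt k) (none, y, r) (mem (encodeInt a ++ rest) txt base num outq post out fst snd)
      (none, y, r') (mem rest txt base num outq post out fst snd) (3 * (encodeInt a).length) := by
  have h := readInt_runs hk y r a hr (mem rest txt base num outq post out fst snd) rest
  rwa [update_mem_inp, update_mem_inp, hr'] at h

theorem update_regs_zero (a b c v₀ v₁ v₂ v₃ : ZMod 8) :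
    Function.update (regs b c v₀ v₁ v₂ v₃) 0 a = regs a c v₀ v₁ v₂ v₃ := by
  funext j; fin_cases j <;> rfl

theorem update_regs_one (a b c v₀ v₁ v₂ v₃ : ZMod 8) :
    Function.update (regs b c v₀ v₁ v₂ v₃) 1 a = regs b a v₀ v₁ v₂ v₃ := by
  funext j; fin_cases j <;> rfl

theorem update_regs_two (a b c v₀ v₁ v₂ v₃ : ZMod 8) :
    Function.update (regs b c v₀ v₁ v₂ v₃) 2 a = regs b c a v₁ v₂ v₃ := by
  funext j; fin_cases j <;> rfl

theorem update_regs_three (a b c v₀ v₁ v₂ v₃ : ZMod 8) :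
    Function.update (regs b c v₀ v₁ v₂ v₃) 3 a = regs b c v₀ a v₂ v₃ := by
  funext j; fin_cases j <;> rfl

theorem update_regs_four (a b c v₀ v₁ v₂ v₃ : ZMod 8) :
    Function.update (regs b c v₀ v₁ v₂ v₃) 4 a = regs b c v₀ v₁ a v₃ := by
  funext j; fin_cases j <;> rfl

theorem update_regs_five (a b c v₀ v₁ v₂ v₃ : ZMod 8) :
    Function.update (regs b c v₀ v₁ v₂ v₃) 5 a = regs b c v₀ v₁ v₂ a := by
  funext j; fin_cases j <;> rfl

theorem wires_twoOps : ∀ op ∈ twoOps, ∀ k ∈ op.wires, k = .fst ∨ k = .snd ∨ k = .num := by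
  simp [twoOps, andOps, Op.wires]

theorem transTerm_runs {n : ℕ} (t : Term n) (b c : ZMod 8) (m : ℕ) (hn : n ≤ m)
    (hm : t.encode.length ≤ m) (rest txt outq post out) :
    RunsIn transTerm (none, (t.encode ++ rest).head?, regs b c 0 0 0 0)
      (mem (t.encode ++ rest).tail txt [] (ones n) outq post out [] [])
      (none, (t.encode ++ rest).head?, regs b c 0 0 0 0)
      (mem rest (((termGates b c t).flatMap Gate.encode).reverse ++ txt) [] (ones n) outq post out
        [] []) (2500 * (m + 1)) := by
  cases t with
  | one i v =>
    have hi := i.2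
    have e : (Term.one i v).encode ++ rest =
        .termOne :: (encodeNat i ++ (encodeInt (v false) ++ (encodeInt (v true) ++ rest))) := by
      simp [Term.encode]
    rw [e, List.head?_cons, List.tail_cons]
    simp only [Term.encode, List.length_cons, List.length_append, length_encodeNat] at hm
    have h1 := readNat_runs (k := .fst) (by decide) none (some .termOne, regs b c 0 0 0 0)
      (mem (encodeNat i ++ (encodeInt (v false) ++ (encodeInt (v true) ++ rest))) txt [] (ones n)
        outq post out [] []) i _ rfl
    have h2 := readInt_mem_runs (k := 2) (by decide) (some .termOne) _ _ (v false) (by rfl)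
      (update_regs_two _ b c 0 0 0 0) (encodeInt (v true) ++ rest) txt [] (ones n) outq post out
      (ones i) []
    have h3 := readInt_mem_runs (k := 3) (by decide) (some .termOne) _ _ (v true) (by rfl)
      (update_regs_three _ b c (v false) 0 0 0) rest txt [] (ones n) outq post out (ones i) []
    have h4 := (Emits.emitOps (S := mem rest txt [] (ones n) outq post out (ones i) [])
      (some .termOne) (regs b c (v false) (v true) 0 0) rfl oneOps m (by
        simp [oneOps, Op.wires]; omega)).runs
    rw [← Op.flatMap_encode_flatMap_gates (place i i) _ _ (by simp [oneOps, Op.Valid]) _ (by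
        simp [oneOps, Op.wires, place])] at h4
    have h5 := (clear_runs .fst none (some .termOne, regs b c (v false) (v true) 0 0)
      (mem rest (((termGates b c (.one i v)).flatMap Gate.encode).reverse ++ txt) [] (ones n) outq
        post out (ones i) [])).seq (RunsIn.load keepAngles _ _)
    simp only [update_mem_inp, update_mem_fst, mem_fst, update_mem_txt, mem_txt, List.append_nil,
      List.length_replicate] at h1 h4 h5
    refine (RunsIn.ite_true (by rfl) (h1.seq (h2.seq (h3.seq (h4.seq h5))))).mono ?_
    simp only [oneOps, List.length_singleton]
    omega
  | two i j hij v =>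
    have hi := i.2
    have hj := j.2
    have e : (Term.two i j hij v).encode ++ rest = .termTwo :: (encodeNat i ++ (encodeNat j ++
        (encodeInt (v false false) ++ (encodeInt (v false true) ++ (encodeInt (v true false) ++
        (encodeInt (v true true) ++ rest)))))) := by
      simp [Term.encode]
    rw [e, List.head?_cons, List.tail_cons]
    simp only [Term.encode, List.length_cons, List.length_append, length_encodeNat] at hm
    obtain ⟨r4, hr4⟩ : ∃ l, l = encodeInt (v true true) ++ rest := ⟨_, rfl⟩
    obtain ⟨r3, hr3⟩ : ∃ l, l = encodeInt (v true false) ++ r4 := ⟨_, rfl⟩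
    obtain ⟨r2, hr2⟩ : ∃ l, l = encodeInt (v false true) ++ r3 := ⟨_, rfl⟩
    obtain ⟨r1, hr1⟩ : ∃ l, l = encodeInt (v false false) ++ r2 := ⟨_, rfl⟩
    rw [← hr4, ← hr3, ← hr2, ← hr1]
    have h1 := readNat_runs (k := .fst) (by decide) none (some .termTwo, regs b c 0 0 0 0)
      (mem (encodeNat i ++ (encodeNat j ++ r1)) txt [] (ones n) outq post out [] []) i _ rfl
    have h1' := readNat_runs (k := .snd) (by decide) none (some .termTwo, regs b c 0 0 0 0)
      (mem (encodeNat j ++ r1) txt [] (ones n) outq post out (ones i) []) j _ rfl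
    have h2 := readInt_mem_runs (k := 2) (by decide) (some .termTwo) _ _ (v false false) (by rfl)
      (update_regs_two _ b c 0 0 0 0) r2 txt [] (ones n) outq post out (ones i) (ones j)
    have h3 := readInt_mem_runs (k := 3) (by decide) (some .termTwo) _ _ (v false true) (by rfl)
      (update_regs_three _ b c (v false false) 0 0 0) r3 txt [] (ones n) outq post out (ones i)
      (ones j)
    have h4 := readInt_mem_runs (k := 4) (by decide) (some .termTwo) _ _ (v true false) (by rfl)
      (update_regs_four _ b c (v false false) (v false true) 0 0) r4 txt [] (ones n) outq post out
      (ones i) (ones j)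
    have h5 := readInt_mem_runs (k := 5) (by decide) (some .termTwo) _ _ (v true true) (by rfl)
      (update_regs_five _ b c (v false false) (v false true) (v true false) 0) rest txt [] (ones n)
      outq post out (ones i) (ones j)
    rw [← hr1] at h2
    rw [← hr2] at h3
    rw [← hr3] at h4
    rw [← hr4] at h5
    have h6 := (Emits.emitOps (S := mem rest txt [] (ones n) outq post out (ones i) (ones j))
      (some .termTwo) (regs b c (v false false) (v false true) (v true false) (v true true)) rfl
      twoOps m (by
        intro op hop k hk
        rcases wires_twoOps op hop k hk with rfl | rfl | rfl <;> simp <;> omega)).runs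
    rw [← Op.flatMap_encode_flatMap_gates (place i j) _ _ (twoOps_valid i j) _ (by
        intro op hop k hk
        rcases wires_twoOps op hop k hk with rfl | rfl | rfl <;> simp [place])] at h6
    have h7 := (clear_runs .fst none (some .termTwo,
      regs b c (v false false) (v false true) (v true false) (v true true))
      (mem rest (((termGates b c (.two i j hij v)).flatMap Gate.encode).reverse ++ txt) [] (ones n)
        outq post out (ones i) (ones j))).seq ((clear_runs .snd none _ _).seq
        (RunsIn.load keepAngles _ _))
    simp only [update_mem_inp, update_mem_fst, mem_fst, update_mem_snd, mem_snd, update_mem_txt,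
      mem_txt, List.append_nil, List.length_replicate] at h1 h1' h6 h7
    refine (RunsIn.ite_false (by rfl) (h1.seq (h1'.seq (h2.seq (h3.seq (h4.seq (h5.seq
      (h6.seq h7)))))))).mono ?_
    simp only [show twoOps.length = 33 by rfl]
    omega

end PostSel

namespace PostSel

open Prog

/-- Read the angles of all the layers; those of the last layer remain in the registers. -/
def readLayers : Routine :=
  .loop (fun v => v.2.1 = some .layer) (readInt 0 ;; readInt 1 ;; .pop .inp setLook)

def encodeLayer (l : ℤ × ℤ) : List Tok := .layer :: encodeInt l.1 ++ encodeInt l.2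

/-- Every layer overwrites the two angle registers, which yields `getLastD`; the initial value `l₀`
is general for the sake of the induction. -/
theorem readLayers_runs (ls : List (ℤ × ℤ)) (l₀ : ℤ × ℤ) (rest : List Tok)
    (hrest : rest.head? ≠ some .layer) (txt base num outq post out fst snd) :
    RunsIn readLayers (none, (ls.flatMap encodeLayer ++ rest).head?, regs l₀.1 l₀.2 0 0 0 0)
      (mem (ls.flatMap encodeLayer ++ rest).tail txt base num outq post out fst snd)
      (none, rest.head?, regs (ls.getLastD l₀).1 (ls.getLastD l₀).2 0 0 0 0)
      (mem rest.tail txt base num outq post out fst snd)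
      (3 * (ls.flatMap encodeLayer).length + 1) := by
  induction ls generalizing l₀ with
  | nil => exact RunsIn.loop_false (by simpa using hrest)
  | cons l ls ih =>
    have e : (l :: ls).flatMap encodeLayer ++ rest = .layer :: (encodeInt l.1 ++ (encodeInt l.2 ++
        (ls.flatMap encodeLayer ++ rest))) := by
      simp [encodeLayer]
    rw [e, List.head?_cons, List.tail_cons]
    have h1 := readInt_mem_runs (k := 0) (by decide) (some .layer) _ _ l.1 (by rfl)
      (update_regs_zero _ l₀.1 l₀.2 0 0 0 0) (encodeInt l.2 ++ (ls.flatMap encodeLayer ++ rest))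
      txt base num outq post out fst snd
    have h2 := readInt_mem_runs (k := 1) (by decide) (some .layer) _ _ l.2 (by rfl)
      (update_regs_one _ l.1 l₀.2 0 0 0 0) (ls.flatMap encodeLayer ++ rest)
      txt base num outq post out fst snd
    have h3 := h1.seq (h2.seq (RunsIn.pop .inp setLook _ _))
    simp only [mem_inp, update_mem_inp, setLook] at h3
    refine (RunsIn.loop_true (by rfl) h3 (ih l)).congr_var (by rw [List.getLastD_cons]) |>.mono ?_
    simp only [List.flatMap_cons, encodeLayer, List.cons_append, List.length_cons,
      List.length_append]
    omega

/-- Read all the terms and write their gates. -/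
def transTerms : Routine := .loop (fun v => v.2.1.isSome) (transTerm ;; .pop .inp setLook)

theorem transTerms_runs {n : ℕ} (ts : List (Term n)) (b c : ZMod 8) (m : ℕ) (hn : n ≤ m)
    (hm : (ts.flatMap Term.encode).length ≤ m) (txt outq post out) :
    RunsIn transTerms (none, (ts.flatMap Term.encode).head?, regs b c 0 0 0 0)
      (mem (ts.flatMap Term.encode).tail txt [] (ones n) outq post out [] [])
      (none, none, regs b c 0 0 0 0)
      (mem [] (((ts.flatMap (termGates b c)).flatMap Gate.encode).reverse ++ txt) [] (ones n) outq
        post out [] []) (2502 * ts.length * (m + 1) + 1) := by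
  induction ts generalizing txt with
  | nil => exact (RunsIn.loop_false (by rfl)).mono (by omega)
  | cons t ts ih =>
    rw [List.flatMap_cons, List.length_append] at hm
    rw [List.flatMap_cons]
    have h1 := (transTerm_runs t b c m hn (by omega) (ts.flatMap Term.encode) txt outq post
      out).seq (RunsIn.pop .inp setLook _ _)
    simp only [mem_inp, update_mem_inp, setLook] at h1
    refine ((RunsIn.loop_true ?_ h1 (ih (by omega) _)).congr_right ?_).mono ?_
    · cases t <;> rfl
    · simp
    · simp only [List.length_cons]
      ring_nf
      omega

/-- Assemble the description of the circuit. -/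
def assembleCircuit : Routine :=
  -- The first `.one` is the post-selection bit of the ancilla, the last qubit. The one pushed after
  -- the second `.sep` turns the count n into n + 1.
  move .txt .out ;; pushAll .out [.one] ;; move .post .out ;; pushAll .out [.sep] ;;
  addTo .outq .out ;; pushAll .out [.sep, .one] ;; addTo .num .out ;; clear .num ;; clear .outq

theorem assembleCircuit_runs (w) (txt : List Tok) (n q : ℕ) (post : List Tok) :
    RunsIn assembleCircuit (none, w) (mem [] txt [] (ones n) (ones q) post [] [] []) (none, w)
      (mem [] [] [] [] [] [] (encodeNat (n + 1) ++ (encodeNat q ++ (post.reverse ++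
        (.one :: txt.reverse)))) [] [])
      (3 * txt.length + 3 * post.length + 10 * n + 10 * q + 50) := by
  have a : ∀ k : Stack, k ≠ .out → k ≠ .tmp → ∀ S : Contents, S .tmp = [] → RunsIn (addTo k .out)
      (none, w) S (none, w) (Function.update S .out (ones (S k).length ++ S .out))
      (7 * (S k).length + 4) := fun k h h' S hS => addTo_runs h h' (by decide) none w S hS
  have h := (move_runs (k := .txt) (d := .out) (by decide) none w
    (mem [] txt [] (ones n) (ones q) post [] [] [])).seq
    ((pushAll_runs .out [.one] (none, w) _).seq
    ((move_runs (k := .post) (d := .out) (by decide) none w _).seq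
    ((pushAll_runs .out [.sep] (none, w) _).seq
    ((a .outq (by decide) (by decide) _ (by simp)).seq
    ((pushAll_runs .out [.sep, .one] (none, w) _).seq
    ((a .num (by decide) (by decide) _ (by simp)).seq
    ((clear_runs .num none w _).seq (clear_runs .outq none w _))))))))
  simp only [update_mem_txt, update_mem_num, update_mem_outq, update_mem_post,
    update_mem_out, mem_txt, mem_num, mem_outq, mem_post, mem_out, List.length_replicate] at h
  refine (h.congr_right ?_).mono ?_
  · congr 1
    simp [encodeNat, ones, List.replicate_add]
  · simp only [List.length_cons, List.length_nil]
    omega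

/-- The translator from QAOA circuits of depth one to circuits. -/
def transQAOA : Routine :=
  readNat .num ;; readNat .outq ;; readBits ;; forIdx (emitOps [.H .idx]) ;; readLayers ;;
    transTerms ;; forIdx (emitOps mixOps) ;; assembleCircuit ;; .load fun _ => (none, none, 0)

theorem QAOA.encode_toCircuit (Q : QAOA) : Q.toCircuit.encode =
    encodeNat (Q.n + 1) ++ (encodeNat Q.readout.out ++ (Q.readout.postBits ++
      (.one :: Q.toCircuit.gates.flatMap Gate.encode))) := by
  have h : (List.ofFn fun i : Fin (Q.n + 1) => encodeBit (decide
      (i ∈ Q.readout.castSucc.post))) = Q.readout.postBits ++ [.one] := by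
    rw [List.ofFn_succ', List.concat_eq_append, Readout.postBits]
    congr 2
    · simp [Readout.castSucc, Fin.castSucc_ne_last]
    · simp [Readout.castSucc, encodeBit]
  simp only [Circuit.encode, Readout.encode]
  change encodeNat (Q.n + 1) ++ (encodeNat Q.readout.out ++ (List.ofFn fun i : Fin (Q.n + 1) =>
    encodeBit (decide (i ∈ Q.readout.castSucc.post)))) ++ _ = _
  rw [h]
  simp

theorem transQAOA_runs (Q : QAOA) :
    RunsIn transQAOA (none, none, 0) (mem Q.encode [] [] [] [] [] [] [] [])
      (none, none, 0) (mem [] [] [] [] [] [] Q.toCircuit.encode [] [])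
      (20000 * (Q.encode.length + 1) ^ 2) := by
  rw [QAOA.encode_toCircuit]
  obtain ⟨n, rd, ls, ts⟩ := Q
  have hqn := rd.out.2
  obtain ⟨L, hL⟩ : ∃ L, L = (QAOA.mk n rd ls ts).encode.length := ⟨_, rfl⟩
  have henc : (QAOA.mk n rd ls ts).encode = encodeNat n ++ (encodeNat rd.out ++
      (rd.postBits ++ (ls.flatMap encodeLayer ++ ts.flatMap Term.encode))) := by
    have e : (fun l : ℤ × ℤ => .layer :: encodeInt l.1 ++ encodeInt l.2) = encodeLayer := rfl
    simp only [QAOA.encode, Readout.encode, Readout.postBits, e, List.append_assoc]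
  have hpb : rd.postBits.length = n := by simp [Readout.postBits]
  have hL' := hL
  rw [henc] at hL'
  simp only [List.length_append, length_encodeNat, hpb] at hL'
  have hts : (ts.flatMap Term.encode).head? ≠ some .layer ∧
      (ts.flatMap Term.encode).head? ≠ some .zero ∧ (ts.flatMap Term.encode).head? ≠ some .one := by
    cases ts with
    | nil => simp
    | cons t ts => cases t <;> simp [Term.encode]
  have h1 := readNat_runs (k := .num) (by decide) none (none, 0)
    (mem (QAOA.mk n rd ls ts).encode [] [] [] [] [] [] [] []) n _ henc
  have h2 := readNat_runs (k := .outq) (by decide) none (none, 0)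
    (mem (encodeNat rd.out ++ (rd.postBits ++ (ls.flatMap encodeLayer ++ ts.flatMap Term.encode)))
      [] [] (ones n) [] [] [] [] []) rd.out _ rfl
  simp only [update_mem_inp, update_mem_num, update_mem_outq, mem_num, mem_outq,
    List.append_nil] at h1 h2
  have h3 := readBits_runs rd.postBits (ls.flatMap encodeLayer ++ ts.flatMap Term.encode)
    rd.postBits_mem (by
      cases ls with
      | nil => simpa using hts.2
      | cons l ls => simp [encodeLayer]) none 0 [] [] (ones n) (ones rd.out) [] [] [] []
  rw [List.append_nil] at h3
  have h4 := (Emits.forIdx_emitOps (ls.flatMap encodeLayer ++ ts.flatMap Term.encode).head? 0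
    [.H .idx] (by simp [Op.wires]) n L (by omega)
    (ls.flatMap encodeLayer ++ ts.flatMap Term.encode).tail [] [] (ones rd.out)
    rd.postBits.reverse [] [] []).runs
  have h0 : regs ((0 : ℤ × ℤ).1 : ℤ) ((0 : ℤ × ℤ).2 : ℤ) 0 0 0 0 = 0 := by
    funext j; fin_cases j <;> rfl
  have h5 := readLayers_runs ls 0 (ts.flatMap Term.encode) hts.1
    (((allGates n 0 [.H .idx]).flatMap Gate.encode).reverse) [] (ones n) (ones rd.out)
    rd.postBits.reverse [] [] []
  rw [h0] at h5
  obtain ⟨l, hl⟩ : ∃ l, l = ls.getLastD 0 := ⟨_, rfl⟩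
  rw [← hl] at h5
  have h6 := transTerms_runs ts l.1 l.2 L (by omega) (by omega)
    (((allGates n 0 [.H .idx]).flatMap Gate.encode).reverse) (ones rd.out) rd.postBits.reverse []
  have h7 := (Emits.forIdx_emitOps none (regs l.1 l.2 0 0 0 0) mixOps
    (by simp [mixOps, Op.wires]) n L (by omega) []
    ((((ts.flatMap (termGates l.1 l.2)).flatMap Gate.encode).reverse ++
      ((allGates n 0 [.H .idx]).flatMap Gate.encode).reverse)) [] (ones rd.out)
    rd.postBits.reverse [] [] []).runs
  simp only [update_mem_txt, mem_txt, List.append_nil] at h4 h7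
  have hlen := (h4.seq (h5.seq (h6.seq h7))).length_le .txt
  -- The concluding `load` clears the angle registers, since a machine has to halt with its initial
  -- variable.
  have h8 := fun txt => (assembleCircuit_runs (none, regs l.1 l.2 0 0 0 0) txt n rd.out
    rd.postBits.reverse).seq (RunsIn.load (fun _ : Var => (none, none, 0)) _ _)
  refine ((h1.seq (h2.seq (h3.seq (h4.seq (h5.seq (h6.seq (h7.seq (h8 _)))))))).congr_right ?_).mono ?_
  · congr 1
    simp only [QAOA.toCircuit]
    change _ = encodeNat (n + 1) ++ (encodeNat rd.out ++ (rd.postBits ++ (.one :: List.flatMap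
      Gate.encode (allGates n 0 [.H .idx] ++ (ts.flatMap (termGates (ls.getLastD 0).1
        (ls.getLastD 0).2) ++ allGates n (regs (ls.getLastD 0).1 (ls.getLastD 0).2 0 0 0 0)
          mixOps)))))
    rw [← hl]
    simp
  · have hT := length_le_length_flatMap Term.encode (by intro t; cases t <;> simp [Term.encode]) ts
    rw [← hL]
    simp only [mem_txt, List.length_nil, Nat.zero_add] at hlen
    simp only [List.length_reverse, hpb]
    have a1 : (64 * [Op.H .idx].length * (L + 1) + 15) * n ≤ (64 * (L + 1) + 15) * L :=
      Nat.mul_le_mul (by simp) (by omega)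
    have a2 : (64 * mixOps.length * (L + 1) + 15) * n ≤ (192 * (L + 1) + 15) * L :=
      Nat.mul_le_mul (by simp [mixOps]) (by omega)
    have a3 : 2502 * ts.length * (L + 1) ≤ 2502 * L * (L + 1) :=
      Nat.mul_le_mul_right _ (by omega)
    have b1 : (64 * (L + 1) + 15) * L = 64 * (L * L) + 79 * L := by ring
    have b2 : (192 * (L + 1) + 15) * L = 192 * (L * L) + 207 * L := by ring
    have b3 : 2502 * L * (L + 1) = 2502 * (L * L) + 2502 * L := by ring
    have b4 : (L + 1) ^ 2 = L * L + 2 * L + 1 := by ring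
    rw [b1] at a1
    rw [b2] at a2
    rw [b3] at a3
    rw [b4]
    generalize L * L = q at *
    omega

/-- The translation of QAOA circuits into circuits takes polynomial time. -/
theorem polyTime_toCircuit : PolyTime QAOA.encode Circuit.encode QAOA.toCircuit := by
  refine Prog.polyTime transQAOA .inp .out (none, none, 0) (20000 * (.X + 1) ^ 2) fun Q => ?_
  rw [update_nil_inp, update_nil_out]
  simpa using transQAOA_runs Q

end PostSel

/-! ### Assembly of the three statements. -/

namespace PostSel

theorem Circuit.answers_toQAOA (C : Circuit) {ε : ℝ} {yes : Prop}
    (h : Answers C.state C.readout ε yes) :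
    Answers C.toQAOA.state C.toQAOA.readout ε yes :=
  ⟨C.prob_postEvent_toQAOA_ne_zero.2 h.1,
    fun hy => (h.2.1 hy).trans_eq (C.condProb_toQAOA {z | z C.readout.out = true}).symm,
    fun hy => (h.2.2 hy).trans_eq (C.condProb_toQAOA {z | z C.readout.out = false}).symm⟩

/-- Every language in `PostBQP` is decided by QAOA circuits of depth one and degree at most three. -/
theorem exists_uniformQAOA (L : Language Bool) (hL : L ∈ PostBQP) :
    ∃ ε : ℝ, 0 < ε ∧ ε < 1 / 2 ∧ ∃ Q : List Bool → QAOA, UniformQAOA Q ∧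
      ∀ w, (Q w).angles = [(Real.pi / 4, Real.pi / 4)] ∧ (Q w).interactionDegree ≤ 3 ∧
        Answers (Q w).state (Q w).readout ε (w ∈ L) := by
  obtain ⟨ε, h0, h1, C, hC, h⟩ := hL
  exact ⟨ε, h0, h1, Circuit.toQAOA ∘ C, PolyTime.comp polyTime_toQAOA hC, fun w =>
    ⟨(C w).angles_toQAOA, (C w).interactionDegree_toQAOA, (C w).answers_toQAOA (h w)⟩⟩

end PostSel

theorem theorem3p2 :
    -- bounded-error decision at depth 1, degree at most 3, with `β = γ = π / 4`
    (∀ L ∈ PostSel.PostBQP, ∃ ε : ℝ, 0 < ε ∧ ε < 1 / 2 ∧ ∃ Q : List Bool → PostSel.QAOA,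
      PostSel.UniformQAOA Q ∧
      ∀ w, (Q w).angles = [(Real.pi / 4, Real.pi / 4)] ∧ (Q w).interactionDegree ≤ 3 ∧
        PostSel.Answers (Q w).state (Q w).readout ε (w ∈ L)) ∧
    -- equality of the two classes
    PostSel.PostQAOA 1 3 = PostSel.PostBQP ∧
    -- a polynomial-time reduction between circuits that preserves the post-selected joint
    -- distribution of all the original qubits, the output qubit among them
    (∃ R : PostSel.Circuit → PostSel.QAOA,
      PostSel.PolyTime PostSel.Circuit.encode PostSel.QAOA.encode R ∧
      ∀ C : PostSel.Circuit,
        (R C).angles = [(Real.pi / 4, Real.pi / 4)] ∧ (R C).interactionDegree ≤ 3 ∧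
        (PostSel.prob (R C).state (R C).readout.postEvent ≠ 0 ↔
          PostSel.prob C.state C.readout.postEvent ≠ 0) ∧
        ∃ ι : Fin C.n ↪ Fin (R C).n, ι C.readout.out = (R C).readout.out ∧
          ∀ z : Fin C.n → Bool,
            PostSel.condProb (R C).state (R C).readout {z' | ∀ i, z' (ι i) = z i} =
              PostSel.condProb C.state C.readout {z}) := by
  refine ⟨PostSel.exists_uniformQAOA, Set.Subset.antisymm ?_ ?_, PostSel.Circuit.toQAOA,
    PostSel.polyTime_toQAOA, fun C => ⟨C.angles_toQAOA, C.interactionDegree_toQAOA,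
      C.prob_postEvent_toQAOA_ne_zero, C.lastVar, rfl, fun z => ?_⟩⟩
  · rintro L ⟨ε, h0, h1, Q, hQ, h⟩
    exact ⟨ε, h0, h1, PostSel.QAOA.toCircuit ∘ Q,
      PostSel.PolyTime.comp PostSel.polyTime_toCircuit hQ, fun w =>
      (Q w).answers_toCircuit (h w).1 (h w).2.2⟩
  · intro L hL
    obtain ⟨ε, h0, h1, Q, hQ, h⟩ := PostSel.exists_uniformQAOA L hL
    refine ⟨ε, h0, h1, Q, hQ, fun w => ⟨?_, (h w).2⟩⟩
    -- There is one pair of angles per layer, so the list of angles determines the depth.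
    have := congrArg List.length (h w).1
    simpa [PostSel.QAOA.angles, PostSel.QAOA.depth] using this
  -- The joint distribution is the special case of singleton events of the equality for all events.
  · rw [← C.condProb_toQAOA {z}]
    congr 1
    ext z'
    exact funext_iff.symm
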